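/- Let $X_1(2,12)$ be the elliptic curve $y^2=x^3-x^2+x$ over $\mathbb{Q}$. Its cusps are the point at infinity and the points with $$x(x-1)(x+1)(x^2-x+1)(x^2+1)(x^2-4x+1)=0.$$ For a quadratic field $K$ with discriminant $\Delta_K$, its non-cuspidal $K$-rational points parametrize the isomorphism classes of triples $(E,P,Q)$, where $E$ is an elliptic curve over $K$ and $P,Q\in E(K)$ are points of orders $2$ and $12$ that generate a subgroup isomorphic to $\mathbb{Z}/2\mathbb{Z}\oplus\mathbb{Z}/12\mathbb{Z}$: with $m=\frac{y+1}{x-1}$, $c=\frac{m(m+1)(m^2+m+1)}{m+2}$ and $b=\frac{c(m^2+2m+2)}{m+2}$, the point $(x,y)$ corresponds to the curve $Y^2+(1-c)XY-bY=X^3-bX^2$ with $Q=(0,0)$ and with $P$ the point of order $2$ with $X$-coordinate $\frac{m(m^2+2m+2)(2+2m+m^2+xm^2-m^4)}{4(m+2)}$; every such triple is isomorphic over $K$ to the triple of exactly one non-cuspidal $K$-rational point. 1. Among the quadratic fields $K$ over which some elliptic curve $E$ has $E(K)_{tors}\simeq\mathbb{Z}/2\mathbb{Z}\oplus\mathbb{Z}/12\mathbb{Z}$,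 the field $\mathbb{Q}(\sqrt{13})$, of discriminant $13$, is the unique one with the smallest $|\Delta_K|$. 2. Among the quadratic fields $K$ such that $X_1(2,12)(K)$ has positive rank, $\mathbb{Q}(\sqrt{13})$ is the unique one with the smallest $|\Delta_K|$. 3. $X_1(2,12)(\mathbb{Q})_{tors}\simeq\mathbb{Z}/4\mathbb{Z}$. For every quadratic field $K$ other than $\mathbb{Q}(i)$, $\mathbb{Q}(\sqrt{3})$ and $\mathbb{Q}(\sqrt{-3})$ one has $X_1(2,12)(K)_{tors}=X_1(2,12)(\mathbb{Q})_{tors}\simeq\mathbb{Z}/4\mathbb{Z}$. For every quadratic field $K$, including these three, all points of $X_1(2,12)(K)_{tors}$ are cusps. 4. Over $\mathbb{Q}(\sqrt{13})$, the elliptic curve $$y^2+(134025-37172\sqrt{13})xy+(47915630355840-13289404780320\sqrt{13})y=x^3+(3775925760\sqrt{13}-13614293940)x^2$$ has torsion group isomorphic to $\mathbb{Z}/2\mathbb{Z}\oplus\mathbb{Z}/12\mathbb{Z}$, generated by the points $$(954691712-264783840\sqrt{13},\ 42132429627392\sqrt{13}-151910635381440)$$ and $$(3993089880-1107483870\sqrt{13},\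 176222937989280\sqrt{13}-635380838833260).$$ -/

import Mathlib

open WeierstrassCurve

universe u

/-- The subfield `ℚ(√d)` of the complex numbers. -/
noncomputable abbrev QSqrt (d : ℤ) : IntermediateField ℚ ℂ :=
  IntermediateField.adjoin ℚ {z : ℂ | z ^ 2 = (d : ℂ)}

theorem finite_setOf_sq_eq (d : ℤ) : {z : ℂ | z ^ 2 = (d : ℂ)}.Finite := by
  refine (Polynomial.finite_setOfPred_isRoot
    (Polynomial.X_pow_sub_C_ne_zero (n := 2) two_pos (d : ℂ))).subset ?_
  intro z hz
  simpa [Polynomial.IsRoot, sub_eq_zero] using hz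

instance QSqrt.numberField (d : ℤ) : NumberField (QSqrt d) where
  to_charZero := inferInstance
  to_finiteDimensional := by
    have : Finite {z : ℂ | z ^ 2 = (d : ℂ)} := (finite_setOf_sq_eq d).to_subtype
    have h : FiniteDimensional ℚ (QSqrt d) := IntermediateField.finiteDimensional_adjoin
      fun z hz => ⟨Polynomial.X ^ 2 - Polynomial.C (d : ℚ),
        Polynomial.monic_X_pow_sub_C _ two_ne_zero, by
          have hz' : z ^ 2 = (d : ℂ) := hz
          rw [Polynomial.eval₂_sub, Polynomial.eval₂_X_pow, Polynomial.eval₂_C, hz']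
          simp⟩
    convert h

section

open scoped Classical in
/-- The torsion subgroup `W(K)_tors` of the group of `K`-rational points of `W`. -/
noncomputable def torsionPoints {K : Type*} [Field K] (W : WeierstrassCurve K) :
    AddSubgroup W.toAffine.Point :=
  AddCommGroup.torsion W.toAffine.Point

open scoped Classical in
/-- The torsion subgroup of `W(K)` is isomorphic to `ℤ/2ℤ ⊕ ℤ/12ℤ`. -/
def HasTorsionTwoTwelve {K : Type*} [Field K] (W : WeierstrassCurve K) : Prop :=
  Nonempty (torsionPoints W ≃+ ZMod 2 × ZMod 12)

open scoped Classical in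
/-- The torsion subgroup of `W(K)` is isomorphic to `ℤ/4ℤ`. -/
def HasTorsionFour {K : Type*} [Field K] (W : WeierstrassCurve K) : Prop :=
  Nonempty (torsionPoints W ≃+ ZMod 4)

/-- `ℤ/2ℤ ⊕ ℤ/12ℤ` appears as the torsion group of an elliptic curve over `K`. -/
def TwoTwelveAppearsOver (K : Type*) [Field K] : Prop :=
  ∃ W : WeierstrassCurve K, W.IsElliptic ∧ HasTorsionTwoTwelve W

/-- The elliptic curve `X₁(2,12) : y² = x³ - x² + x` over `ℚ`. -/
def X₁TwoTwelve : WeierstrassCurve ℚ := ⟨0, -1, 0, 1, 0⟩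

/-- The cusps of `X₁(2,12)`: the point at infinity, and the points whose `x`-coordinate satisfies
`x(x - 1)(x + 1)(x² - x + 1)(x² + 1)(x² - 4x + 1) = 0`. -/
def IsX₁Cusp {K : Type*} [Field K] [Algebra ℚ K] : (X₁TwoTwelve⁄K).toAffine.Point → Prop
  | .zero => True
  | .some x _ _ =>
      x * (x - 1) * (x + 1) * (x ^ 2 - x + 1) * (x ^ 2 + 1) * (x ^ 2 - 4 * x + 1) = 0

open scoped Classical in
/-- The Mordell-Weil group `X₁(2,12)(K)` has positive rank. -/
def X₁TwoTwelveHasPositiveRank (K : Type*) [Field K] [Algebra ℚ K] : Prop :=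
  0 < Module.rank ℤ (X₁TwoTwelve⁄K).toAffine.Point

open scoped Classical in
/-- The inclusion `X₁(2,12)(ℚ) → X₁(2,12)(K)`. -/
noncomputable def X₁TwoTwelveBaseChange (K : Type*) [Field K] [Algebra ℚ K]
    (S : (X₁TwoTwelve⁄ℚ).toAffine.Point) : (X₁TwoTwelve⁄K).toAffine.Point :=
  Affine.Point.baseChange (W' := X₁TwoTwelve.toAffine) ℚ K S

open scoped Classical in
/-- A triple `(E, P, Q)`: an elliptic curve `E` over `K`, and `K`-rational points `P` of order `2`
and `Q` of order `12` that generate a subgroup isomorphic to `ℤ/2ℤ ⊕ ℤ/12ℤ`. -/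
structure TwoTwelveTriple (K : Type*) [Field K] where
  W : WeierstrassCurve K
  isElliptic : W.IsElliptic
  P : W.toAffine.Point
  Q : W.toAffine.Point
  addOrderOf_P : addOrderOf P = 2
  addOrderOf_Q : addOrderOf Q = 12
  generate : Nonempty (AddSubgroup.closure {P, Q} ≃+ ZMod 2 × ZMod 12)

/-- The isomorphism `W → C • W` given by the change of variables `C` carries the point `P` of `W`
to the affine point with coordinates `(x, y)`. -/
def Carries {K : Type*} [Field K] (C : VariableChange K) {W : WeierstrassCurve K}
    (P : W.toAffine.Point) (x y : K) : Prop :=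
  ∃ h, P = .some ((C.u : K) ^ 2 * x + C.r) ((C.u : K) ^ 3 * y + (C.u : K) ^ 2 * C.s * x + C.t) h

namespace Fibre

variable {K : Type*} [Field K] (x y : K)

/-- The parameter `m = (y + 1) / (x - 1)` on `X₁(2,12)`. -/
def m : K := (y + 1) / (x - 1)

/-- The parameter `c` of the Tate normal form. -/
def c : K := m x y * (m x y + 1) * (m x y ^ 2 + m x y + 1) / (m x y + 2)

/-- The parameter `b` of the Tate normal form. -/
def b : K := c x y * (m x y ^ 2 + 2 * m x y + 2) / (m x y + 2)

/-- The universal curve over `X₁(2,12)`: its fibre at the point `(x, y)` is the curve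
`Y² + (1 - c)XY - bY = X³ - bX²`, on which `(0, 0)` is the point of order `12`. -/
def curve : WeierstrassCurve K := ⟨1 - c x y, -b x y, -b x y, 0, 0⟩

/-- The `X`-coordinate of the point of order `2` on the fibre. -/
def pX : K :=
  m x y * (m x y ^ 2 + 2 * m x y + 2) *
    (2 + 2 * m x y + m x y ^ 2 + x * m x y ^ 2 - m x y ^ 4) / (4 * (m x y + 2))

/-- The `Y`-coordinate of the point of order `2` on the fibre. -/
def pY : K := (b x y - (1 - c x y) * pX x y) / 2

end Fibre

/-- The point `R` of `X₁(2,12)(K)` represents the triple `T`: some isomorphism over `K` carries `T`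
to the fibre of the universal triple at `R`. -/
def Represents {K : Type*} [Field K] [Algebra ℚ K] :
    (X₁TwoTwelve⁄K).toAffine.Point → TwoTwelveTriple K → Prop
  | .zero, _ => False
  | .some x y _, T => ∃ C : VariableChange K, C • T.W = Fibre.curve x y ∧
      Carries C T.P (Fibre.pX x y) (Fibre.pY x y) ∧ Carries C T.Q 0 0

/-- The curve `Y² + (134025 - 37172w)XY + (47915630355840 - 13289404780320w)Y
= X³ + (3775925760w - 13614293940)X²`. -/
def exampleCurve {K : Type*} [Field K] (w : K) : WeierstrassCurve K :=
  ⟨134025 - 37172 * w, 3775925760 * w - 13614293940, 47915630355840 - 13289404780320 * w, 0, 0⟩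

open scoped Classical in
/-- The points with coordinates `(x₁, y₁)` and `(x₂, y₂)` lie on `W` and generate the torsion
subgroup of `W(K)`. -/
def GenerateTorsion {K : Type*} [Field K] (W : WeierstrassCurve K) (x₁ y₁ x₂ y₂ : K) : Prop :=
  ∃ (h₁ : W.toAffine.Nonsingular x₁ y₁) (h₂ : W.toAffine.Nonsingular x₂ y₂),
    AddSubgroup.closure {Affine.Point.some x₁ y₁ h₁, Affine.Point.some x₂ y₂ h₂} = torsionPoints W

end

/-! Write E for y² = x³ - x² + x. The moduli statement is Tate's normal form. Moving Q to the origin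
with horizontal tangent and scaling leaves only the parameters b, c, and the condition 12Q = 0 makes
both rational functions of one parameter m. The 2-division polynomial of the resulting curve splits
off the abscissa of 6Q; the remaining quadratic factor becomes, after an affine substitution, x² -
m²x + (m+1)² = 0. This is the residual intersection of E with the line of slope m through (1, -1).
The values of m where the curve degenerates are those of the cusps (`cusp_polynomial_eq_zero_iff`,
`exists_point_represents`, `represents_unique`).

Torsion over a quadratic field K is controlled at a prime above 2. Modulo 2 the curve E has a
singular point with x = 1; nevertheless 8P always lies in the set where x has a pole or the point is
zero (`inKernel_eight`, which needs the ramification index to be at most 2). There doubling lowers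
the valuation of x by exactly 2·v(2). Hence this set contains no nonzero torsion point, and E(K)
contains no nonzero point that is infinitely divisible by 2. So torsion is killed by 8, and since K
cannot contain square roots of both -1 and -3, solving 8P = 0 gives only cusps. A non-cuspidal point
therefore has infinite order.

For |Δ| < 13 the rank is zero. With σ the conjugation of K = ℚ(√d), 2P is the sum of P + σP, which
is rational, and P - σP, which comes from the twist by d. A descent through the 2-isogeny on these
twists shows that each of their points is a double up to a point killed by 4 (`twist_halvable`).
Iterating makes 8P infinitely divisible by 2 in E(K), hence zero. Neither heights nor the
Mordell-Weil theorem is used.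

For Δ = 13 the point (4, -2√13) of E gives the explicit curve. Its two points generate a group of
order 24. The prime 23 splits in ℚ(√13), both reductions have 24 points, and torsion injects into
them because the kernel of reduction in `ℚ_[p]` is torsion-free (`eq_zero_of_isOfFinAddOrder`). -/

/-! ### Chord and tangent formulas with the slope as a witness. -/

section PointFormulas

variable {F : Type*} [Field F] [DecidableEq F] {W : WeierstrassCurve F}

theorem WeierstrassCurve.add_eq_of_chord {x₁ y₁ x₂ y₂ x₃ y₃ l : F}
    (h₁ : W.toAffine.Nonsingular x₁ y₁) (h₂ : W.toAffine.Nonsingular x₂ y₂) (hx : x₁ ≠ x₂)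
    (hl : l * (x₁ - x₂) = y₁ - y₂) (hx₃ : x₃ = l ^ 2 + W.a₁ * l - W.a₂ - x₁ - x₂)
    (hy₃ : y₃ = -(l * (x₃ - x₁) + y₁) - W.a₁ * x₃ - W.a₃) :
    ∃ h₃, (Affine.Point.some x₁ y₁ h₁ + Affine.Point.some x₂ y₂ h₂ : W.toAffine.Point) =
      Affine.Point.some x₃ y₃ h₃ := by
  have hs : W.toAffine.slope x₁ x₂ y₁ y₂ = l := by
    rw [Affine.slope_of_X_ne hx, div_eq_iff (sub_ne_zero.2 hx), hl]
  have hX : W.toAffine.addX x₁ x₂ (W.toAffine.slope x₁ x₂ y₁ y₂) = x₃ := by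
    rw [hs, hx₃]; simp [Affine.addX]
  have hY : W.toAffine.addY x₁ x₂ y₁ (W.toAffine.slope x₁ x₂ y₁ y₂) = y₃ := by
    rw [Affine.addY, Affine.negAddY, hX, hs, hy₃]; simp [Affine.negY]
  have := Affine.nonsingular_add h₁ h₂ fun hxy => hx hxy.1
  rw [hX, hY] at this
  refine ⟨this, ?_⟩
  rw [Affine.Point.add_of_X_ne hx]
  simp only [hX, hY]

theorem WeierstrassCurve.add_self_eq_of_tangent {x₁ y₁ x₃ y₃ l : F}
    (h₁ : W.toAffine.Nonsingular x₁ y₁) (hy : 2 * y₁ + W.a₁ * x₁ + W.a₃ ≠ 0)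
    (hl : l * (2 * y₁ + W.a₁ * x₁ + W.a₃) = 3 * x₁ ^ 2 + 2 * W.a₂ * x₁ + W.a₄ - W.a₁ * y₁)
    (hx₃ : x₃ = l ^ 2 + W.a₁ * l - W.a₂ - 2 * x₁)
    (hy₃ : y₃ = -(l * (x₃ - x₁) + y₁) - W.a₁ * x₃ - W.a₃) :
    ∃ h₃, (Affine.Point.some x₁ y₁ h₁ + Affine.Point.some x₁ y₁ h₁ : W.toAffine.Point) =
      Affine.Point.some x₃ y₃ h₃ := by
  have hy' : y₁ ≠ W.toAffine.negY x₁ y₁ := by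
    intro h; apply hy; rw [Affine.negY] at h; linear_combination h
  have hs : W.toAffine.slope x₁ x₁ y₁ y₁ = l := by
    rw [Affine.slope_of_Y_ne rfl hy', div_eq_iff (sub_ne_zero.2 hy'), ← hl, Affine.negY]; ring
  have hX : W.toAffine.addX x₁ x₁ (W.toAffine.slope x₁ x₁ y₁ y₁) = x₃ := by
    rw [hs, hx₃]; simp [Affine.addX]; ring
  have hY : W.toAffine.addY x₁ x₁ y₁ (W.toAffine.slope x₁ x₁ y₁ y₁) = y₃ := by
    rw [Affine.addY, Affine.negAddY, hX, hs, hy₃]; simp [Affine.negY]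
  have := Affine.nonsingular_add h₁ h₁ fun hxy => hy' hxy.2
  rw [hX, hY] at this
  refine ⟨this, ?_⟩
  rw [Affine.Point.add_self_of_Y_ne hy']
  simp only [hX, hY]

theorem WeierstrassCurve.add_self_eq_zero {x y : F} (h : W.toAffine.Nonsingular x y)
    (hy : 2 * y + W.a₁ * x + W.a₃ = 0) :
    (Affine.Point.some x y h + Affine.Point.some x y h : W.toAffine.Point) = 0 := by
  apply Affine.Point.add_self_of_Y_eq
  rw [Affine.negY]; linear_combination hy

end PointFormulas

/-! ### Field embeddings followed by changes of variables, as group homomorphisms. -/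

section ModelChange

/-- The curve `W'` is the image of `W` under the embedding `f` of fields, followed by the change of
variables `(X, Y) ↦ (u²X + r, u³Y + u²sX + t)`. -/
structure IsModelChange {F K : Type*} [Field F] [Field K] (f : F →+* K) (W : WeierstrassCurve F)
    (W' : WeierstrassCurve K) (u r s t : K) : Prop where
  u_ne : u ≠ 0
  a₁ : u * W'.a₁ = f W.a₁ + 2 * s
  a₂ : u ^ 2 * W'.a₂ = f W.a₂ - s * f W.a₁ + 3 * r - s ^ 2
  a₃ : u ^ 3 * W'.a₃ = f W.a₃ + r * f W.a₁ + 2 * t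
  a₄ : u ^ 4 * W'.a₄ = f W.a₄ - s * f W.a₃ + 2 * r * f W.a₂ - (t + r * s) * f W.a₁ + 3 * r ^ 2
    - 2 * s * t
  a₆ : u ^ 6 * W'.a₆ = f W.a₆ + r * f W.a₄ + r ^ 2 * f W.a₂ + r ^ 3 - t * f W.a₃ - t ^ 2
    - r * t * f W.a₁

variable {F K : Type*} [Field F] [Field K] {f : F →+* K} {W : WeierstrassCurve F}
  {W' : WeierstrassCurve K} {u r s t : K}

namespace IsModelChange

theorem nonsingular (H : IsModelChange f W W' u r s t) {x y : F} {X Y : K}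
    (hX : f x = u ^ 2 * X + r) (hY : f y = u ^ 3 * Y + u ^ 2 * s * X + t)
    (h : W.toAffine.Nonsingular x y) : W'.toAffine.Nonsingular X Y := by
  obtain ⟨hu, h1, h2, h3, h4, h6⟩ := H
  rw [Affine.nonsingular_iff, Affine.equation_iff] at h ⊢
  obtain ⟨he, hn⟩ := h
  have he' := congrArg f he
  simp only [map_add, map_mul, map_pow, hX, hY] at he'
  refine ⟨?_, ?_⟩
  · apply mul_left_cancel₀ (pow_ne_zero 6 hu)
    linear_combination he' + u ^ 5 * X * Y * h1 + u ^ 3 * Y * h3 - u ^ 4 * X ^ 2 * h2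
      - u ^ 2 * X * h4 - h6
  · by_contra hcon
    push Not at hcon
    obtain ⟨c1, c2⟩ := hcon
    have c2' : 2 * f y + f W.a₁ * f x + f W.a₃ = 0 := by
      rw [hX, hY]
      linear_combination u ^ 3 * c2 - u ^ 2 * X * h1 - h3
    have c1' : f W.a₁ * f y - (3 * f x ^ 2 + 2 * f W.a₂ * f x + f W.a₄) = 0 := by
      rw [hX, hY] at c2' ⊢
      linear_combination u ^ 4 * c1 - u ^ 3 * Y * h1 + 2 * u ^ 2 * X * h2 + h4 - s * c2'
    rcases hn with hn | hn
    · apply hn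
      apply f.injective
      simp only [map_add, map_mul, map_pow, map_ofNat]
      linear_combination c1'
    · apply hn
      apply f.injective
      simp only [map_sub, map_neg, map_mul]
      linear_combination c2'

theorem map_x (H : IsModelChange f W W' u r s t) (x : F) :
    f x = u ^ 2 * ((f x - r) / u ^ 2) + r := by
  have := H.u_ne; field_simp; ring

theorem map_y (H : IsModelChange f W W' u r s t) (x y : F) :
    f y = u ^ 3 * ((f y - t - s * (f x - r)) / u ^ 3) + u ^ 2 * s * ((f x - r) / u ^ 2) + t := by
  have := H.u_ne; field_simp; ring

/-- The map on points attached to a change of model. -/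
def mapPoint (H : IsModelChange f W W' u r s t) : W.toAffine.Point → W'.toAffine.Point
  | .zero => .zero
  | .some x y h => .some ((f x - r) / u ^ 2) ((f y - t - s * (f x - r)) / u ^ 3)
      (H.nonsingular (H.map_x x) (H.map_y x y) h)

theorem exists_mapPoint_some (H : IsModelChange f W W' u r s t) {x y : F} {X Y : K}
    (hX : f x = u ^ 2 * X + r) (hY : f y = u ^ 3 * Y + u ^ 2 * s * X + t)
    (h : W.toAffine.Nonsingular x y) : ∃ h', H.mapPoint (.some x y h) = .some X Y h' := by
  have := H.u_ne
  refine ⟨H.nonsingular hX hY h, ?_⟩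
  simp only [mapPoint, Affine.Point.some.injEq]
  constructor
  · rw [hX]; field_simp; ring
  · rw [hX, hY]; field_simp; ring

variable [DecidableEq F] [DecidableEq K]

theorem mapPoint_add (H : IsModelChange f W W' u r s t) (P Q : W.toAffine.Point) :
    H.mapPoint (P + Q) = H.mapPoint P + H.mapPoint Q := by
  have hu := H.u_ne
  have zl : ∀ P : W.toAffine.Point, .zero + P = P := zero_add
  have zr : ∀ P : W.toAffine.Point, P + .zero = P := add_zero
  have zl' : ∀ P : W'.toAffine.Point, .zero + P = P := zero_add
  have zr' : ∀ P : W'.toAffine.Point, P + .zero = P := add_zero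
  rcases P with _ | ⟨x₁, y₁, h₁⟩
  · rw [zl, mapPoint, zl']
  rcases Q with _ | ⟨x₂, y₂, h₂⟩
  · rw [zr]; conv_rhs => rw [mapPoint.eq_def H .zero]
    exact (zr' _).symm
  -- A line of slope l is carried to a line of slope (f l - s) / u; both the chord and the tangent
  -- case reduce to this computation.
  have key (l : F) (x₃ y₃ : F) (hx₃ : x₃ = l ^ 2 + W.a₁ * l - W.a₂ - x₁ - x₂)
      (hy₃ : y₃ = -(l * (x₃ - x₁) + y₁) - W.a₁ * x₃ - W.a₃) :
      (f x₃ - r) / u ^ 2 = ((f l - s) / u) ^ 2 + W'.a₁ * ((f l - s) / u) - W'.a₂ -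
        (f x₁ - r) / u ^ 2 - (f x₂ - r) / u ^ 2 ∧
      (f y₃ - t - s * (f x₃ - r)) / u ^ 3 =
        -((f l - s) / u * ((f x₃ - r) / u ^ 2 - (f x₁ - r) / u ^ 2) +
        (f y₁ - t - s * (f x₁ - r)) / u ^ 3) - W'.a₁ * ((f x₃ - r) / u ^ 2) - W'.a₃ := by
    have e1 : W'.a₁ = (f W.a₁ + 2 * s) / u := by rw [← H.a₁]; field_simp
    have e2 : W'.a₂ = (f W.a₂ - s * f W.a₁ + 3 * r - s ^ 2) / u ^ 2 := by rw [← H.a₂]; field_simp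
    have e3 : W'.a₃ = (f W.a₃ + r * f W.a₁ + 2 * t) / u ^ 3 := by rw [← H.a₃]; field_simp
    have hx' : f x₃ = f l ^ 2 + f W.a₁ * f l - f W.a₂ - f x₁ - f x₂ := by rw [hx₃]; simp
    have hy' : f y₃ = -(f l * (f x₃ - f x₁) + f y₁) - f W.a₁ * f x₃ - f W.a₃ := by rw [hy₃]; simp
    rw [e1, e2, e3]
    constructor
    · rw [hx']; field_simp; ring
    · rw [hy']; field_simp; ring
  by_cases hx : x₁ = x₂
  · subst hx
    by_cases hy : y₁ = W.toAffine.negY x₁ y₂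
    · rw [Affine.Point.add_of_Y_eq rfl hy]
      simp only [mapPoint]
      rw [Affine.Point.add_of_Y_eq rfl]
      · rfl
      · rw [Affine.negY, hy, Affine.negY]
        simp only [map_sub, map_mul, map_neg]
        have e1 : W'.a₁ = (f W.a₁ + 2 * s) / u := by rw [← H.a₁]; field_simp
        have e3 : W'.a₃ = (f W.a₃ + r * f W.a₁ + 2 * t) / u ^ 3 := by rw [← H.a₃]; field_simp
        change _ = - _ - W'.a₁ * _ - W'.a₃
        rw [e1, e3]
        field_simp; ring
    · have hyy : y₁ = y₂ := (Affine.Y_eq_of_X_eq h₁.1 h₂.1 rfl).resolve_right hy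
      subst hyy
      have hne : 2 * y₁ + W.a₁ * x₁ + W.a₃ ≠ 0 := by
        intro h; apply hy; rw [Affine.negY]; linear_combination h
      have hl : (3 * x₁ ^ 2 + 2 * W.a₂ * x₁ + W.a₄ - W.a₁ * y₁) / (2 * y₁ + W.a₁ * x₁ + W.a₃) *
        (2 * y₁ + W.a₁ * x₁ + W.a₃) = 3 * x₁ ^ 2 + 2 * W.a₂ * x₁ + W.a₄ - W.a₁ * y₁ :=
        div_mul_cancel₀ _ hne
      generalize (3 * x₁ ^ 2 + 2 * W.a₂ * x₁ + W.a₄ - W.a₁ * y₁) /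
        (2 * y₁ + W.a₁ * x₁ + W.a₃) = l at hl
      obtain ⟨h₃, e₃⟩ := WeierstrassCurve.add_self_eq_of_tangent h₁ hne hl rfl rfl
      obtain ⟨k1, k2⟩ := key l (l ^ 2 + W.a₁ * l - W.a₂ - 2 * x₁) _ (by ring) rfl
      rw [e₃]
      simp only [mapPoint]
      have hl' := congrArg f hl
      simp only [map_add, map_sub, map_mul, map_pow, map_ofNat] at hl'
      have hne' : 2 * f y₁ + f W.a₁ * f x₁ + f W.a₃ ≠ 0 := by
        intro h; apply hne; apply f.injective; simpa [map_ofNat] using h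
      have h2 : u ^ 3 * (2 * ((f y₁ - t - s * (f x₁ - r)) / u ^ 3) + W'.a₁ * ((f x₁ - r) / u ^ 2) +
          W'.a₃) = 2 * f y₁ + f W.a₁ * f x₁ + f W.a₃ := by
        field_simp
        linear_combination (f x₁ - r) * H.a₁ + H.a₃
      obtain ⟨h₃', e₃'⟩ := WeierstrassCurve.add_self_eq_of_tangent (W := W')
        (H.nonsingular (H.map_x x₁) (H.map_y x₁ y₁) h₁) (l := (f l - s) / u)
        (by intro h; apply hne'; rw [← h2, h, mul_zero])
        (by
          apply mul_left_cancel₀ (pow_ne_zero 4 hu)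
          have : u ^ 4 * ((f l - s) / u * (2 * ((f y₁ - t - s * (f x₁ - r)) / u ^ 3) +
            W'.a₁ * ((f x₁ - r) / u ^ 2) + W'.a₃)) = (f l - s) *
              (2 * f y₁ + f W.a₁ * f x₁ + f W.a₃) := by
            rw [← h2]; field_simp
          rw [this]
          field_simp
          linear_combination hl' - 2 * (f x₁ - r) * H.a₂ - H.a₄
            + (f y₁ - t - s * (f x₁ - r)) * H.a₁)
        (k1.trans (by ring)) k2
      exact e₃'.symm
  · have hl : (y₁ - y₂) / (x₁ - x₂) * (x₁ - x₂) = y₁ - y₂ := div_mul_cancel₀ _ (sub_ne_zero.2 hx)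
    generalize (y₁ - y₂) / (x₁ - x₂) = l at hl
    obtain ⟨h₃, e₃⟩ := WeierstrassCurve.add_eq_of_chord h₁ h₂ hx hl rfl rfl
    obtain ⟨k1, k2⟩ := key l _ _ rfl rfl
    rw [e₃]
    simp only [mapPoint]
    have hl' := congrArg f hl
    simp only [map_sub, map_mul] at hl'
    obtain ⟨h₃', e₃'⟩ := WeierstrassCurve.add_eq_of_chord (W := W')
      (H.nonsingular (H.map_x x₁) (H.map_y x₁ y₁) h₁)
      (H.nonsingular (H.map_x x₂) (H.map_y x₂ y₂) h₂) (l := (f l - s) / u)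
      (by
        intro h; apply hx; apply f.injective
        field_simp at h; linear_combination h)
      (by field_simp; linear_combination hl') k1 k2
    exact e₃'.symm

/-- The homomorphism on points attached to a change of model. -/
def hom (H : IsModelChange f W W' u r s t) : W.toAffine.Point →+ W'.toAffine.Point where
  toFun := H.mapPoint
  map_zero' := rfl
  map_add' := H.mapPoint_add

theorem hom_injective (H : IsModelChange f W W' u r s t) : Function.Injective H.hom := by
  rw [injective_iff_map_eq_zero]
  rintro (_ | ⟨x, y, h⟩) hP
  · rfl
  · exact absurd hP (Affine.Point.some_ne_zero _)

theorem exists_hom_some (H : IsModelChange f W W' u r s t) {x y : F} {X Y : K}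
    (hX : f x = u ^ 2 * X + r) (hY : f y = u ^ 3 * Y + u ^ 2 * s * X + t)
    (h : W.toAffine.Nonsingular x y) : ∃ h', H.hom (.some x y h) = .some X Y h' :=
  H.exists_mapPoint_some hX hY h

end IsModelChange

theorem isModelChange_smul (C : VariableChange F) (W : WeierstrassCurve F) :
    IsModelChange (RingHom.id F) W (C • W) C.u C.r C.s C.t := by
  have := C.u.ne_zero
  refine ⟨this, ?_, ?_, ?_, ?_, ?_⟩ <;>
  simp only [variableChange_def, RingHom.id_apply, Units.val_inv_eq_inv_val] <;> field_simp

end ModelChange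

/-! ### Curves y² = x³ + Ax² + Bx + C. -/

section Cubic

/-- The Weierstrass curve `y² = x³ + Ax² + Bx + C`. -/
abbrev cubicCurve {F : Type*} [Field F] (A B C : F) : WeierstrassCurve F := ⟨0, A, 0, B, C⟩

variable {F : Type*} [Field F] {A B C : F}

theorem cubicCurve_equation {x y : F} :
    (cubicCurve A B C).toAffine.Equation x y ↔ y ^ 2 = x ^ 3 + A * x ^ 2 + B * x + C := by
  rw [Affine.equation_iff]; simp

theorem cubicCurve_nonsingular {x y : F} :
    (cubicCurve A B C).toAffine.Nonsingular x y ↔ y ^ 2 = x ^ 3 + A * x ^ 2 + B * x + C ∧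
      (3 * x ^ 2 + 2 * A * x + B ≠ 0 ∨ 2 * y ≠ 0) := by
  rw [Affine.nonsingular_iff, cubicCurve_equation]
  refine and_congr_right fun _ => or_congr ?_ ?_
  · rw [zero_mul, ne_comm]
  · refine not_congr ⟨fun h => ?_, fun h => ?_⟩ <;> linear_combination h

theorem cubicCurve_neg {x y : F} (h : (cubicCurve A B C).toAffine.Nonsingular x y) :
    ∃ h', -(Affine.Point.some x y h) = Affine.Point.some x (-y) h' := by
  have e : (cubicCurve A B C).toAffine.negY x y = -y := by simp [Affine.negY]
  rw [Affine.Point.neg_some]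
  have := (Affine.nonsingular_neg ..).mpr h
  rw [e] at this
  exact ⟨this, by simp only [e]⟩

variable [DecidableEq F]

theorem cubicCurve_add_self {x y x' y' l : F} (h2 : (2 : F) ≠ 0) (hy : y ≠ 0)
    (h : (cubicCurve A B C).toAffine.Nonsingular x y)
    (hl : l * (2 * y) = 3 * x ^ 2 + 2 * A * x + B) (hx' : x' = l ^ 2 - A - 2 * x)
    (hy' : y' = -(l * (x' - x) + y)) :
    ∃ h', (Affine.Point.some x y h + Affine.Point.some x y h : (cubicCurve A B C).toAffine.Point) =
      Affine.Point.some x' y' h' := by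
  apply WeierstrassCurve.add_self_eq_of_tangent h (l := l)
  · simp [h2, hy]
  · simpa using hl
  · simpa using hx'
  · simpa using hy'

theorem cubicCurve_add_self_eq_zero {x y : F} (hy : y = 0)
    (h : (cubicCurve A B C).toAffine.Nonsingular x y) :
    (Affine.Point.some x y h + Affine.Point.some x y h : (cubicCurve A B C).toAffine.Point) = 0 :=
  WeierstrassCurve.add_self_eq_zero h (by simp [hy])

theorem cubicCurve_add {x₁ y₁ x₂ y₂ x' y' l : F}
    (h₁ : (cubicCurve A B C).toAffine.Nonsingular x₁ y₁)
    (h₂ : (cubicCurve A B C).toAffine.Nonsingular x₂ y₂) (hx : x₁ ≠ x₂)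
    (hl : l * (x₁ - x₂) = y₁ - y₂) (hx' : x' = l ^ 2 - A - x₁ - x₂)
    (hy' : y' = -(l * (x' - x₁) + y₁)) :
    ∃ h', (Affine.Point.some x₁ y₁ h₁ + Affine.Point.some x₂ y₂ h₂ :
      (cubicCurve A B C).toAffine.Point) = Affine.Point.some x' y' h' := by
  apply WeierstrassCurve.add_eq_of_chord h₁ h₂ hx hl
  · simpa using hx'
  · simpa using hy'

omit [DecidableEq F] in
theorem cubicCurve_eq_or_eq_neg {x y y' : F} (h : (cubicCurve A B C).toAffine.Nonsingular x y)
    (h' : (cubicCurve A B C).toAffine.Nonsingular x y') :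
    Affine.Point.some x y h = Affine.Point.some x y' h' ∨
      Affine.Point.some x y h = -Affine.Point.some x y' h' :=
  Affine.Point.X_eq_iff.1 rfl

/-- The doubling formula on a curve `y² = x³ + Ax² + Bx`. -/
theorem cubicCurve_add_self_x {x y x' : F} (h2 : (2 : F) ≠ 0) (hy : y ≠ 0)
    (h : (cubicCurve A B 0).toAffine.Nonsingular x y) (hx' : x' = ((x ^ 2 - B) / (2 * y)) ^ 2) :
    ∃ y' h', (Affine.Point.some x y h + Affine.Point.some x y h :
      (cubicCurve A B 0).toAffine.Point) = Affine.Point.some x' y' h' := by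
  have he := (cubicCurve_nonsingular.1 h).1
  refine ⟨_, cubicCurve_add_self h2 hy h
    (l := (3 * x ^ 2 + 2 * A * x + B) / (2 * y)) ?_ ?_ rfl⟩
  · field_simp
  · rw [hx']
    field_simp
    linear_combination (4 * A + 8 * x) * he

end Cubic

/-! ### Additive discrete valuations. -/

section Ord

/-- A discrete valuation, written additively, with an arbitrary value at `0`. -/
structure IsOrd {K : Type*} [Field K] (o : K → ℤ) : Prop where
  map_mul : ∀ a b, a ≠ 0 → b ≠ 0 → o (a * b) = o a + o b
  map_add : ∀ a b, a ≠ 0 → b ≠ 0 → a + b ≠ 0 → min (o a) (o b) ≤ o (a + b)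

namespace IsOrd

variable {K : Type*} [Field K] {o : K → ℤ} (ho : IsOrd o)
include ho

theorem map_one : o 1 = 0 := by
  have := ho.map_mul 1 1 one_ne_zero one_ne_zero
  rw [mul_one] at this; omega

theorem map_neg {a : K} (ha : a ≠ 0) : o (-a) = o a := by
  have h1 := ho.map_mul (-1) (-1) (neg_ne_zero.2 one_ne_zero) (neg_ne_zero.2 one_ne_zero)
  rw [neg_mul_neg, mul_one, ho.map_one] at h1
  have h2 := ho.map_mul (-1) a (neg_ne_zero.2 one_ne_zero) ha
  rw [neg_one_mul] at h2; omega

theorem map_pow {a : K} (ha : a ≠ 0) (n : ℕ) : o (a ^ n) = n * o a := by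
  induction n with
  | zero => simp [ho.map_one]
  | succ n ih => rw [pow_succ, ho.map_mul _ _ (pow_ne_zero n ha) ha, ih]; push_cast; ring

theorem add_of_lt {a b : K} (ha : a ≠ 0) (hb : b ≠ 0) (h : o a < o b) :
    a + b ≠ 0 ∧ o (a + b) = o a := by
  have h0 : a + b ≠ 0 := by
    intro h0
    have : a = -b := by linear_combination h0
    rw [this, ho.map_neg hb] at h; omega
  refine ⟨h0, ?_⟩
  have h1 := ho.map_add a b ha hb h0
  have h2 := ho.map_add (a + b) (-b) h0 (neg_ne_zero.2 hb) (by simpa using ha)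
  rw [ho.map_neg hb, add_neg_cancel_right] at h2
  omega

theorem eq_of_sub {a b : K} (ha : a ≠ 0) (hb : b ≠ 0) (h : o a ≠ o b) :
    a - b ≠ 0 ∧ o (a - b) = min (o a) (o b) := by
  have hb' := neg_ne_zero.2 hb
  have e := ho.map_neg hb
  rcases lt_or_gt_of_ne h with h | h
  · have := ho.add_of_lt ha hb' (by omega)
    rw [← sub_eq_add_neg] at this
    exact ⟨this.1, by omega⟩
  · have := ho.add_of_lt hb' ha (by omega)
    rw [neg_add_eq_sub] at this
    exact ⟨this.1, by omega⟩

end IsOrd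

end Ord

/-! ### The curve y² = x³ - x² + x at a prime above 2. -/

section TwoAdic

variable {K : Type*} [Field K] [CharZero K] [DecidableEq K]

/-- The points in the kernel of reduction. -/
def InKernel (o : K → ℤ) {W : WeierstrassCurve K} (P : W.toAffine.Point) : Prop :=
  P = 0 ∨ ∃ x y h, P = .some x y h ∧ x ≠ 0 ∧ o x < 0

/-- Doubling on `y² = x³ - x² + x`. -/
theorem X₁_double {x y : K} (h : (cubicCurve (-1 : K) 1 0).toAffine.Nonsingular x y) :
    (Affine.Point.some x y h + Affine.Point.some x y h : (cubicCurve (-1 : K) 1 0).toAffine.Point)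
      = 0 ∨ (x ≠ 0 ∧ x ^ 2 - x + 1 ≠ 0 ∧ ∃ x' y' h',
    (Affine.Point.some x y h + Affine.Point.some x y h : (cubicCurve (-1 : K) 1 0).toAffine.Point)
      = .some x' y' h' ∧ x' * (4 * x * (x ^ 2 - x + 1)) = (x ^ 2 - 1) ^ 2) := by
  by_cases hy : y = 0
  · exact .inl (cubicCurve_add_self_eq_zero hy h)
  have he := (cubicCurve_nonsingular.1 h).1
  obtain ⟨y', h', e⟩ := cubicCurve_add_self_x two_ne_zero hy h rfl
  have hxy : x * (x ^ 2 - x + 1) = y ^ 2 := by linear_combination -he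
  have h0 : x * (x ^ 2 - x + 1) ≠ 0 := by rw [hxy]; exact pow_ne_zero 2 hy
  refine .inr ⟨left_ne_zero_of_mul h0, right_ne_zero_of_mul h0, _, y', h', e, ?_⟩
  rw [mul_assoc, hxy]
  field_simp
  ring

variable {o : K → ℤ} (ho : IsOrd o)
include ho

/-- At a pole the leading terms dominate: in x(2P) = (x² - 1)² / (4x(x² - x + 1)) the numerator has
valuation 4·o(x) and the denominator 2·o(2) + 3·o(x). -/
theorem X₁_double_of_neg {x y : K} (h : (cubicCurve (-1 : K) 1 0).toAffine.Nonsingular x y)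
    (hx : x ≠ 0) (hox : o x < 0) : ∃ x' y' h',
    (Affine.Point.some x y h + Affine.Point.some x y h : (cubicCurve (-1 : K) 1 0).toAffine.Point)
      = .some x' y' h' ∧ x' ≠ 0 ∧ o x' = o x - 2 * o 2 := by
  have h1 := ho.map_one
  have o2 : o (x ^ 2) = 2 * o x := by simpa using ho.map_pow hx 2
  have hx2 : x ^ 2 ≠ 0 := pow_ne_zero 2 hx
  obtain ⟨a1, a2⟩ := ho.eq_of_sub hx2 one_ne_zero (by omega)
  obtain ⟨b1, b2⟩ := ho.eq_of_sub hx one_ne_zero (by omega)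
  have b3 : o (x * (x - 1)) = 2 * o x := by rw [ho.map_mul _ _ hx b1]; omega
  obtain ⟨c1, c2⟩ := ho.add_of_lt (mul_ne_zero hx b1) one_ne_zero (by omega)
  have e : x * (x - 1) + 1 = x ^ 2 - x + 1 := by ring
  rw [e] at c1 c2
  have he := (cubicCurve_nonsingular.1 h).1
  rcases X₁_double h with h0 | ⟨-, -, x', y', h', e1, e2⟩
  · exfalso
    have hy : y ≠ 0 := by
      intro hy
      have : x * (x ^ 2 - x + 1) = 0 := by rw [hy] at he; linear_combination -he
      exact mul_ne_zero hx c1 this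
    obtain ⟨y', h', e⟩ := cubicCurve_add_self_x two_ne_zero hy h rfl
    rw [h0] at e
    exact Affine.Point.some_ne_zero _ e.symm
  · have hx' : x' ≠ 0 := by
      rintro rfl
      rw [zero_mul] at e2
      exact pow_ne_zero 2 a1 e2.symm
    refine ⟨x', y', h', e1, hx', ?_⟩
    have h4 : (4 : K) = 2 ^ 2 := by norm_num
    have o4 : o (4 : K) = 2 * o 2 := by rw [h4]; simpa using ho.map_pow (two_ne_zero (α := K)) 2
    have h4' : (4 : K) ≠ 0 := by norm_num
    have := congrArg o e2
    rw [ho.map_mul _ _ hx' (mul_ne_zero (mul_ne_zero h4' hx) c1),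
      ho.map_mul _ _ (mul_ne_zero h4' hx) c1, ho.map_mul _ _ h4' hx, ho.map_pow a1] at this
    push_cast at this
    omega

variable (h2 : 0 < o 2)
include h2

theorem InKernel.add_self {P : (cubicCurve (-1 : K) 1 0).toAffine.Point} (hP : InKernel o P) :
    InKernel o (P + P) := by
  rcases hP with rfl | ⟨x, y, h, rfl, hx, hox⟩
  · left; simp
  · obtain ⟨x', y', h', e, hx', ho'⟩ := X₁_double_of_neg ho h hx hox
    exact .inr ⟨x', y', h', e, hx', by omega⟩

/-- Such a point does not reduce to the singular point x = 1. Since x + 1 ≡ x - 1, the numerator (x²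
- 1)² is a unit, while the denominator is divisible by 4. -/
theorem inKernel_add_self_of_ord_sub_one_eq_zero {x y : K}
    (h : (cubicCurve (-1 : K) 1 0).toAffine.Nonsingular x y) (hx : x ≠ 0 → 0 ≤ o x)
    (hx1 : x - 1 ≠ 0) (hox : o (x - 1) = 0) :
    InKernel o (Affine.Point.some x y h + Affine.Point.some x y h :
      (cubicCurve (-1 : K) 1 0).toAffine.Point) := by
  have h1 := ho.map_one
  rcases X₁_double h with h0 | ⟨h0, c1, x', y', h', e1, e2⟩
  · exact .inl h0
  right
  have hox0 := hx h0
  have h4 : (4 : K) = 2 ^ 2 := by norm_num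
  have o4 : o (4 : K) = 2 * o 2 := by rw [h4]; simpa using ho.map_pow (two_ne_zero (α := K)) 2
  have h4' : (4 : K) ≠ 0 := by norm_num
  obtain ⟨a1, a2⟩ := ho.add_of_lt hx1 two_ne_zero (by omega)
  have e : x - 1 + 2 = x + 1 := by ring
  rw [e] at a1 a2
  have b : (x - 1) * (x + 1) = x ^ 2 - 1 := by ring
  have b2 := ho.map_mul _ _ hx1 a1
  rw [b] at b2
  have b1 : x ^ 2 - 1 ≠ 0 := by rw [← b]; exact mul_ne_zero hx1 a1
  have c2 := ho.map_mul _ _ h0 hx1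
  have c3 := ho.map_add _ _ (mul_ne_zero h0 hx1) one_ne_zero (by
    intro h; apply c1; linear_combination h)
  have e3 : x * (x - 1) + 1 = x ^ 2 - x + 1 := by ring
  rw [e3] at c3
  have hx' : x' ≠ 0 := by
    rintro rfl
    rw [zero_mul] at e2
    exact pow_ne_zero 2 b1 e2.symm
  refine ⟨x', y', h', e1, hx', ?_⟩
  have := congrArg o e2
  rw [ho.map_mul _ _ hx' (mul_ne_zero (mul_ne_zero h4' h0) c1),
    ho.map_mul _ _ (mul_ne_zero h4' h0) c1, ho.map_mul _ _ h4' h0, ho.map_pow b1] at this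
  push_cast at this
  omega

omit ho h2 in
theorem add_self_eq_zero_of_x_eq_zero {x y : K} (hx : x = 0)
    (h : (cubicCurve (-1 : K) 1 0).toAffine.Nonsingular x y) :
    (Affine.Point.some x y h + Affine.Point.some x y h : (cubicCurve (-1 : K) 1 0).toAffine.Point)
      = 0 := by
  rcases X₁_double h with h0 | ⟨h0, -⟩
  · exact h0
  · exact absurd hx h0

theorem inKernel_add_self_of_ord_ne_zero {x y : K}
    (h : (cubicCurve (-1 : K) 1 0).toAffine.Nonsingular x y) (hx : x ≠ 0 → o x ≠ 0) :
    InKernel o (Affine.Point.some x y h + Affine.Point.some x y h :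
      (cubicCurve (-1 : K) 1 0).toAffine.Point) := by
  by_cases h0 : x = 0
  · exact .inl (add_self_eq_zero_of_x_eq_zero h0 h)
  have hne := hx h0
  have h1 := ho.map_one
  rcases lt_or_gt_of_ne hne with hlt | hgt
  · exact InKernel.add_self ho h2 (.inr ⟨x, y, h, rfl, h0, hlt⟩)
  · obtain ⟨a, b⟩ := ho.eq_of_sub h0 one_ne_zero (by omega)
    exact inKernel_add_self_of_ord_sub_one_eq_zero ho h2 h (fun _ => hgt.le) a (by omega)

omit [DecidableEq K] h2 in
/-- The `x`-coordinate of the double of a point which reduces to the cusp modulo `2`. -/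
theorem ord_double_of_pos {x x' : K} (hx1 : x - 1 ≠ 0) (hox : 0 < o (x - 1)) (hx : x + 1 ≠ 0)
    (e : x' * (4 * x * (x ^ 2 - x + 1)) = (x ^ 2 - 1) ^ 2) :
    o x = 0 ∧ x ≠ 0 ∧ x ^ 2 - x + 1 ≠ 0 ∧ o (x ^ 2 - x + 1) = 0 ∧ x' ≠ 0 ∧
      o x' + 2 * o 2 = 2 * o (x - 1) + 2 * o (x + 1) := by
  have h1 := ho.map_one
  have h4 : (4 : K) = 2 ^ 2 := by norm_num
  have o4 : o (4 : K) = 2 * o 2 := by rw [h4]; simpa using ho.map_pow (two_ne_zero (α := K)) 2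
  have h4' : (4 : K) ≠ 0 := by norm_num
  obtain ⟨a1, a2⟩ := ho.add_of_lt one_ne_zero hx1 (by omega)
  have e1 : 1 + (x - 1) = x := by ring
  rw [e1] at a1 a2
  have c2 := ho.map_mul _ _ a1 hx1
  obtain ⟨c3, c4⟩ := ho.add_of_lt one_ne_zero (mul_ne_zero a1 hx1) (by omega)
  have e3 : 1 + x * (x - 1) = x ^ 2 - x + 1 := by ring
  rw [e3] at c3 c4
  have b : (x - 1) * (x + 1) = x ^ 2 - 1 := by ring
  have b1 : x ^ 2 - 1 ≠ 0 := by rw [← b]; exact mul_ne_zero hx1 hx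
  have b2 := ho.map_mul _ _ hx1 hx
  rw [b] at b2
  have hx' : x' ≠ 0 := by
    rintro rfl
    rw [zero_mul] at e
    exact pow_ne_zero 2 b1 e.symm
  refine ⟨by omega, a1, c3, by omega, hx', ?_⟩
  have := congrArg o e
  rw [ho.map_mul _ _ hx' (mul_ne_zero (mul_ne_zero h4' a1) c3),
    ho.map_mul _ _ (mul_ne_zero h4' a1) c3, ho.map_mul _ _ h4' a1, ho.map_pow b1] at this
  push_cast at this
  omega

/-- Put a = o(x - 1) and e = o(2). By `ord_double_of_pos`, x(2P) has valuation 4a - 2e if a < e, at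
least 2e if a = e, and 2a if a > e. It vanishes only if 2a = e, and a nonzero valuation suffices for
the next doubling. If x = 1, then x(2P) = 0. -/
theorem inKernel_four_of_ord_sub_one {x y : K}
    (h : (cubicCurve (-1 : K) 1 0).toAffine.Nonsingular x y)
    (hx : x - 1 ≠ 0 → 0 < o (x - 1) ∧ 2 * o (x - 1) ≠ o 2) :
    InKernel o (((Affine.Point.some x y h + Affine.Point.some x y h) +
      (Affine.Point.some x y h + Affine.Point.some x y h)) :
      (cubicCurve (-1 : K) 1 0).toAffine.Point) := by
  rcases X₁_double h with h0 | ⟨h0, c1, x', y', h', e1, e2⟩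
  · rw [h0]; left; simp
  rw [e1]
  apply inKernel_add_self_of_ord_ne_zero ho h2
  intro hx'
  have hb : x ^ 2 - 1 ≠ 0 := by
    intro hb
    rw [hb, zero_pow two_ne_zero] at e2
    have : 4 * x * (x ^ 2 - x + 1) ≠ 0 := mul_ne_zero (mul_ne_zero (by norm_num) h0) c1
    exact (mul_ne_zero hx' this) e2
  have hb' : (x - 1) * (x + 1) ≠ 0 := by
    intro h; apply hb; linear_combination h
  have hx1 := left_ne_zero_of_mul hb'
  have hx2 := right_ne_zero_of_mul hb'
  obtain ⟨p1, p2⟩ := hx hx1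
  obtain ⟨-, -, -, -, -, E⟩ := ord_double_of_pos ho hx1 p1 hx2 e2
  have e3 : x - 1 + 2 = x + 1 := by ring
  rcases lt_trichotomy (o (x - 1)) (o 2) with hlt | heq | hgt
  · have := ho.add_of_lt hx1 two_ne_zero hlt
    rw [e3] at this
    omega
  · have := ho.map_add _ _ hx1 two_ne_zero (by rwa [e3])
    rw [e3] at this
    omega
  · have := ho.add_of_lt two_ne_zero hx1 hgt
    rw [add_comm, e3] at this
    omega

/-- The only obstruction to 4P lying in the kernel is 2·o(x - 1) = o(2). In that case 2P is examined
in turn, and `hH` prevents the same obstruction from occurring twice in a row. -/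
theorem inKernel_eight (hH : ∀ a : K, a ≠ 0 → 4 * o a ≠ 5 * o 2)
    (P : (cubicCurve (-1 : K) 1 0).toAffine.Point) :
    InKernel o (((P + P) + (P + P)) + ((P + P) + (P + P))) := by
  have h1 := ho.map_one
  rcases P with _ | ⟨x, y, h⟩
  · left; rfl
  have step {Q : (cubicCurve (-1 : K) 1 0).toAffine.Point} (hQ : InKernel o Q) :=
    InKernel.add_self ho h2 hQ
  by_cases hneg : x ≠ 0 ∧ o x < 0
  · exact step (step (step (.inr ⟨x, y, h, rfl, hneg.1, hneg.2⟩)))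
  have hx : x ≠ 0 → 0 ≤ o x := fun hx => by
    by_contra hc
    exact hneg ⟨hx, by omega⟩
  by_cases hx1 : x - 1 = 0
  · exact step (inKernel_four_of_ord_sub_one ho h2 h fun h => absurd hx1 h)
  have hint {z : K} (hz : z ≠ 0 → 0 ≤ o z) (hz1 : z - 1 ≠ 0) : 0 ≤ o (z - 1) := by
    by_cases hz0 : z = 0
    · rw [hz0, zero_sub, ho.map_neg one_ne_zero, h1]
    · have e1 := ho.map_add z (-1) hz0 (neg_ne_zero.2 one_ne_zero) (by rwa [← sub_eq_add_neg])
      rw [ho.map_neg one_ne_zero, ← sub_eq_add_neg] at e1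
      have := hz hz0
      omega
  have hi := hint hx hx1
  rcases hi.eq_or_lt with h0 | hpos
  · exact step (step (inKernel_add_self_of_ord_sub_one_eq_zero ho h2 h hx hx1 h0.symm))
  by_cases hcrit : 2 * o (x - 1) = o 2
  swap
  · exact step (inKernel_four_of_ord_sub_one ho h2 h fun _ => ⟨hpos, hcrit⟩)
  rcases X₁_double h with h0 | ⟨h0, c1, x', y', h', e1, e2⟩
  · rw [h0]; left; simp
  have e3 : x - 1 + 2 = x + 1 := by ring
  obtain ⟨q1, q2⟩ := ho.add_of_lt hx1 two_ne_zero (by omega)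
  rw [e3] at q1 q2
  obtain ⟨r1, -, -, r2, r3, r4⟩ := ord_double_of_pos ho hx1 hpos q1 e2
  have hx'0 : o x' = 0 := by omega
  rw [e1]
  by_cases hx1' : x' - 1 = 0
  · exact inKernel_four_of_ord_sub_one ho h2 h' fun h => absurd hx1' h
  have hi' := hint (fun _ => hx'0.ge) hx1'
  rcases hi'.eq_or_lt with h0' | hpos'
  · exact step (inKernel_add_self_of_ord_sub_one_eq_zero ho h2 h' (fun _ => hx'0.ge) hx1' h0'.symm)
  refine inKernel_four_of_ord_sub_one ho h2 h' fun _ => ⟨hpos', fun hc => ?_⟩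
  have h4 : (4 : K) = 2 ^ 2 := by norm_num
  have o4 : o (4 : K) = 2 * o 2 := by rw [h4]; simpa using ho.map_pow (two_ne_zero (α := K)) 2
  have h4' : (4 : K) ≠ 0 := by norm_num
  -- The two factors on the right differ by 4x, of valuation 2·o(2). If their valuations agree,
  -- 2·o(x' - 1) = o(2) would give 4·o(x² + 1) = 5·o(2); if they differ, the smaller is 2·o(2) and
  -- o(x' - 1) is too large.
  have hAB : (x' - 1) * (4 * x * (x ^ 2 - x + 1)) = (x ^ 2 + 1) * (x ^ 2 - 4 * x + 1) := by
    linear_combination e2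
  have hne : (x ^ 2 + 1) * (x ^ 2 - 4 * x + 1) ≠ 0 := by
    rw [← hAB]; exact mul_ne_zero hx1' (mul_ne_zero (mul_ne_zero h4' h0) c1)
  have hA := left_ne_zero_of_mul hne
  have hB := right_ne_zero_of_mul hne
  have E := congrArg o hAB
  rw [ho.map_mul _ _ hx1' (mul_ne_zero (mul_ne_zero h4' h0) c1),
    ho.map_mul _ _ (mul_ne_zero h4' h0) c1, ho.map_mul _ _ h4' h0, ho.map_mul _ _ hA hB] at E
  by_cases hAB' : o (x ^ 2 + 1) = o (x ^ 2 - 4 * x + 1)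
  · have := hH _ hA
    omega
  · obtain ⟨-, s2⟩ := ho.eq_of_sub hA hB hAB'
    have e4 : x ^ 2 + 1 - (x ^ 2 - 4 * x + 1) = 4 * x := by ring
    rw [e4, ho.map_mul _ _ h4' h0] at s2
    omega

theorem InKernel.two_pow_smul {x y : K} (h : (cubicCurve (-1 : K) 1 0).toAffine.Nonsingular x y)
    (hx : x ≠ 0) (hox : o x < 0) (n : ℕ) : ∃ x' y' h',
    (2 ^ n : ℕ) • (Affine.Point.some x y h : (cubicCurve (-1 : K) 1 0).toAffine.Point) =
      .some x' y' h' ∧ x' ≠ 0 ∧ o x' = o x - 2 * n * o 2 := by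
  induction n with
  | zero => exact ⟨x, y, h, by simp, hx, by simp⟩
  | succ n ih =>
    obtain ⟨x', y', h', e, hx', ho'⟩ := ih
    obtain ⟨x'', y'', h'', e', hx'', ho''⟩ := X₁_double_of_neg ho h' hx' (by nlinarith)
    refine ⟨x'', y'', h'', ?_, hx'', ?_⟩
    · rw [pow_succ, mul_comm, mul_smul, e, two_nsmul, e']
    · rw [ho'', ho']; push_cast; ring

omit [CharZero K] ho h2 in
theorem eight_nsmul_eq {W : WeierstrassCurve K} (P : W.toAffine.Point) :
    ((P + P) + (P + P)) + ((P + P) + (P + P)) = 8 • P := by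
  abel

/-- A point of finite order is killed by `8`. -/
theorem eight_nsmul_eq_zero_of_isOfFinAddOrder (hH : ∀ a : K, a ≠ 0 → 4 * o a ≠ 5 * o 2)
    {P : (cubicCurve (-1 : K) 1 0).toAffine.Point} (hP : IsOfFinAddOrder P) : 8 • P = 0 := by
  have hk := inKernel_eight ho h2 hH P
  rw [eight_nsmul_eq] at hk
  rcases hk with h0 | ⟨x, y, h, e, hx, hox⟩
  · exact h0
  exfalso
  have hfin : IsOfFinAddOrder (8 • P) := hP.nsmul
  rw [e] at hfin
  -- The multiples of 8P by powers of 2 have abscissas of pairwise different valuations, so they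
  -- cannot lie in a finite group.
  have : Finite (AddSubmonoid.multiples (Affine.Point.some x y h :
    (cubicCurve (-1 : K) 1 0).toAffine.Point)) := hfin.finite_multiples
  obtain ⟨a, b, hab, heq⟩ := Finite.exists_ne_map_eq_of_infinite
    (fun n : ℕ => (⟨(2 ^ n : ℕ) • (Affine.Point.some x y h), ⟨2 ^ n, rfl⟩⟩ :
      AddSubmonoid.multiples (Affine.Point.some x y h :
        (cubicCurve (-1 : K) 1 0).toAffine.Point)))
  replace heq := congrArg Subtype.val heq
  dsimp only at heq
  obtain ⟨x₁, y₁, h₁, e₁, -, o₁⟩ := InKernel.two_pow_smul ho h2 h hx hox a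
  obtain ⟨x₂, y₂, h₂, e₂, -, o₂⟩ := InKernel.two_pow_smul ho h2 h hx hox b
  rw [e₁, e₂] at heq
  have hxx : x₁ = x₂ := (Affine.Point.some.inj heq).1
  rw [hxx, o₂] at o₁
  have : (a : ℤ) * o 2 = b * o 2 := by linarith
  have := mul_right_cancel₀ h2.ne' this
  exact hab (by exact_mod_cast this)

/-- A point which is infinitely divisible by `2` is trivial. -/
theorem eq_zero_of_two_pow_divisible (hH : ∀ a : K, a ≠ 0 → 4 * o a ≠ 5 * o 2)
    {P : (cubicCurve (-1 : K) 1 0).toAffine.Point}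
    (hP : ∀ n : ℕ, ∃ Q : (cubicCurve (-1 : K) 1 0).toAffine.Point, (2 ^ n : ℕ) • Q = P) :
    P = 0 := by
  by_contra hne
  have key (n : ℕ) : ∃ x y h, P = .some x y h ∧ o x < - 2 * n * o 2 := by
    -- Three of the halvings are spent on moving into the kernel; each of the other n contributes
    -- -2·o(2) to the valuation of the fixed abscissa of P.
    obtain ⟨Q, hQ⟩ := hP (n + 3)
    have hk := inKernel_eight ho h2 hH Q
    rw [eight_nsmul_eq] at hk
    have e8 : (2 ^ n : ℕ) • (8 • Q) = P := by
      rw [← hQ, ← mul_smul]; congr 1; rw [pow_add]; norm_num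
    rcases hk with h0 | ⟨x, y, h, e, hx, hox⟩
    · rw [h0, smul_zero] at e8
      exact absurd e8.symm hne
    · obtain ⟨x', y', h', e', hx', ho'⟩ := InKernel.two_pow_smul ho h2 h hx hox n
      rw [e, e'] at e8
      exact ⟨x', y', h', e8.symm, by rw [ho']; linarith⟩
  obtain ⟨x, y, h, e, -⟩ := key 0
  obtain ⟨x', y', h', e', hlt⟩ := key (o x).natAbs
  rw [e] at e'
  rw [← (Affine.Point.some.inj e').1] at hlt
  have : -((o x).natAbs : ℤ) ≤ o x := by omega
  have h3 : (0 : ℤ) ≤ ((o x).natAbs : ℤ) := by omega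
  nlinarith

end TwoAdic

/-! ### Square classes of rationals and integral forms of descent quartics. -/

section Arithmetic

/-- A fraction num/den is num·den divided by a square, so the squarefree part of the integer num·den
serves. -/
theorem Rat.exists_squarefree_mul_sq {q : ℚ} (hq : q ≠ 0) :
    ∃ (e : ℤ) (t : ℚ), Squarefree e ∧ t ≠ 0 ∧ q = e * t ^ 2 := by
  obtain ⟨a, b, hab, ha⟩ := Nat.sq_mul_squarefree (q.num * q.den).natAbs
  have hden : (q.den : ℚ) ≠ 0 := by exact_mod_cast q.den_nz
  have hnum : q.num ≠ 0 := Rat.num_ne_zero.2 hq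
  have hb : b ≠ 0 := by
    rintro rfl
    have : (q.num * q.den).natAbs = 0 := by rw [← hab]; simp
    rw [Int.natAbs_eq_zero] at this
    have hd : (q.den : ℤ) ≠ 0 := by exact_mod_cast q.den_nz
    exact (mul_ne_zero hnum hd) this
  have hs : (q.num * q.den : ℤ) = (q.num * q.den).sign * ((b : ℤ) ^ 2 * a) := by
    conv_lhs => rw [← Int.sign_mul_natAbs (q.num * q.den), ← hab]
    push_cast; ring
  refine ⟨(q.num * q.den).sign * a, b / q.den, ?_, by positivity, ?_⟩
  · rw [← Int.squarefree_natAbs, Int.natAbs_mul, Int.natAbs_sign_of_ne_zero, one_mul,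
      Int.natAbs_natCast]
    · exact ha
    · have hd : (q.den : ℤ) ≠ 0 := by exact_mod_cast q.den_nz
      exact mul_ne_zero hnum hd
  · have hs' : (q.num * q.den : ℚ) = (q.num * q.den : ℤ).sign * ((b : ℚ) ^ 2 * a) := by
      exact_mod_cast hs
    have : q = (q.num * q.den : ℚ) / q.den ^ 2 := by
      field_simp
      exact Rat.mul_den_eq_num q
    refine this.trans ?_
    rw [hs']
    push_cast
    field_simp

/-- The square of eN is the integer ek, so eN is an integer; its square is divisible by the
squarefree e, hence so is eN. -/
theorem Int.exists_eq_of_squarefree_mul_sq {e k : ℤ} {N : ℚ} (he : Squarefree e)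
    (h : (e : ℚ) * N ^ 2 = k) : ∃ N' : ℤ, N = N' := by
  have he0 : e ≠ 0 := he.ne_zero
  have h1 : ((e : ℚ) * N) ^ 2 = ((e * k : ℤ) : ℚ) := by
    push_cast; rw [← h]; ring
  have : IsIntegral ℤ ((e : ℚ) * N) := by
    refine IsIntegral.of_pow (n := 2) two_pos ?_
    rw [h1]; exact isIntegral_algebraMap (R := ℤ) (x := e * k)
  obtain ⟨M, hM⟩ := IsIntegrallyClosed.isIntegral_iff.1 this
  have hM' : (M : ℚ) = e * N := by simpa using hM
  have h2 : M ^ 2 = e * k := by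
    have : (M : ℚ) ^ 2 = ((e * k : ℤ) : ℚ) := by rw [hM', h1]
    exact_mod_cast this
  have h3 : e ∣ M := (he.dvd_pow_iff_dvd two_ne_zero).1
    ⟨k, h2⟩
  obtain ⟨N', rfl⟩ := h3
  refine ⟨N', ?_⟩
  have : (e : ℚ) ≠ 0 := by exact_mod_cast he0
  apply mul_left_cancel₀ this
  rw [← hM']; push_cast; ring

/-- The integral form of the equation `q² + aq + c = qz²` with `q` in the class of `e` modulo
squares. -/
theorem exists_int_quartic {a c e : ℤ} (he : Squarefree e) {q t z : ℚ} (ht : t ≠ 0)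
    (hq : q = e * t ^ 2) (h : q ^ 2 + a * q + c = q * z ^ 2) :
    e ∣ c ∧ ∃ m n N : ℤ, IsCoprime m n ∧ m ≠ 0 ∧ n ≠ 0 ∧ t = m / n ∧
      e ^ 2 * m ^ 4 + a * e * m ^ 2 * n ^ 2 + c * n ^ 4 = e * N ^ 2 := by
  have he0 : e ≠ 0 := he.ne_zero
  have hn0 : (t.den : ℚ) ≠ 0 := by exact_mod_cast t.den_nz
  have htmn : t = (t.num : ℚ) / (t.den : ℤ) := by
    push_cast; exact (Rat.num_div_den t).symm
  have hcop : IsCoprime t.num (t.den : ℤ) := by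
    rw [Int.isCoprime_iff_gcd_eq_one]
    exact t.reduced
  have hm0 : t.num ≠ 0 := Rat.num_ne_zero.2 ht
  have hd0 : (t.den : ℤ) ≠ 0 := by exact_mod_cast t.den_nz
  generalize t.num = m at *
  generalize (t.den : ℤ) = n at *
  have hn' : (n : ℚ) ≠ 0 := by exact_mod_cast hd0
  have E : (e : ℚ) * (m * n * z) ^ 2 =
      ((e ^ 2 * m ^ 4 + a * e * m ^ 2 * n ^ 2 + c * n ^ 4 : ℤ) : ℚ) := by
    rw [hq, htmn] at h
    field_simp at h
    push_cast
    linear_combination -h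
  obtain ⟨N, hN⟩ := Int.exists_eq_of_squarefree_mul_sq he E
  rw [hN] at E
  have E' : e * N ^ 2 = e ^ 2 * m ^ 4 + a * e * m ^ 2 * n ^ 2 + c * n ^ 4 := by exact_mod_cast E
  refine ⟨?_, m, n, N, hcop, hm0, hd0, htmn, E'.symm⟩
  -- A prime dividing both e and n divides e exactly once. The equation then forces it to divide N,
  -- and after a second division to divide m, against coprimality.
  have hen : IsCoprime e n := by
    rw [Int.isCoprime_iff_gcd_eq_one]
    by_contra hg
    obtain ⟨l, hl, hlg⟩ := Nat.exists_prime_and_dvd hg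
    have hlp : Prime (l : ℤ) := Nat.prime_iff_prime_int.1 hl
    have hle : (l : ℤ) ∣ e := (Int.natCast_dvd_natCast.2 hlg).trans (Int.gcd_dvd_left ..)
    have hln : (l : ℤ) ∣ n := (Int.natCast_dvd_natCast.2 hlg).trans (Int.gcd_dvd_right ..)
    obtain ⟨e', rfl⟩ := hle
    obtain ⟨n', rfl⟩ := hln
    have hl0 : (l : ℤ) ≠ 0 := hlp.ne_zero
    have hle' : ¬ (l : ℤ) ∣ e' := by
      rintro ⟨e'', rfl⟩
      have := he l ⟨e'', by ring⟩
      exact hlp.not_isUnit this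
    have h1 : e' * N ^ 2 = l * (e' ^ 2 * m ^ 4 + a * e' * m ^ 2 * l * n' ^ 2
        + c * l ^ 2 * n' ^ 4) := by
      apply mul_left_cancel₀ hl0; linear_combination E'
    have h2 : (l : ℤ) ∣ N := by
      have : (l : ℤ) ∣ e' * N ^ 2 := ⟨_, h1⟩
      exact hlp.dvd_of_dvd_pow ((hlp.dvd_mul.1 this).resolve_left hle')
    obtain ⟨N', rfl⟩ := h2
    have h3 : e' ^ 2 * m ^ 4 = l * (e' * N' ^ 2 - a * e' * m ^ 2 * n' ^ 2
        - c * l * n' ^ 4) := by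
      apply mul_left_cancel₀ hl0; linear_combination -h1
    have h4 : (l : ℤ) ∣ e' ^ 2 * m ^ 4 := ⟨_, h3⟩
    rcases hlp.dvd_mul.1 h4 with h5 | h5
    · exact hle' (hlp.dvd_of_dvd_pow h5)
    · have h6 := hlp.dvd_of_dvd_pow h5
      exact hlp.not_isUnit (hcop.isUnit_of_dvd' h6 ⟨n', rfl⟩)
  -- Modulo e only the term cn⁴ survives.
  have : e ∣ c * n ^ 4 := ⟨N ^ 2 - e * m ^ 4 - a * m ^ 2 * n ^ 2, by linear_combination -E'⟩
  exact (hen.pow_right (n := 4)).dvd_of_dvd_mul_right this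

end Arithmetic

/-! ### Divisibility by 2 up to points killed by 4. -/

section Halving

/-- The point `P` is twice another point, up to a point killed by `4`. -/
def Halvable {G : Type*} [AddCommGroup G] (P : G) : Prop := ∃ R : G, 4 • P = 8 • R

namespace Halvable

variable {G : Type*} [AddCommGroup G] {P T : G}

theorem neg (h : Halvable (-P)) : Halvable P := by
  obtain ⟨R, hR⟩ := h
  refine ⟨-R, ?_⟩
  rw [smul_neg, ← hR, smul_neg, neg_neg]

theorem of_torsion (h : 4 • P = 0) : Halvable P := ⟨0, by simpa using h⟩

theorem of_add (hT : 4 • T = 0) (h : Halvable (P + T)) : Halvable P := by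
  obtain ⟨R, hR⟩ := h
  exact ⟨R, by rw [← hR, smul_add, hT, add_zero]⟩

theorem of_double {R : G} (h : P = R + R) : Halvable P := ⟨R, by rw [h]; abel⟩

end Halvable

theorem four_nsmul_eq_zero {G : Type*} [AddCommGroup G] {P : G} (h : P + P = 0) : 4 • P = 0 := by
  have : 4 • P = (P + P) + (P + P) := by abel
  rw [this, h, add_zero]

end Halving

/-! ### The 2-isogeny descent on the twist y² = x³ - dx² + d²x. -/

section Descent

variable {d : ℚ}

local notation "Tw" d => WeierstrassCurve.toAffine (cubicCurve (-d) (d ^ 2) (0 : ℚ))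

theorem twist_quartic {s w : ℚ} (hs : s ≠ 0)
    (h : (Tw d).Nonsingular (s ^ 2) (s * w)) : w ^ 2 = s ^ 4 - d * s ^ 2 + d ^ 2 := by
  have he := (cubicCurve_nonsingular.1 h).1
  apply mul_left_cancel₀ (pow_ne_zero 2 hs)
  linear_combination he

/-- With u = 2s² - d + 2w, the pair (u, 2su) is a point of the 2-isogenous curve v² = u(u² + 2du -
3d²), and the dual isogeny sends it to abscissa s². The square class of u is thus the obstruction to
halving in the second step of the descent. -/
theorem twist_param {s w : ℚ} (h : w ^ 2 = s ^ 4 - d * s ^ 2 + d ^ 2) :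
    (2 * s ^ 2 - d + 2 * w) ^ 2 + 2 * d * (2 * s ^ 2 - d + 2 * w) - 3 * d ^ 2 =
      (2 * s ^ 2 - d + 2 * w) * (2 * s) ^ 2 := by
  linear_combination 4 * h

theorem twist_param_ne_zero (hd : d ≠ 0) {s w : ℚ} (h : w ^ 2 = s ^ 4 - d * s ^ 2 + d ^ 2) :
    2 * s ^ 2 - d + 2 * w ≠ 0 := by
  intro h0
  have := twist_param h
  rw [h0] at this
  apply hd
  have : d ^ 2 = 0 := by linear_combination -this / 3
  exact pow_eq_zero_iff two_ne_zero |>.1 this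

/-- If u = r², the point (u, 2su) is itself an image under the isogeny, so P is a double up to sign.
-/
theorem halvable_of_param_eq_sq (hd : d ≠ 0) {s w r : ℚ} (hs : s ≠ 0)
    (h : (Tw d).Nonsingular (s ^ 2) (s * w)) (hr : 2 * s ^ 2 - d + 2 * w = r ^ 2) :
    Halvable (Affine.Point.some _ _ h) := by
  have hw := twist_quartic hs h
  have hr0 : r ≠ 0 := by
    rintro rfl; exact twist_param_ne_zero hd hw (by simpa using hr)
  have hrel := twist_param hw
  rw [hr] at hrel
  -- A point (X, rX) lies on the twist when X² - (d + r²)X + d² = 0. The discriminant is r⁴ + 2dr² -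
  -- 3d² = (2sr)², which makes X rational.
  obtain ⟨X, hX⟩ : ∃ X, X = (d + r ^ 2) / 2 + s * r := ⟨_, rfl⟩
  have hq : X ^ 2 - (d + r ^ 2) * X + d ^ 2 = 0 := by rw [hX]; linear_combination -hrel / 4
  have hX0 : X ≠ 0 := by
    rintro hX0; rw [hX0] at hq
    exact hd (pow_eq_zero_iff two_ne_zero |>.1 (by linear_combination hq))
  have hY0 : r * X ≠ 0 := mul_ne_zero hr0 hX0
  have hR : (Tw d).Nonsingular X (r * X) := by
    rw [cubicCurve_nonsingular]
    exact ⟨by linear_combination -X * hq, .inr (mul_ne_zero two_ne_zero hY0)⟩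
  obtain ⟨y', h', e⟩ := cubicCurve_add_self_x (x' := s ^ 2) two_ne_zero hY0 hR (by
    have : (X ^ 2 - d ^ 2) / (2 * (r * X)) = s := by
      rw [div_eq_iff (mul_ne_zero two_ne_zero hY0)]
      linear_combination -hq + 2 * X * hX
    rw [this])
  rcases cubicCurve_eq_or_eq_neg h h' with h1 | h1
  · exact .of_double (h1.trans e.symm)
  · exact .neg (.of_double (by rw [h1, neg_neg, e]))

/-- Replacing P by -P changes w to -w and u to -3d²/u, which is a square when -3u is. -/
theorem halvable_of_param (hd : d ≠ 0) {s w r : ℚ} (hs : s ≠ 0)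
    (h : (Tw d).Nonsingular (s ^ 2) (s * w))
    (hr : 2 * s ^ 2 - d + 2 * w = r ^ 2 ∨ -3 * (2 * s ^ 2 - d + 2 * w) = r ^ 2) :
    Halvable (Affine.Point.some _ _ h) := by
  rcases hr with hr | hr
  · exact halvable_of_param_eq_sq hd hs h hr
  have hw := twist_quartic hs h
  have hu := twist_param_ne_zero hd hw
  have hr0 : r ≠ 0 := by
    rintro rfl
    exact (mul_ne_zero (by norm_num) hu) (hr.trans (by norm_num))
  obtain ⟨h', e⟩ := cubicCurve_neg h
  have hyy : -(s * w) = s * -w := by ring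
  apply Halvable.neg
  rw [e]
  simp only [hyy] at h' ⊢
  refine halvable_of_param_eq_sq hd hs h' (r := 3 * d / r) ?_
  rw [div_pow, ← hr]
  field_simp
  linear_combination -4 * hw

/-- Translation by the point `(0, 0)`. -/
theorem halvable_of_translate {s w : ℚ} (hd : d ≠ 0) (hs : s ≠ 0)
    (h : (Tw d).Nonsingular (s ^ 2) (s * w)) :
    ∃ h' : (Tw d).Nonsingular ((d / s) ^ 2) (d / s * (d * w / s ^ 2)),
      Halvable (Affine.Point.some _ _ h') → Halvable (Affine.Point.some _ _ h) := by
  have hw := twist_quartic hs h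
  have h0 : (Tw d).Nonsingular 0 0 := by
    rw [cubicCurve_nonsingular]
    refine ⟨by norm_num, .inl ?_⟩
    have := pow_ne_zero 2 hd
    simpa using hd
  have hT : 4 • (Affine.Point.some _ _ h0) = 0 :=
    four_nsmul_eq_zero (cubicCurve_add_self_eq_zero rfl h0)
  obtain ⟨h1, e1⟩ := cubicCurve_add h h0 (pow_ne_zero 2 hs) (l := w / s)
    (x' := (d / s) ^ 2) (y' := -(d / s * (d * w / s ^ 2))) (by field_simp; ring)
    (by field_simp; linear_combination -hw) (by field_simp; ring)
  obtain ⟨h2, e2⟩ := cubicCurve_neg h1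
  simp only [neg_neg] at h2 e2
  refine ⟨h2, fun H => ?_⟩
  refine .of_add hT (.neg ?_)
  rwa [e1, e2]

/-- Up to sign, translation by (0, 0) multiplies the square class of the parameter by d. -/
theorem translate_param {s w : ℚ} (hs : s ≠ 0) (h : w ^ 2 = s ^ 4 - d * s ^ 2 + d ^ 2) :
    (2 * (d / s) ^ 2 - d + 2 * (d * w / s ^ 2)) * (2 * s ^ 2 - d + 2 * w) =
      d * ((s ^ 2 + d + w) / s) ^ 2 := by
  field_simp
  linear_combination 3 * d * h

/-- The classes 1, -3, d, -3d come from the symmetries by negation and by translation by (0, 0). -/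
theorem halvable_of_param_class (hd : d ≠ 0) {s w r : ℚ} (hs : s ≠ 0)
    (h : (Tw d).Nonsingular (s ^ 2) (s * w))
    (hr : 2 * s ^ 2 - d + 2 * w = r ^ 2 ∨ -3 * (2 * s ^ 2 - d + 2 * w) = r ^ 2 ∨
      d * (2 * s ^ 2 - d + 2 * w) = r ^ 2 ∨ -3 * d * (2 * s ^ 2 - d + 2 * w) = r ^ 2) :
    Halvable (Affine.Point.some _ _ h) := by
  rcases hr with hr | hr | hr
  · exact halvable_of_param hd hs h (.inl hr)
  · exact halvable_of_param hd hs h (.inr hr)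
  obtain ⟨h', H⟩ := halvable_of_translate hd hs h
  apply H
  have hw := twist_quartic hs h
  have hu := twist_param_ne_zero hd hw
  have ht := translate_param hs hw
  have hds : d / s ≠ 0 := div_ne_zero hd hs
  rcases hr with hr | hr
  · have hr0 : r ≠ 0 := by
      rintro rfl
      exact (mul_ne_zero hd hu) (hr.trans (by norm_num))
    refine halvable_of_param hd hds h' (r := d * ((s ^ 2 + d + w) / s) / r) (.inl ?_)
    apply mul_right_cancel₀ hu
    rw [ht, div_pow _ r, ← hr]
    generalize 2 * s ^ 2 - d + 2 * w = u at hu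
    field_simp
  · have hr0 : r ≠ 0 := by
      rintro rfl
      exact (mul_ne_zero (mul_ne_zero (by norm_num) hd) hu) (hr.trans (by norm_num))
    refine halvable_of_param hd hds h' (r := 3 * d * ((s ^ 2 + d + w) / s) / r) (.inr ?_)
    apply mul_right_cancel₀ hu
    rw [mul_assoc, ht, div_pow _ r, ← hr]
    generalize 2 * s ^ 2 - d + 2 * w = u at hu
    field_simp

/-- If `-1` and the classes equivalent to it are not represented, every point with square
`x`-coordinate is halvable. -/
theorem halvable_of_not_neg_sq {s w e t : ℚ} (hd : d ≠ 0) (hs : s ≠ 0) (ht : t ≠ 0)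
    (h : (Tw d).Nonsingular (s ^ 2) (s * w))
    (hk : ∀ q z r : ℚ, q ≠ 0 → q ^ 2 + 2 * d * q - 3 * d ^ 2 = q * z ^ 2 → q ≠ -r ^ 2)
    (hq : 2 * s ^ 2 - d + 2 * w = e * t ^ 2)
    (he : e = 1 ∨ e = -1 ∨ e = 3 ∨ e = -3 ∨ e = d ∨ e = -d ∨ e = 3 * d ∨ e = -3 * d) :
    Halvable (Affine.Point.some _ _ h) := by
  have hw := twist_quartic hs h
  have hu := twist_param_ne_zero hd hw
  have hrel := twist_param hw
  have hw' : (-w) ^ 2 = s ^ 4 - d * s ^ 2 + d ^ 2 := by rw [neg_sq, hw]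
  have hu' := twist_param_ne_zero hd hw'
  have hrel' := twist_param hw'
  have hprod : (2 * s ^ 2 - d + 2 * w) * (2 * s ^ 2 - d + 2 * -w) = -3 * d ^ 2 := by
    linear_combination -4 * hw
  have hds : d / s ≠ 0 := div_ne_zero hd hs
  have htr := translate_param hs hw
  have hV : (d * w / s ^ 2) ^ 2 = (d / s) ^ 4 - d * (d / s) ^ 2 + d ^ 2 := by
    field_simp; linear_combination hw
  have hV' : (-(d * w / s ^ 2)) ^ 2 = (d / s) ^ 4 - d * (d / s) ^ 2 + d ^ 2 := by rw [neg_sq, hV]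
  have hU := twist_param_ne_zero hd hV
  have hUrel := twist_param hV
  have hU' := twist_param_ne_zero hd hV'
  have hUrel' := twist_param hV'
  have hUprod : (2 * (d / s) ^ 2 - d + 2 * (d * w / s ^ 2)) *
      (2 * (d / s) ^ 2 - d + 2 * -(d * w / s ^ 2)) = -3 * d ^ 2 := by
    linear_combination -4 * hV
  -- On square classes negation acts by e ↦ -3e and translation by (0, 0) by e ↦ de. Excluding -1
  -- therefore excludes 3, -d and 3d as well; the other four classes are halvable.
  rcases he with he | he | he | he | he | he | he | he
  · exact halvable_of_param_class hd hs h (r := t) (.inl (by rw [hq, he, one_mul]))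
  · exact absurd (by rw [hq, he]; ring) (hk _ _ t hu hrel)
  · refine absurd ?_ (hk _ _ (d / t) hu' hrel')
    apply mul_left_cancel₀ hu
    rw [hprod, hq, he]; field_simp
  · exact halvable_of_param_class hd hs h (r := 3 * t) (.inr (.inl (by rw [hq, he]; ring)))
  · exact halvable_of_param_class hd hs h (r := d * t) (.inr (.inr (.inl (by rw [hq, he]; ring))))
  · refine absurd ?_ (hk _ _ ((s ^ 2 + d + w) / s / t) hU hUrel)
    apply mul_right_cancel₀ hu
    rw [htr, hq, he]; field_simp
  · have hne : s ^ 2 + d + w ≠ 0 := by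
      intro h0
      rw [h0, zero_div, zero_pow two_ne_zero, mul_zero] at htr
      exact (mul_ne_zero hU hu) htr
    refine absurd ?_ (hk _ _ (3 * d * t / ((s ^ 2 + d + w) / s)) hU' hUrel')
    apply mul_left_cancel₀ hU
    apply mul_right_cancel₀ hu
    have : (2 * (d / s) ^ 2 - d + 2 * (d * w / s ^ 2)) *
        -(3 * d * t / ((s ^ 2 + d + w) / s)) ^ 2 * (2 * s ^ 2 - d + 2 * w) =
        ((2 * (d / s) ^ 2 - d + 2 * (d * w / s ^ 2)) * (2 * s ^ 2 - d + 2 * w)) *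
        -(3 * d * t / ((s ^ 2 + d + w) / s)) ^ 2 := by ring
    rw [this, hUprod, htr, hq, he]
    field_simp
  · exact halvable_of_param_class hd hs h (r := 3 * d * t)
      (.inr (.inr (.inr (by rw [hq, he]; ring))))

end Descent

/-! ### Local obstructions to the descent quartics. -/

section Congruences

theorem IsCoprime.false_of_zmod (p : ℕ) [hp : Fact p.Prime] {m n : ℤ} (h : IsCoprime m n)
    (hm : (m : ZMod p) = 0) (hn : (n : ZMod p) = 0) : False := by
  rw [ZMod.intCast_zmod_eq_zero_iff_dvd] at hm hn
  have hpp : Prime (p : ℤ) := Nat.prime_iff_prime_int.1 hp.out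
  exact hpp.not_isUnit (h.isUnit_of_dvd' hm hn)

theorem Int.exists_eq_mul_of_sq_eq (p : ℕ) [hp : Fact p.Prime] {N k : ℤ} (h : N ^ 2 = p * k) :
    ∃ N', N = p * N' ∧ k = p * N' ^ 2 := by
  have hpp : Prime (p : ℤ) := Nat.prime_iff_prime_int.1 hp.out
  obtain ⟨N', rfl⟩ := hpp.dvd_of_dvd_pow ⟨k, h⟩
  refine ⟨N', rfl, ?_⟩
  apply mul_left_cancel₀ hpp.ne_zero
  linear_combination -h

instance fact_prime_five : Fact (Nat.Prime 5) := ⟨by norm_num⟩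
instance fact_prime_seven : Fact (Nat.Prime 7) := ⟨by norm_num⟩
instance fact_prime_eleven : Fact (Nat.Prime 11) := ⟨by norm_num⟩

/-- Here p = |d|, so p divides N. After division by p², the form m⁴ ± m²n² + n⁴ equals p times a
square, which is impossible for coprime m, n: the form is anisotropic modulo p, except for p = 7. -/
theorem quartic_ne_mul_sq {d p : ℤ} (h : (d = 5 ∧ p = 5) ∨ (d = 2 ∧ p = 2) ∨ (d = -2 ∧ p = 2) ∨
    (d = 3 ∧ p = 3) ∨ (d = -7 ∧ p = 7) ∨ (d = -11 ∧ p = 11)) {m n N : ℤ} (hc : IsCoprime m n) :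
    p ^ 2 * m ^ 4 + (-d) * p * m ^ 2 * n ^ 2 + d ^ 2 * n ^ 4 ≠ p * N ^ 2 := by
  intro H
  rcases h with ⟨rfl, rfl⟩ | ⟨rfl, rfl⟩ | ⟨rfl, rfl⟩ | ⟨rfl, rfl⟩ | ⟨rfl, rfl⟩ | ⟨rfl, rfl⟩
  · obtain ⟨k, rfl, hk⟩ := Int.exists_eq_mul_of_sq_eq 5 (N := N)
      (k := m ^ 4 - m ^ 2 * n ^ 2 + n ^ 4) (by push_cast; linarith)
    have h0 : (m : ZMod 5) ^ 4 - m ^ 2 * n ^ 2 + n ^ 4 = 0 := by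
      have := congrArg (Int.cast : ℤ → ZMod 5) hk
      push_cast at this
      rw [this, show (5 : ZMod 5) = 0 from rfl, zero_mul]
    have : ∀ a b : ZMod 5, a ^ 4 - a ^ 2 * b ^ 2 + b ^ 4 = 0 → a = 0 ∧ b = 0 := by decide
    exact hc.false_of_zmod 5 (this _ _ h0).1 (this _ _ h0).2
  · obtain ⟨k, rfl, hk⟩ := Int.exists_eq_mul_of_sq_eq 2 (N := N)
      (k := m ^ 4 - m ^ 2 * n ^ 2 + n ^ 4) (by push_cast; linarith)
    have h0 : (m : ZMod 2) ^ 4 - m ^ 2 * n ^ 2 + n ^ 4 = 0 := by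
      have := congrArg (Int.cast : ℤ → ZMod 2) hk
      push_cast at this
      rw [this, show (2 : ZMod 2) = 0 from rfl, zero_mul]
    have : ∀ a b : ZMod 2, a ^ 4 - a ^ 2 * b ^ 2 + b ^ 4 = 0 → a = 0 ∧ b = 0 := by decide
    exact hc.false_of_zmod 2 (this _ _ h0).1 (this _ _ h0).2
  · obtain ⟨k, rfl, hk⟩ := Int.exists_eq_mul_of_sq_eq 2 (N := N)
      (k := m ^ 4 + m ^ 2 * n ^ 2 + n ^ 4) (by push_cast; linarith)
    have h0 : (m : ZMod 2) ^ 4 + m ^ 2 * n ^ 2 + n ^ 4 = 0 := by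
      have := congrArg (Int.cast : ℤ → ZMod 2) hk
      push_cast at this
      rw [this, show (2 : ZMod 2) = 0 from rfl, zero_mul]
    have : ∀ a b : ZMod 2, a ^ 4 + a ^ 2 * b ^ 2 + b ^ 4 = 0 → a = 0 ∧ b = 0 := by decide
    exact hc.false_of_zmod 2 (this _ _ h0).1 (this _ _ h0).2
  · obtain ⟨k, rfl, hk⟩ := Int.exists_eq_mul_of_sq_eq 3 (N := N)
      (k := m ^ 4 - m ^ 2 * n ^ 2 + n ^ 4) (by push_cast; linarith)
    have h0 : (m : ZMod 3) ^ 4 - m ^ 2 * n ^ 2 + n ^ 4 = 0 := by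
      have := congrArg (Int.cast : ℤ → ZMod 3) hk
      push_cast at this
      rw [this, show (3 : ZMod 3) = 0 from rfl, zero_mul]
    have : ∀ a b : ZMod 3, a ^ 4 - a ^ 2 * b ^ 2 + b ^ 4 = 0 → a = 0 ∧ b = 0 := by decide
    exact hc.false_of_zmod 3 (this _ _ h0).1 (this _ _ h0).2
  · obtain ⟨k, rfl, hk⟩ := Int.exists_eq_mul_of_sq_eq 7 (N := N)
      (k := m ^ 4 + m ^ 2 * n ^ 2 + n ^ 4) (by push_cast; linarith)
    -- Since -3 is a square modulo 7, the form has zeros there; the obstruction for d = -7 is found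
    -- modulo 8 instead.
    have h0 : (m : ZMod 8) ^ 4 + m ^ 2 * n ^ 2 + n ^ 4 = 7 * k ^ 2 := by
      exact_mod_cast congrArg (Int.cast : ℤ → ZMod 8) hk
    have : ∀ a b c : ZMod 8, a ^ 4 + a ^ 2 * b ^ 2 + b ^ 4 = 7 * c ^ 2 →
      (ZMod.castHom (show 2 ∣ 8 by norm_num) (ZMod 2)) a = 0 ∧
      (ZMod.castHom (show 2 ∣ 8 by norm_num) (ZMod 2)) b = 0 := by decide +kernel
    have := this _ _ _ h0
    rw [map_intCast, map_intCast] at this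
    exact hc.false_of_zmod 2 this.1 this.2
  · obtain ⟨k, rfl, hk⟩ := Int.exists_eq_mul_of_sq_eq 11 (N := N)
      (k := m ^ 4 + m ^ 2 * n ^ 2 + n ^ 4) (by push_cast; linarith)
    have h0 : (m : ZMod 11) ^ 4 + m ^ 2 * n ^ 2 + n ^ 4 = 0 := by
      have := congrArg (Int.cast : ℤ → ZMod 11) hk
      push_cast at this
      rw [this, show (11 : ZMod 11) = 0 from rfl, zero_mul]
    have : ∀ a b : ZMod 11, a ^ 4 + a ^ 2 * b ^ 2 + b ^ 4 = 0 → a = 0 ∧ b = 0 := by decide +kernel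
    exact hc.false_of_zmod 11 (this _ _ h0).1 (this _ _ h0).2

theorem neg_sq_ne_quartic_of_two {d : ℤ} (h : d = 2 ∨ d = -2) {m n N : ℤ} (hc : IsCoprime m n) :
    (-1) ^ 2 * m ^ 4 + 2 * d * (-1) * m ^ 2 * n ^ 2 + -3 * d ^ 2 * n ^ 4 ≠ -1 * N ^ 2 := by
  intro H
  have key : ∀ a b c : ZMod 16, (a ^ 4 - 4 * a ^ 2 * b ^ 2 - 12 * b ^ 4 = -c ^ 2 ∨
      a ^ 4 + 4 * a ^ 2 * b ^ 2 - 12 * b ^ 4 = -c ^ 2) →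
      (ZMod.castHom (show 2 ∣ 16 by norm_num) (ZMod 2)) a = 0 ∧
      (ZMod.castHom (show 2 ∣ 16 by norm_num) (ZMod 2)) b = 0 := by decide +kernel
  have := key m n N (by
    have H' := congrArg (Int.cast : ℤ → ZMod 16) H
    rcases h with rfl | rfl
    · left; push_cast at H'; linear_combination H'
    · right; push_cast at H'; linear_combination H')
  rw [map_intCast, map_intCast] at this
  exact hc.false_of_zmod 2 this.1 this.2

theorem neg_sq_ne_quartic_of_five_of_eleven {d : ℤ} (h : d = 5 ∨ d = -11) {m n N : ℤ}
    (hc : IsCoprime m n) :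
    (-1) ^ 2 * m ^ 4 + 2 * d * (-1) * m ^ 2 * n ^ 2 + -3 * d ^ 2 * n ^ 4 ≠ -1 * N ^ 2 := by
  intro H
  -- The equation involves only m², n² and N², so the search modulo 32 runs over the seven square
  -- residues instead of all residues.
  have hsq : ∀ a : ZMod 32, a ^ 2 ∈ ({0, 1, 4, 9, 16, 17, 25} : Finset (ZMod 32)) := by decide
  have hev : ∀ a : ZMod 32, a ^ 2 ∈ ({0, 4, 16} : Finset (ZMod 32)) →
      (ZMod.castHom (show 2 ∣ 32 by norm_num) (ZMod 2)) a = 0 := by decide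
  have key : ∀ a ∈ ({0, 1, 4, 9, 16, 17, 25} : Finset (ZMod 32)),
      ∀ b ∈ ({0, 1, 4, 9, 16, 17, 25} : Finset (ZMod 32)),
      ∀ c ∈ ({0, 1, 4, 9, 16, 17, 25} : Finset (ZMod 32)),
      (a ^ 2 - 10 * a * b - 75 * b ^ 2 = -c ∨ a ^ 2 + 22 * a * b - 363 * b ^ 2 = -c) →
      a ∈ ({0, 4, 16} : Finset (ZMod 32)) ∧ b ∈ ({0, 4, 16} : Finset (ZMod 32)) := by
    decide +kernel
  have := key _ (hsq m) _ (hsq n) _ (hsq N) (by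
    have H' := congrArg (Int.cast : ℤ → ZMod 32) H
    rcases h with rfl | rfl
    · left; push_cast at H'; linear_combination H'
    · right; push_cast at H'; linear_combination H')
  have h1 := hev _ this.1
  have h2 := hev _ this.2
  rw [map_intCast] at h1 h2
  exact hc.false_of_zmod 2 h1 h2

/-- Two reductions modulo 7: first -1 is a nonresidue, which makes m and N divisible by 7; after
division by 49, 3 is a nonresidue, which makes n divisible by 7. -/
theorem neg_sq_ne_quartic_of_neg_seven {m n N : ℤ} (hc : IsCoprime m n) :
    (-1) ^ 2 * m ^ 4 + 2 * (-7) * (-1) * m ^ 2 * n ^ 2 + -3 * (-7) ^ 2 * n ^ 4 ≠ -1 * N ^ 2 := by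
  intro H
  have k1 : ∀ a b : ZMod 7, a ^ 4 + b ^ 2 = 0 → a = 0 ∧ b = 0 := by decide
  have k2 : ∀ a b : ZMod 7, b ^ 2 - 3 * a ^ 4 = 0 → a = 0 ∧ b = 0 := by decide
  have e7 : (7 : ZMod 7) = 0 := rfl
  have hm := k1 m N (by
    have H' := congrArg (Int.cast : ℤ → ZMod 7) H
    push_cast at H'
    linear_combination H' + (-2 * (m : ZMod 7) ^ 2 * n ^ 2 + 21 * n ^ 4) * e7)
  rw [ZMod.intCast_zmod_eq_zero_iff_dvd, ZMod.intCast_zmod_eq_zero_iff_dvd] at hm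
  obtain ⟨⟨m', rfl⟩, ⟨N', rfl⟩⟩ := hm
  have H2 : N' ^ 2 - 3 * n ^ 4 = 7 * (- 7 * m' ^ 4 - 2 * m' ^ 2 * n ^ 2) := by
    push_cast at H; linarith
  have hn := k2 n N' (by
    have H' := congrArg (Int.cast : ℤ → ZMod 7) H2
    push_cast at H'
    rw [H', e7, zero_mul])
  exact hc.false_of_zmod 7 (by push_cast; rw [e7, zero_mul]) hn.1

/-- Dividing out 3 repeatedly, first because -1 is a nonresidue modulo 3, leaves n²(n² - 2m'²) ≡ 0;
as 2 is also a nonresidue, 3 divides n as well as m. -/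
theorem neg_sq_ne_quartic_of_neg_three {m n N : ℤ} (hc : IsCoprime m n) :
    (-1) ^ 2 * m ^ 4 + 2 * (-3) * (-1) * m ^ 2 * n ^ 2 + -3 * (-3) ^ 2 * n ^ 4 ≠ -1 * N ^ 2 := by
  intro H
  have k1 : ∀ a b : ZMod 3, a ^ 4 + b ^ 2 = 0 → a = 0 ∧ b = 0 := by decide
  have e3 : (3 : ZMod 3) = 0 := rfl
  have hm := k1 m N (by
    have H' := congrArg (Int.cast : ℤ → ZMod 3) H
    push_cast at H'
    linear_combination H' + (-2 * (m : ZMod 3) ^ 2 * n ^ 2 + 9 * n ^ 4) * e3)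
  rw [ZMod.intCast_zmod_eq_zero_iff_dvd, ZMod.intCast_zmod_eq_zero_iff_dvd] at hm
  obtain ⟨⟨m', rfl⟩, ⟨N', rfl⟩⟩ := hm
  obtain ⟨N'', rfl, hN⟩ := Int.exists_eq_mul_of_sq_eq 3 (N := N')
    (k := n ^ 4 - 2 * m' ^ 2 * n ^ 2 - 3 * m' ^ 4) (by push_cast at H ⊢; linarith)
  have hn : ∀ a b : ZMod 3, a ^ 4 - 2 * b ^ 2 * a ^ 2 = 0 → a = 0 := by decide
  have := hn n m' (by
    have H' := congrArg (Int.cast : ℤ → ZMod 3) hN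
    push_cast at H'
    linear_combination H' + (N'' ^ 2 + m' ^ 4 : ZMod 3) * e3)
  exact hc.false_of_zmod 3 (by push_cast; rw [e3, zero_mul]) this

end Congruences

/-! ### Halving on the nine twists needed for |Δ| < 13. -/

section TwistDescent

/-- The quadratic twist by `d` of `y² = x³ - x² + x`. -/
abbrev twistCurve {F : Type*} [Field F] (d : F) : WeierstrassCurve F := cubicCurve (-d) (d ^ 2) 0

theorem neg_sq_ne_param {d : ℤ} (h : d = 2 ∨ d = -2 ∨ d = 5 ∨ d = -11 ∨ d = -7 ∨ d = -3)
    (q z r : ℚ) (hq : q ≠ 0) (hrel : q ^ 2 + 2 * (d : ℚ) * q - 3 * (d : ℚ) ^ 2 = q * z ^ 2) :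
    q ≠ -r ^ 2 := by
  intro hr
  have hr0 : r ≠ 0 := by rintro rfl; simp [hr] at hq
  obtain ⟨-, m, n, N, hc, -, -, -, E⟩ := exists_int_quartic (a := 2 * d) (c := -3 * d ^ 2) (e := -1)
    (q := q) (z := z) (t := r) isUnit_one.neg.squarefree hr0 (by rw [hr]; push_cast; ring)
    (by push_cast; linear_combination hrel)
  rcases h with h | h | h | h | h | h
  · exact neg_sq_ne_quartic_of_two (.inl h) hc E
  · exact neg_sq_ne_quartic_of_two (.inr h) hc E
  · exact neg_sq_ne_quartic_of_five_of_eleven (.inl h) hc E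
  · exact neg_sq_ne_quartic_of_five_of_eleven (.inr h) hc E
  · subst h; exact neg_sq_ne_quartic_of_neg_seven hc E
  · subst h; exact neg_sq_ne_quartic_of_neg_three hc E

theorem twist_x_class {d : ℤ} (hd : d ≠ 0) {x y : ℚ} (hx : x ≠ 0)
    (h : (twistCurve (d : ℚ)).toAffine.Nonsingular x y) :
    ∃ (e : ℤ) (t : ℚ), 0 < e ∧ e ∣ d ∧ t ≠ 0 ∧ x = e * t ^ 2 ∧ ∃ m n N : ℤ, IsCoprime m n ∧
      e ^ 2 * m ^ 4 + (-d) * e * m ^ 2 * n ^ 2 + d ^ 2 * n ^ 4 = e * N ^ 2 := by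
  have he := (cubicCurve_nonsingular.1 h).1
  obtain ⟨e, t, hsq, ht, hxe⟩ := Rat.exists_squarefree_mul_sq hx
  obtain ⟨hdvd, m, n, N, hc, hm, hn, -, E⟩ := exists_int_quartic (a := -d) (c := d ^ 2) (z := y / x)
    hsq ht hxe (by push_cast; field_simp; linear_combination -he)
  refine ⟨e, t, ?_, (hsq.dvd_pow_iff_dvd two_ne_zero).1 hdvd, ht, hxe, m, n, N, hc, E⟩
  by_contra hneg
  have h1 : 0 < d ^ 2 * n ^ 4 := by positivity
  have h2 : e * N ^ 2 ≤ 0 := mul_nonpos_of_nonpos_of_nonneg (by omega) (sq_nonneg N)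
  -- Four times the quartic is (2em² - dn²)² + 3d²n⁴ > 0, so e cannot be negative.
  nlinarith [sq_nonneg (2 * e * m ^ 2 - d * n ^ 2)]

theorem Int.eq_of_dvd_three_mul {e d : ℤ} (h : e ∣ 3 * d) (hd : d = 2 ∨ d = -2 ∨ d = 5 ∨ d = -11 ∨
    d = -7) : e = 1 ∨ e = -1 ∨ e = 3 ∨ e = -3 ∨ e = d ∨ e = -d ∨ e = 3 * d ∨ e = -3 * d := by
  have h1 : e.natAbs ∣ (3 * d).natAbs := Int.natAbs_dvd_natAbs.2 h
  have h2 : e.natAbs ∈ Nat.divisors (3 * d).natAbs :=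
    Nat.mem_divisors.2 ⟨h1, by rcases hd with rfl | rfl | rfl | rfl | rfl <;> norm_num⟩
  have k6 : Nat.divisors 6 = {1, 2, 3, 6} := by decide
  have k15 : Nat.divisors 15 = {1, 3, 5, 15} := by decide
  have k21 : Nat.divisors 21 = {1, 3, 7, 21} := by decide
  have k33 : Nat.divisors 33 = {1, 3, 11, 33} := by decide
  rcases hd with rfl | rfl | rfl | rfl | rfl
  · norm_num [k6] at h2; omega
  · norm_num [k6] at h2; omega
  · norm_num [k15] at h2; omega
  · norm_num [k33] at h2; omega
  · norm_num [k21] at h2; omega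

theorem Int.eq_of_dvd_three {e : ℤ} (h : e ∣ 3) : e = 1 ∨ e = -1 ∨ e = 3 ∨ e = -3 := by
  have h1 : e.natAbs ∣ 3 := by simpa using Int.natAbs_dvd_natAbs.2 h
  rcases (Nat.dvd_prime Nat.prime_three).1 h1 with h | h <;> omega

variable {d : ℤ}

/-- The squarefree class divides the constant term -3d² of the isogenous quartic, hence (3d)², hence
3d. -/
theorem twist_param_class (hd : (d : ℚ) ≠ 0) {s w : ℚ} (hs : s ≠ 0)
    (h : (twistCurve (d : ℚ)).toAffine.Nonsingular (s ^ 2) (s * w)) :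
    ∃ (e : ℤ) (t : ℚ), Squarefree e ∧ e ∣ 3 * d ∧ t ≠ 0 ∧ 2 * s ^ 2 - d + 2 * w = e * t ^ 2 := by
  have hw := twist_quartic hs h
  obtain ⟨e, t, hsq, ht, he⟩ := Rat.exists_squarefree_mul_sq (twist_param_ne_zero hd hw)
  obtain ⟨hdvd, -⟩ := exists_int_quartic (a := 2 * d) (c := -3 * d ^ 2) (z := 2 * s)
    hsq ht he (by push_cast; linear_combination twist_param hw)
  refine ⟨e, t, hsq, ?_, ht, he⟩
  apply (hsq.dvd_pow_iff_dvd two_ne_zero).1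
  exact hdvd.trans ⟨-3, by ring⟩

/-- For d = 1 the class -1 does occur, at points killed by 4 such as (1, -1). Translation by (1, 1)
multiplies the class by 3, turning -1 into the halvable class -3, and negation reduces the class 3
to -1. -/
theorem halvable_of_sq_one {s w : ℚ} (hs : s ≠ 0)
    (h : (twistCurve (1 : ℚ)).toAffine.Nonsingular (s ^ 2) (s * w)) :
    Halvable (Affine.Point.some _ _ h) := by
  have hw := twist_quartic hs h
  have hT : (twistCurve (1 : ℚ)).toAffine.Nonsingular 1 1 := by
    rw [cubicCurve_nonsingular]; norm_num
  have h4 {y : ℚ} (h : (twistCurve (1 : ℚ)).toAffine.Nonsingular 1 y) :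
      4 • (Affine.Point.some _ _ h) = 0 := by
    have hy : y ≠ 0 := by
      rintro rfl
      have := (cubicCurve_nonsingular.1 h).1
      norm_num at this
    obtain ⟨y', h', e⟩ := cubicCurve_add_self_x (x' := 0) two_ne_zero hy h (by norm_num)
    have hy' : y' = 0 := by simpa using (cubicCurve_nonsingular.1 h').1
    have : 4 • (Affine.Point.some _ _ h) = (Affine.Point.some _ _ h + Affine.Point.some _ _ h) +
      (Affine.Point.some _ _ h + Affine.Point.some _ _ h) := by abel
    rw [this, e, cubicCurve_add_self_eq_zero hy']
  have hu := twist_param_ne_zero one_ne_zero hw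
  by_cases hs1 : s ^ 2 = 1
  · apply Halvable.of_torsion
    simp only [hs1] at h ⊢
    exact h4 h
  have hs1' : s ^ 2 - 1 ≠ 0 := sub_ne_zero.2 hs1
  have hsp : s + 1 ≠ 0 := by
    intro h; apply hs1'; linear_combination (s - 1) * h
  have hsm : s - 1 ≠ 0 := by
    intro h; apply hs1'; linear_combination (s + 1) * h
  have hws : (w - s) * (w + s) = (s ^ 2 - 1) ^ 2 := by linear_combination hw
  have hws0 : w - s ≠ 0 := by
    intro h; rw [h, zero_mul] at hws; exact pow_ne_zero 2 hs1' hws.symm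
  -- negative classes are removed by translating by `(1, 1)`
  have main {w : ℚ} (hw : w ^ 2 = s ^ 4 - 1 * s ^ 2 + 1 ^ 2) (hws0 : w - s ≠ 0)
      (h : (twistCurve (1 : ℚ)).toAffine.Nonsingular (s ^ 2) (s * w)) {r : ℚ} (hr0 : r ≠ 0)
      (hr : 2 * s ^ 2 - 1 + 2 * w = -r ^ 2) :
      Halvable (Affine.Point.some _ _ h) := by
    obtain ⟨h1, e1⟩ := cubicCurve_add h hT hs1 (l := (s * w - 1) / (s ^ 2 - 1))
      (x' := ((w - s) / (s ^ 2 - 1)) ^ 2)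
      (y' := (w - s) / (s ^ 2 - 1) * ((s ^ 2 + 1) * (w - s) / (s ^ 2 - 1) ^ 2)) (by field_simp)
      (by field_simp; linear_combination (1 - s ^ 2) * hw)
      (by field_simp; linear_combination (s * w - s ^ 2) * hw)
    refine .of_add (h4 hT) ?_
    rw [e1]
    refine halvable_of_param_class one_ne_zero (div_ne_zero hws0 hs1') h1
      (r := 3 * (s ^ 2 + w) / ((s + 1) * r)) (.inr (.inl ?_))
    have hu0 : 2 * s ^ 2 - 1 + 2 * w ≠ 0 := twist_param_ne_zero one_ne_zero hw
    have E : (2 * ((w - s) / (s ^ 2 - 1)) ^ 2 - 1 +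
        2 * ((s ^ 2 + 1) * (w - s) / (s ^ 2 - 1) ^ 2)) * (2 * s ^ 2 - 1 + 2 * w) =
        3 * ((s ^ 2 + w) / (s + 1)) ^ 2 := by
      field_simp
      linear_combination (-1 - 4 * s + 8 * s * w + 4 * s ^ 2 * w + 8 * s ^ 3 + 5 * s ^ 4 + 4 * w) * hw
    apply mul_right_cancel₀ hu0
    rw [mul_assoc, E, hr]
    field_simp
  obtain ⟨e, t, hsq, hdvd, ht, he⟩ := twist_param_class (d := 1) (by norm_num) hs (by simpa using h)
  rcases Int.eq_of_dvd_three (by simpa using hdvd) with rfl | rfl | rfl | rfl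
  · exact halvable_of_param_class one_ne_zero hs h (r := t) (.inl (by simpa using he))
  · exact main hw hws0 h ht (by simpa using he)
  · obtain ⟨h', e'⟩ := cubicCurve_neg h
    have hyy : -(s * w) = s * -w := by ring
    apply Halvable.neg
    rw [e']
    simp only [hyy] at h' ⊢
    have hw' : (-w) ^ 2 = s ^ 4 - 1 * s ^ 2 + 1 ^ 2 := by rw [neg_sq, hw]
    refine main hw' (fun h => ?_) h' (r := 1 / t) (by positivity) ?_
    · have : w + s = 0 := by linear_combination -h
      rw [this, mul_zero] at hws
      exact pow_ne_zero 2 hs1' hws.symm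
    · apply mul_left_cancel₀ hu
      have : (2 * s ^ 2 - 1 + 2 * w) * (2 * s ^ 2 - 1 + 2 * -w) = -3 := by
        linear_combination -4 * hw
      rw [this]
      push_cast at he
      rw [he]; field_simp
  · exact halvable_of_param_class one_ne_zero hs h (r := 3 * t)
      (.inr (.inl (by push_cast at he; rw [he]; ring)))

theorem halvable_of_x_eq_zero {y : ℚ} (h : (twistCurve (d : ℚ)).toAffine.Nonsingular 0 y) :
    Halvable (Affine.Point.some _ _ h) := by
  have hy : y = 0 := by simpa using (cubicCurve_nonsingular.1 h).1
  exact .of_torsion (four_nsmul_eq_zero (cubicCurve_add_self_eq_zero hy h))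

/-- The available classes divide 3d. For d = ±2, 5, -7, -11 and -3, half of them are excluded
locally; for d = 3 and d = -1, the classes 1, -3, d, -3d already exhaust ±1, ±3. -/
theorem halvable_of_sq {s w : ℚ} (hs : s ≠ 0)
    (hd : d = 1 ∨ d = 5 ∨ d = 2 ∨ d = 3 ∨ d = -3 ∨ d = -1 ∨ d = -7 ∨ d = -2 ∨ d = -11)
    (h : (twistCurve (d : ℚ)).toAffine.Nonsingular (s ^ 2) (s * w)) :
    Halvable (Affine.Point.some _ _ h) := by
  by_cases h1 : d = 1
  · subst h1
    have e1 : ((1 : ℤ) : ℚ) = 1 := Int.cast_one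
    simp only [e1] at h ⊢
    exact halvable_of_sq_one hs h
  have hd0 : (d : ℚ) ≠ 0 := by
    rw [Int.cast_ne_zero]; omega
  obtain ⟨e, t, hsq, hdvd, ht, he⟩ := twist_param_class hd0 hs h
  by_cases h2 : d = 2 ∨ d = -2 ∨ d = 5 ∨ d = -11 ∨ d = -7
  · refine halvable_of_not_neg_sq (e := e) hd0 hs ht h
      (neg_sq_ne_param (by tauto)) he ?_
    exact_mod_cast Int.eq_of_dvd_three_mul hdvd h2
  have he0 : e ∣ 3 := by
    rcases (show d = 3 ∨ d = -3 ∨ d = -1 by omega) with rfl | rfl | rfl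
    · exact (hsq.dvd_pow_iff_dvd (n := 2) two_ne_zero).1 (hdvd.trans ⟨1, by norm_num⟩)
    · exact (hsq.dvd_pow_iff_dvd (n := 2) two_ne_zero).1 (hdvd.trans ⟨-1, by norm_num⟩)
    · exact hdvd.trans ⟨-1, by norm_num⟩
  by_cases h3 : d = -3
  · refine halvable_of_not_neg_sq (e := e) hd0 hs ht h
      (neg_sq_ne_param (by tauto)) he ?_
    have := Int.eq_of_dvd_three he0
    have h4 : e = 1 ∨ e = -1 ∨ e = 3 ∨ e = -3 ∨ e = d ∨ e = -d ∨ e = 3 * d ∨ e = -3 * d := by omega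
    exact_mod_cast h4
  rcases (show d = 3 ∨ d = -1 by omega) with rfl | rfl <;>
  rcases Int.eq_of_dvd_three he0 with rfl | rfl | rfl | rfl
  · exact halvable_of_param_class hd0 hs h (r := t) (.inl (by rw [he]; push_cast; ring))
  · exact halvable_of_param_class hd0 hs h (r := 3 * t)
      (.inr (.inr (.inr (by rw [he]; push_cast; ring))))
  · exact halvable_of_param_class hd0 hs h (r := 3 * t)
      (.inr (.inr (.inl (by rw [he]; push_cast; ring))))
  · exact halvable_of_param_class hd0 hs h (r := 3 * t) (.inr (.inl (by rw [he]; push_cast; ring)))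
  · exact halvable_of_param_class hd0 hs h (r := t) (.inl (by rw [he]; push_cast; ring))
  · exact halvable_of_param_class hd0 hs h (r := t)
      (.inr (.inr (.inl (by rw [he]; push_cast; ring))))
  · exact halvable_of_param_class hd0 hs h (r := 3 * t)
      (.inr (.inr (.inr (by rw [he]; push_cast; ring))))
  · exact halvable_of_param_class hd0 hs h (r := 3 * t) (.inr (.inl (by rw [he]; push_cast; ring)))

/-- On the twist by `-3`, a point with `x`-coordinate in the class of `3` is moved by `(3, 9)`
to one with square `x`-coordinate. -/
theorem halvable_of_three_mul_sq {s y : ℚ} (hs : s ≠ 0)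
    (h : (twistCurve ((-3 : ℤ) : ℚ)).toAffine.Nonsingular (3 * s ^ 2) y) :
    Halvable (Affine.Point.some _ _ h) := by
  have hT : (twistCurve ((-3 : ℤ) : ℚ)).toAffine.Nonsingular 3 9 := by
    rw [cubicCurve_nonsingular]; norm_num
  have h4 {y : ℚ} (h : (twistCurve ((-3 : ℤ) : ℚ)).toAffine.Nonsingular 3 y) :
      4 • (Affine.Point.some _ _ h) = 0 := by
    have hy : y ≠ 0 := by
      rintro rfl
      have := (cubicCurve_nonsingular.1 h).1
      norm_num at this
    obtain ⟨y', h', e⟩ := cubicCurve_add_self_x (x' := 0) two_ne_zero hy h (by norm_num)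
    have hy' : y' = 0 := by simpa using (cubicCurve_nonsingular.1 h').1
    have : 4 • (Affine.Point.some _ _ h) = (Affine.Point.some _ _ h + Affine.Point.some _ _ h) +
      (Affine.Point.some _ _ h + Affine.Point.some _ _ h) := by abel
    rw [this, e, cubicCurve_add_self_eq_zero hy']
  by_cases hs1 : s ^ 2 = 1
  · apply Halvable.of_torsion
    have e3 : 3 * s ^ 2 = 3 := by rw [hs1, mul_one]
    simp only [e3] at h ⊢
    exact h4 h
  have hs1' : s ^ 2 - 1 ≠ 0 := sub_ne_zero.2 hs1
  obtain ⟨w, rfl⟩ : ∃ w, y = 9 * s * w := ⟨y / (9 * s), by field_simp⟩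
  have hw : 3 * w ^ 2 = s ^ 4 + s ^ 2 + 1 := by
    have he := (cubicCurve_nonsingular.1 h).1
    push_cast at he
    apply mul_left_cancel₀ (pow_ne_zero 2 hs)
    linear_combination he / 27
  obtain ⟨h1, e1⟩ := cubicCurve_add h hT (by intro h; apply hs1; linarith)
    (l := 3 * (s * w - 1) / (s ^ 2 - 1)) (x' := (3 * (w - s) / (s ^ 2 - 1)) ^ 2)
    (by field_simp; ring) (by push_cast; field_simp; linear_combination (1 - s ^ 2) * hw) rfl
  refine .of_add (h4 hT) ?_
  rw [e1]
  by_cases hws : w = s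
  · have e0 : (3 * (w - s) / (s ^ 2 - 1)) ^ 2 = 0 := by rw [hws]; simp
    generalize (3 * (w - s) / (s ^ 2 - 1)) ^ 2 = x' at *
    subst e0
    exact halvable_of_x_eq_zero h1
  · have hs0 : 3 * (w - s) / (s ^ 2 - 1) ≠ 0 :=
      div_ne_zero (mul_ne_zero (by norm_num) (sub_ne_zero.2 hws)) hs1'
    clear e1
    generalize 3 * (w - s) / (s ^ 2 - 1) = s' at *
    generalize -(3 * (s * w - 1) / (s ^ 2 - 1) * (s' ^ 2 - 3 * s ^ 2) + 9 * s * w) = y' at *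
    obtain ⟨w', rfl⟩ : ∃ w', y' = s' * w' := ⟨y' / s', by field_simp⟩
    exact halvable_of_sq hs0 (by norm_num) h1

/-- As |d| is 1 or a prime, the class of a nonzero abscissa is 1 or |d|. The class 1 is settled by
the second descent, and |d| is locally impossible, except for d = -3, where it comes from the point
(3, 9) killed by 4. -/
theorem twist_halvable
    (hd : d = 1 ∨ d = 5 ∨ d = 2 ∨ d = 3 ∨ d = -3 ∨ d = -1 ∨ d = -7 ∨ d = -2 ∨ d = -11)
    (P : (twistCurve (d : ℚ)).toAffine.Point) : Halvable P := by
  rcases P with _ | ⟨x, y, h⟩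
  · exact .of_torsion (nsmul_zero 4)
  by_cases hx : x = 0
  · subst hx
    exact halvable_of_x_eq_zero h
  have hd0 : d ≠ 0 := by omega
  obtain ⟨e, t, he0, hed, ht, rfl, m, n, N, hc, E⟩ := twist_x_class hd0 hx h
  by_cases h1 : e = 1
  · subst h1
    have e1 : ((1 : ℤ) : ℚ) * t ^ 2 = t ^ 2 := by simp
    simp only [e1] at h ⊢
    obtain ⟨w, rfl⟩ : ∃ w, y = t * w := ⟨y / t, by field_simp⟩
    exact halvable_of_sq ht hd h
  have hdiv : e.natAbs ∣ d.natAbs := Int.natAbs_dvd_natAbs.2 hed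
  have habs : e = d.natAbs := by
    have hp : d.natAbs.Prime ∨ d.natAbs = 1 := by
      rcases hd with rfl | rfl | rfl | rfl | rfl | rfl | rfl | rfl | rfl <;> norm_num
    rcases hp with hp | hp
    · rcases (Nat.dvd_prime hp).1 hdiv with h | h <;> omega
    · rw [hp, Nat.dvd_one] at hdiv; omega
  by_cases h3 : d = -3
  · subst h3
    have e3 : e = 3 := by simpa using habs
    subst e3
    exact halvable_of_three_mul_sq ht h
  refine absurd E (quartic_ne_mul_sq ?_ hc)
  clear E
  rw [habs]
  rcases hd with rfl | rfl | rfl | rfl | rfl | rfl | rfl | rfl | rfl <;> simp_all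

end TwistDescent

/-! ### Conjugation, discriminant and a prime above 2 of a quadratic field. -/

section QuadraticField

open NumberField IsDedekindDomain

variable (K : Type*) [Field K] [NumberField K]

/-- The properties of the nontrivial automorphism of a quadratic field. -/
structure IsQuadConj {K : Type*} [Field K] [NumberField K] (σ : K ≃ₐ[ℚ] K) : Prop where
  invol : ∀ z, σ (σ z) = z
  fixed : ∀ z, σ z = z → ∃ q : ℚ, algebraMap ℚ K q = z
  trace : ∀ z, algebraMap ℚ K (Algebra.trace ℚ K z) = z + σ z

theorem exists_isQuadConj (hK : Module.finrank ℚ K = 2) : ∃ σ : K ≃ₐ[ℚ] K, IsQuadConj σ := by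
  have : Algebra.IsQuadraticExtension ℚ K := ⟨hK⟩
  have hcard : Nat.card (K ≃ₐ[ℚ] K) = 2 := by rw [IsGalois.card_aut_eq_finrank, hK]
  obtain ⟨σ, hσ, huniq⟩ := (Nat.card_eq_two_iff' (1 : K ≃ₐ[ℚ] K)).1 hcard
  have hall : ∀ τ : K ≃ₐ[ℚ] K, τ = 1 ∨ τ = σ := fun τ => by
    by_cases h : τ = 1
    · exact .inl h
    · exact .inr (huniq τ h)
  have hinv : σ * σ = 1 := by
    rcases hall (σ * σ) with h | h
    · exact h
    · exact absurd (mul_eq_left.1 h) hσ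
  refine ⟨σ, fun z => by simpa using DFunLike.congr_fun hinv z, fun z hz => ?_, fun z => ?_⟩
  · have : z ∈ (⊥ : IntermediateField ℚ K) := by
      rw [IsGalois.mem_bot_iff_fixed]
      intro f
      rcases hall f with rfl | rfl
      · rfl
      · exact hz
    exact IntermediateField.mem_bot.1 this
  · classical
    rw [trace_eq_sum_automorphisms]
    have huniv : (Finset.univ : Finset (K ≃ₐ[ℚ] K)) = {1, σ} := by
      ext τ; simpa using hall τ
    rw [huniv, Finset.sum_pair hσ.symm]
    simp

variable {K}

theorem IsQuadConj.isIntegral_fixed {σ : K ≃ₐ[ℚ] K} (hσ : IsQuadConj σ) {z : K} (hz : IsIntegral ℤ z)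
    (hfix : σ z = z) : ∃ n : ℤ, (n : K) = z := by
  obtain ⟨q, rfl⟩ := hσ.fixed z hfix
  have : IsIntegral ℤ q := (isIntegral_algebraMap_iff (algebraMap ℚ K).injective).1 hz
  obtain ⟨n, rfl⟩ := IsIntegrallyClosed.isIntegral_iff.1 this
  exact ⟨n, by simp⟩

/-- A square root of the discriminant. -/
theorem IsQuadConj.exists_sqrt_discr (hK : Module.finrank ℚ K = 2) {σ : K ≃ₐ[ℚ] K} (hσ : IsQuadConj σ) :
    ∃ b : Module.Basis (Fin 2) ℤ (𝓞 K), ∃ θ : K,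
      θ = (b 0 : K) * σ (b 1 : K) - (b 1 : K) * σ (b 0 : K) ∧ θ ^ 2 = (discr K : ℤ) ∧ σ θ = -θ ∧
      ∃ S N : ℤ, discr K = S ^ 2 - 4 * N := by
  have hrank : Module.finrank ℤ (𝓞 K) = 2 := by rw [RingOfIntegers.rank, hK]
  let b : Module.Basis (Fin 2) ℤ (𝓞 K) := Module.finBasisOfFinrankEq ℤ (𝓞 K) hrank
  obtain ⟨θ, hθ⟩ : ∃ θ, θ = (b 0 : K) * σ (b 1 : K) - (b 1 : K) * σ (b 0 : K) := ⟨_, rfl⟩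
  have htr (x : 𝓞 K) : ((Algebra.trace ℤ (𝓞 K) x : ℤ) : K) = (x : K) + σ x := by
    rw [← hσ.trace, ← Algebra.coe_trace_int]
    simp
  -- The trace matrix is the Gram matrix of the two embeddings 1 and σ, so its determinant is the
  -- square of det(bᵢ, σbᵢ).
  have hsq : θ ^ 2 = (discr K : ℤ) := by
    rw [← NumberField.discr_eq_discr K b, Algebra.discr_def, Matrix.det_fin_two]
    simp only [Algebra.traceMatrix_apply, Algebra.traceForm_apply]
    push_cast
    rw [htr, htr, htr, htr]
    simp only [map_mul]
    rw [hθ]; ring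
  have hconj : σ θ = -θ := by
    rw [hθ]; simp only [map_sub, map_mul, hσ.invol]; ring
  have hint (x : 𝓞 K) : IsIntegral ℤ (x : K) := x.isIntegral_coe
  have hint' (x : 𝓞 K) : IsIntegral ℤ (σ (x : K)) := (hint x).map (σ.toAlgHom.restrictScalars ℤ)
  -- Stickelberger's congruence: the two products in the determinant have integral sum S and
  -- integral product N, so the discriminant is S² - 4N.
  obtain ⟨S, hS⟩ := hσ.isIntegral_fixed
    (((hint (b 0)).mul (hint' (b 1))).add ((hint (b 1)).mul (hint' (b 0))))
    (by simp only [map_add, map_mul, hσ.invol]; ring)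
  obtain ⟨N, hN⟩ := hσ.isIntegral_fixed
    (((hint (b 0)).mul (hint' (b 0))).mul ((hint (b 1)).mul (hint' (b 1))))
    (by simp only [map_mul, hσ.invol]; ring)
  refine ⟨b, θ, hθ, hsq, hconj, S, N, ?_⟩
  have : ((discr K : ℤ) : K) = ((S ^ 2 - 4 * N : ℤ) : K) := by
    push_cast
    rw [← hsq, hS, hN, hθ]; ring
  exact_mod_cast this

/-- There is a discrete valuation above `2`, of ramification index at most `2`. -/
theorem exists_isOrd (hK : Module.finrank ℚ K = 2) :
    ∃ o : K → ℤ, IsOrd o ∧ 0 < o 2 ∧ ∀ a : K, a ≠ 0 → 4 * o a ≠ 5 * o 2 := by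
  have hnorm : Ideal.absNorm (Ideal.span {(2 : 𝓞 K)}) = 4 := by
    rw [Ideal.absNorm_span_singleton]
    have : (2 : 𝓞 K) = algebraMap ℤ (𝓞 K) 2 := by simp
    rw [this, Algebra.norm_algebraMap, RingOfIntegers.rank, hK]
    norm_num
  have hne : Ideal.span {(2 : 𝓞 K)} ≠ ⊤ := by
    intro h
    rw [h, Ideal.absNorm_top] at hnorm
    omega
  obtain ⟨M, hM, hle⟩ := Ideal.exists_le_maximal _ hne
  have h2M : (2 : 𝓞 K) ∈ M := hle (Ideal.mem_span_singleton_self _)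
  have hbot : M ≠ ⊥ := by
    rintro rfl
    rw [Ideal.mem_bot] at h2M
    exact two_ne_zero h2M
  let v : HeightOneSpectrum (𝓞 K) := ⟨M, hM.isPrime, hbot⟩
  have h2K : v.valuation K (2 : K) = v.intValuation 2 := by
    have : algebraMap (𝓞 K) K 2 = 2 := map_ofNat _ 2
    rw [← this]
    exact HeightOneSpectrum.valuation_of_algebraMap v 2
  have hv2 : v.valuation K (2 : K) ≠ 0 := (Valuation.ne_zero_iff _).2 two_ne_zero
  have hlt : v.valuation K (2 : K) < WithZero.exp 0 := by
    rw [h2K, WithZero.exp_zero, HeightOneSpectrum.intValuation_lt_one_iff_dvd, Ideal.dvd_iff_le]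
    exact hle
  -- The ideal (2) has norm 4. If M³ divided it, the cube of the norm of M would divide 4, forcing
  -- that norm to be 1. Hence 2 has valuation 1 or 2, and 4·o(a) = 5·o(2) fails modulo 4.
  have hgt : WithZero.exp (-3 : ℤ) < v.valuation K (2 : K) := by
    rw [← not_le, h2K]
    have := HeightOneSpectrum.intValuation_le_pow_iff_dvd v (2 : 𝓞 K) 3
    push_cast at this
    rw [this]
    intro hdvd
    have h3 := Ideal.absNorm_dvd_absNorm_of_le (Ideal.dvd_iff_le.1 hdvd)
    rw [map_pow, hnorm] at h3
    have h4 : Ideal.absNorm M ≠ 1 := by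
      rw [Ne, Ideal.absNorm_eq_one_iff]; exact hM.ne_top
    change Ideal.absNorm M ^ 3 ∣ 4 at h3
    have h5 := Nat.le_of_dvd (by norm_num) h3
    have h6 : Ideal.absNorm M < 2 := by
      by_contra hc
      have := Nat.pow_le_pow_left (not_lt.1 hc) 3
      omega
    have h7 : Ideal.absNorm M = 0 := by omega
    rw [h7] at h3; norm_num at h3
  have hl1 : (v.valuation K (2 : K)).log < 0 := by
    rw [← WithZero.log_exp (0 : ℤ)]
    exact (WithZero.log_lt_log hv2 WithZero.exp_ne_zero).2 hlt
  have hl2 : -3 < (v.valuation K (2 : K)).log := by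
    rw [← WithZero.log_exp (-3 : ℤ)]
    exact (WithZero.log_lt_log WithZero.exp_ne_zero hv2).2 hgt
  refine ⟨fun a => -(v.valuation K a).log, ⟨fun a b ha hb => ?_, fun a b ha hb hab => ?_⟩, ?_, ?_⟩
  · rw [map_mul, WithZero.log_mul ((Valuation.ne_zero_iff _).2 ha) ((Valuation.ne_zero_iff _).2 hb)]
    ring
  · have h := (v.valuation K).map_add a b
    have ha' := (Valuation.ne_zero_iff (v.valuation K)).2 ha
    have hb' := (Valuation.ne_zero_iff (v.valuation K)).2 hb
    have hab' := (Valuation.ne_zero_iff (v.valuation K)).2 hab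
    rcases le_max_iff.1 h with h | h
    · have := (WithZero.log_le_log hab' ha').2 h
      omega
    · have := (WithZero.log_le_log hab' hb').2 h
      omega
  · dsimp only; omega
  · intro a _; dsimp only; omega

theorem QSqrt.exists_sq_eq (d : ℤ) : ∃ w : QSqrt d, w ^ 2 = (d : QSqrt d) := by
  obtain ⟨z, hz⟩ := IsAlgClosed.exists_pow_nat_eq (d : ℂ) two_pos
  refine ⟨⟨z, IntermediateField.subset_adjoin _ _ hz⟩, ?_⟩
  apply Subtype.ext
  simpa using hz

theorem QSqrt.finrank_le (d : ℤ) : Module.finrank ℚ (QSqrt d) ≤ 2 := by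
  obtain ⟨z, hz⟩ := IsAlgClosed.exists_pow_nat_eq (d : ℂ) two_pos
  have hset : {x : ℂ | x ^ 2 = (d : ℂ)} = {z, -z} := by
    ext x
    simp only [Set.mem_ofPred_eq, Set.mem_insert_iff, Set.mem_singleton_iff]
    rw [← hz, sq_eq_sq_iff_eq_or_eq_neg]
  have hadj : QSqrt d = IntermediateField.adjoin ℚ {z} := by
    rw [QSqrt, hset]
    apply le_antisymm
    · rw [IntermediateField.adjoin_le_iff]
      rintro x (rfl | rfl)
      · exact IntermediateField.mem_adjoin_simple_self ℚ x
      · exact neg_mem (IntermediateField.mem_adjoin_simple_self ℚ z)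
    · exact IntermediateField.adjoin.mono _ _ _ (by simp)
  have hmonic : (Polynomial.X ^ 2 - Polynomial.C (d : ℚ)).Monic :=
    Polynomial.monic_X_pow_sub_C _ two_ne_zero
  have hroot : Polynomial.aeval z (Polynomial.X ^ 2 - Polynomial.C (d : ℚ)) = 0 := by
    simp [hz]
  have hint : IsIntegral ℚ z := ⟨_, hmonic, hroot⟩
  rw [hadj, IntermediateField.adjoin.finrank hint]
  refine (Polynomial.natDegree_le_of_dvd (minpoly.dvd ℚ z hroot) hmonic.ne_zero).trans ?_
  rw [Polynomial.natDegree_X_pow_sub_C]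

theorem QSqrt.finrank_eq {d : ℤ} (hd : ¬ IsSquare (d : ℚ)) : Module.finrank ℚ (QSqrt d) = 2 := by
  refine le_antisymm (QSqrt.finrank_le d) ?_
  by_contra hc
  have h1 : Module.finrank ℚ (QSqrt d) = 1 := by
    have : 0 < Module.finrank ℚ (QSqrt d) := Module.finrank_pos
    omega
  rw [IntermediateField.finrank_eq_one_iff] at h1
  obtain ⟨w, hw⟩ := QSqrt.exists_sq_eq d
  have hmem : (w : ℂ) ∈ (⊥ : IntermediateField ℚ ℂ) := by rw [← h1]; exact w.2
  obtain ⟨q, hq⟩ := IntermediateField.mem_bot.1 hmem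
  apply hd
  refine ⟨q, ?_⟩
  have hw' : (w : ℂ) ^ 2 = d := by exact_mod_cast congrArg (Subtype.val) hw
  rw [← hq] at hw'
  have : ((q ^ 2 : ℚ) : ℂ) = ((d : ℚ) : ℂ) := by
    push_cast; simpa using hw'
  rw [← sq]
  exact (Rat.cast_injective this).symm

/-- The image of K in ℂ contains both square roots of d, hence `QSqrt d`, and the two degrees agree.
-/
theorem nonempty_ringEquiv_QSqrt (hK : Module.finrank ℚ K = 2) {d : ℤ} {θ : K}
    (hθ : θ ^ 2 = (d : K)) (hd : ¬ IsSquare (d : ℚ)) : Nonempty (K ≃+* QSqrt d) := by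
  let φ : K →ₐ[ℚ] ℂ := (IsAlgClosed.lift : K →ₐ[ℚ] ℂ)
  have hfr : Module.finrank ℚ φ.fieldRange = 2 := by
    rw [← hK]
    exact (AlgEquiv.ofInjectiveField φ).toLinearEquiv.finrank_eq.symm
  have hle : QSqrt d ≤ φ.fieldRange := by
    rw [QSqrt, IntermediateField.adjoin_le_iff]
    intro z hz
    have hφ : φ θ ^ 2 = (d : ℂ) := by rw [← map_pow, hθ]; simp
    rw [Set.mem_ofPred_eq, ← hφ, sq_eq_sq_iff_eq_or_eq_neg] at hz
    rcases hz with rfl | rfl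
    · exact ⟨θ, rfl⟩
    · exact ⟨-θ, by simp⟩
  have hfin : FiniteDimensional ℚ φ.fieldRange := Module.finite_of_finrank_pos (by omega)
  have h2 := QSqrt.finrank_eq hd
  have heq : QSqrt d = φ.fieldRange := IntermediateField.eq_of_le_of_finrank_le hle (by omega)
  exact ⟨((AlgEquiv.ofInjectiveField φ).trans
    (IntermediateField.equivOfEq heq.symm)).toRingEquiv⟩

end QuadraticField

/-! ### Torsion points of y² = x³ - x² + x are cusps. -/

section Torsion

theorem X₁_baseChange (K : Type*) [Field K] [Algebra ℚ K] :
    X₁TwoTwelve⁄K = cubicCurve (-1 : K) 1 0 := by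
  ext <;> simp [X₁TwoTwelve]

/-- A field without simultaneous square roots of `-1` and `-3`. -/
theorem IsQuadConj.not_sqrt_neg_one_and_neg_three {K : Type*} [Field K] [NumberField K]
    {σ : K ≃ₐ[ℚ] K} (hσ : IsQuadConj σ) {i s : K} (hi : i ^ 2 = -1) (hs : s ^ 2 = -3) : False := by
  have aux (z : K) (c : ℚ) (hc : c < 0) (hz : z ^ 2 = (c : K)) : σ z = -z := by
    have h1 : σ z ^ 2 = z ^ 2 := by rw [← map_pow, hz]; simp
    rcases sq_eq_sq_iff_eq_or_eq_neg.1 h1 with h | h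
    · obtain ⟨q, rfl⟩ := hσ.fixed z h
      have : ((q ^ 2 : ℚ) : K) = (c : K) := by push_cast; simpa using hz
      have := Rat.cast_injective this
      nlinarith [sq_nonneg q]
    · exact h
  have e1 := aux i (-1) (by norm_num) (by push_cast; exact hi)
  have e2 := aux s (-3) (by norm_num) (by push_cast; exact hs)
  -- Conjugation changes the sign of both roots, so their product would be a rational square root of
  -- 3.
  obtain ⟨q, hq⟩ := hσ.fixed (i * s) (by rw [map_mul, e1, e2]; ring)
  have h3 : (i * s) ^ 2 = 3 := by rw [mul_pow, hi, hs]; norm_num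
  have h4 : ((q ^ 2 : ℚ) : K) = ((3 : ℚ) : K) := by
    rw [← hq] at h3; push_cast; simpa using h3
  have h5 : q ^ 2 = 3 := Rat.cast_injective h4
  have h6 : IsSquare (3 : ℚ) := ⟨q, by rw [← h5, sq]⟩
  have h7 : ¬ IsSquare (3 : ℕ) := by
    rintro ⟨r, hr⟩
    have : r < 2 := by nlinarith
    interval_cases r <;> omega
  exact h7 (Rat.isSquare_natCast_iff.1 (by exact_mod_cast h6))

variable {K : Type*} [Field K] [CharZero K] [DecidableEq K]

/-- Abscissas of doubles are squares, and x² - x + 1 has no square root of K as a zero, so the only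
nonzero double killed by 2 is (0, 0). Going back, x(2P) = 0 means x = ±1, and x(2P) = 1 means (x² +
1)(x² - 4x + 1) = 0. -/
theorem cusp_of_eight_nsmul_eq_zero (hK : ∀ i s : K, i ^ 2 = -1 → s ^ 2 = -3 → False) {x y : K}
    (h : (cubicCurve (-1 : K) 1 0).toAffine.Nonsingular x y)
    (h8 : 8 • (Affine.Point.some x y h : (cubicCurve (-1 : K) 1 0).toAffine.Point) = 0) :
    x * (x - 1) * (x + 1) * (x ^ 2 - x + 1) * (x ^ 2 + 1) * (x ^ 2 - 4 * x + 1) = 0 := by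
  have he := (cubicCurve_nonsingular.1 h).1
  -- A zero r would be a primitive 12th root of unity, with (r³)² = -1 and (2r² - 1)² = -3.
  have hno (r : K) : r ^ 4 - r ^ 2 + 1 ≠ 0 := fun hr =>
    hK (r ^ 3) (2 * r ^ 2 - 1) (by linear_combination (r ^ 2 + 1) * hr) (by linear_combination 4 * hr)
  have hd {x y : K} (h : (cubicCurve (-1 : K) 1 0).toAffine.Nonsingular x y) :
      y = 0 ∨ ∃ r y' h', (Affine.Point.some x y h + Affine.Point.some x y h :
        (cubicCurve (-1 : K) 1 0).toAffine.Point) = .some (r ^ 2) y' h' ∧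
        r ^ 2 * (4 * x * (x ^ 2 - x + 1)) = (x ^ 2 - 1) ^ 2 := by
    by_cases hy : y = 0
    · exact .inl hy
    have he := (cubicCurve_nonsingular.1 h).1
    obtain ⟨y', h', e⟩ := cubicCurve_add_self_x two_ne_zero hy h rfl
    refine .inr ⟨_, y', h', e, ?_⟩
    have : 4 * x * (x ^ 2 - x + 1) = (2 * y) ^ 2 := by linear_combination -4 * he
    rw [this]; field_simp
  have h0 {x y : K} (h : (cubicCurve (-1 : K) 1 0).toAffine.Nonsingular x y) (hy : y = 0) :
      x * (x ^ 2 - x + 1) = 0 := by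
    have he := (cubicCurve_nonsingular.1 h).1
    rw [hy] at he; linear_combination -he
  -- a double which is killed by `2` is `(0, 0)`
  have h1 {x : K} {r : K} (hx : (r ^ 2) * ((r ^ 2) ^ 2 - r ^ 2 + 1) = 0)
      (hr : r ^ 2 * (4 * x * (x ^ 2 - x + 1)) = (x ^ 2 - 1) ^ 2) : (x - 1) * (x + 1) = 0 := by
    have : r ^ 2 = 0 := (mul_eq_zero.1 hx).resolve_right (by
      have := hno r; intro h; apply this; linear_combination h)
    rw [this, zero_mul] at hr
    have := pow_eq_zero_iff two_ne_zero |>.1 hr.symm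
    linear_combination this
  rw [← eight_nsmul_eq] at h8
  suffices H : x * (x ^ 2 - x + 1) = 0 ∨ (x - 1) * (x + 1) = 0 ∨
      (x ^ 2 + 1) * (x ^ 2 - 4 * x + 1) = 0 by
    rcases H with H | H | H
    · linear_combination (x - 1) * (x + 1) * (x ^ 2 + 1) * (x ^ 2 - 4 * x + 1) * H
    · linear_combination x * (x ^ 2 - x + 1) * (x ^ 2 + 1) * (x ^ 2 - 4 * x + 1) * H
    · linear_combination x * (x - 1) * (x + 1) * (x ^ 2 - x + 1) * H
  rcases hd h with hy | ⟨r, y₁, h₁, e₁, hr⟩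
  · exact .inl (h0 h hy)
  rw [e₁] at h8
  rcases hd h₁ with hy | ⟨r₂, y₂, h₂, e₂, hr₂⟩
  · exact .inr (.inl (h1 (h0 h₁ hy) hr))
  rw [e₂] at h8
  rcases hd h₂ with hy | ⟨r₃, y₃, h₃, e₃, hr₃⟩
  swap
  · rw [e₃] at h8; exact absurd h8 (Affine.Point.some_ne_zero _)
  have h3 := h1 (h0 h₂ hy) hr₂
  right; right
  rcases mul_eq_zero.1 h3 with h3 | h3
  · have : r ^ 2 = 1 := by linear_combination h3
    rw [this] at hr
    linear_combination -hr
  · exfalso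
    -- At abscissa -1 the equation of the curve gives y₁² = -3, so both forbidden square roots would
    -- exist.
    have hr1 : r ^ 2 = -1 := by linear_combination h3
    have := (cubicCurve_nonsingular.1 h₁).1
    rw [hr1] at this
    exact hK r y₁ hr1 (by rw [this]; norm_num)

/-- Without square roots of `-1`, `3` and `-3`, the torsion subgroup is generated by `(1, 1)`. -/
theorem torsion_eq_zmultiples (h1 : ∀ z : K, z ^ 2 ≠ -1) (h3 : ∀ z : K, z ^ 2 ≠ 3)
    (h3' : ∀ z : K, z ^ 2 ≠ -3) {W : WeierstrassCurve K} (hW : W = cubicCurve (-1 : K) 1 0)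
    (htors : ∀ x y h, IsOfFinAddOrder (Affine.Point.some x y h : W.toAffine.Point) →
      x * (x - 1) * (x + 1) * (x ^ 2 - x + 1) * (x ^ 2 + 1) * (x ^ 2 - 4 * x + 1) = 0) :
    (∀ P : W.toAffine.Point, IsOfFinAddOrder P ↔
      P = 0 ∨ ∃ x y h, P = .some x y h ∧ ((x = 0 ∧ y = 0) ∨ (x = 1 ∧ y = 1) ∨ (x = 1 ∧ y = -1))) ∧
    Nonempty (AddCommGroup.torsion W.toAffine.Point ≃+ ZMod 4) := by
  subst hW
  have hT : (cubicCurve (-1 : K) 1 0).toAffine.Nonsingular 1 1 := by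
    rw [cubicCurve_nonsingular]; norm_num
  obtain ⟨T, hTdef⟩ : ∃ T : (cubicCurve (-1 : K) 1 0).toAffine.Point, T = .some 1 1 hT := ⟨_, rfl⟩
  obtain ⟨h0, e0⟩ : ∃ h0, T + T = .some 0 0 h0 := by
    obtain ⟨y', h', e⟩ := cubicCurve_add_self_x (x' := 0) two_ne_zero one_ne_zero hT (by norm_num)
    have hy' : y' = 0 := by simpa using (cubicCurve_nonsingular.1 h').1
    subst hy'
    exact ⟨h', by rw [hTdef, e]⟩
  have e4 : (T + T) + (T + T) = 0 := by rw [e0]; exact cubicCurve_add_self_eq_zero rfl h0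
  obtain ⟨hn, en⟩ : ∃ hn, -T = .some 1 (-1) hn := by rw [hTdef]; exact cubicCurve_neg hT
  have hmem (P : (cubicCurve (-1 : K) 1 0).toAffine.Point) (hP : IsOfFinAddOrder P) : P = 0 ∨
      ∃ x y h, P = .some x y h ∧ ((x = 0 ∧ y = 0) ∨ (x = 1 ∧ y = 1) ∨ (x = 1 ∧ y = -1)) := by
    rcases P with _ | ⟨x, y, h⟩
    · exact .inl rfl
    refine .inr ⟨x, y, h, rfl, ?_⟩
    have hx := htors x y h hP
    have he := (cubicCurve_nonsingular.1 h).1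
    rcases mul_eq_zero.1 hx with hx | hx
    swap
    · exact absurd (by linear_combination hx) (h3 (x - 2))
    rcases mul_eq_zero.1 hx with hx | hx
    swap
    · exact absurd (by linear_combination hx) (h1 x)
    rcases mul_eq_zero.1 hx with hx | hx
    swap
    · exact absurd (by linear_combination 4 * hx) (h3' (2 * x - 1))
    rcases mul_eq_zero.1 hx with hx | hx
    swap
    · have : x = -1 := by linear_combination hx
      rw [this] at he
      exact absurd (by linear_combination he) (h3' y)
    rcases mul_eq_zero.1 hx with hx | hx
    · rw [hx] at he
      exact .inl ⟨hx, by simpa using he⟩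
    · have : x = 1 := by linear_combination hx
      rw [this] at he
      have hy : y ^ 2 = 1 ^ 2 := by linear_combination he
      rcases sq_eq_sq_iff_eq_or_eq_neg.1 hy with hy | hy
      · exact .inr (.inl ⟨this, hy⟩)
      · exact .inr (.inr ⟨this, hy⟩)
  have hz (P : (cubicCurve (-1 : K) 1 0).toAffine.Point) (hP : P = 0 ∨ ∃ x y h, P = .some x y h ∧
      ((x = 0 ∧ y = 0) ∨ (x = 1 ∧ y = 1) ∨ (x = 1 ∧ y = -1))) : P ∈ AddSubgroup.zmultiples T := by
    rcases hP with rfl | ⟨x, y, h, rfl, ⟨rfl, rfl⟩ | ⟨rfl, rfl⟩ | ⟨rfl, rfl⟩⟩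
    · exact zero_mem _
    · rw [← e0]; exact add_mem (AddSubgroup.mem_zmultiples T) (AddSubgroup.mem_zmultiples T)
    · rw [← hTdef]; exact AddSubgroup.mem_zmultiples T
    · rw [← en]; exact neg_mem (AddSubgroup.mem_zmultiples T)
  have hord : addOrderOf T = 4 := by
    refine addOrderOf_eq_prime_pow (p := 2) (n := 1) ?_ ?_
    · rw [pow_one, two_nsmul, e0]; exact Affine.Point.some_ne_zero _
    · have : 2 ^ (1 + 1) • T = (T + T) + (T + T) := by norm_num; abel
      rw [this, e4]
  have hfin : IsOfFinAddOrder T := by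
    rw [← addOrderOf_pos_iff, hord]; norm_num
  have htz (P : (cubicCurve (-1 : K) 1 0).toAffine.Point) (hP : P ∈ AddSubgroup.zmultiples T) :
      IsOfFinAddOrder P := by
    obtain ⟨n, rfl⟩ := AddSubgroup.mem_zmultiples_iff.1 hP
    exact hfin.zsmul
  refine ⟨fun P => ⟨hmem P, fun h => htz P (hz P h)⟩, ?_⟩
  have heq : AddCommGroup.torsion (cubicCurve (-1 : K) 1 0).toAffine.Point =
      AddSubgroup.zmultiples T := by
    ext P
    exact ⟨fun h => hz P (hmem P h), fun h => htz P h⟩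
  rw [heq]
  have hcard : Nat.card (AddSubgroup.zmultiples T) = 4 := by rw [Nat.card_zmultiples, hord]
  have hcyc : IsAddCyclic (AddSubgroup.zmultiples T) := inferInstance
  have e := zmodAddCyclicAddEquiv hcyc
  rw [hcard] at e
  exact ⟨e.symm⟩

end Torsion

/-! ### Splitting points under conjugation; vanishing of the rank. -/

section Rank

variable {K : Type*} [Field K] [NumberField K] [DecidableEq K]

theorem cubicCurve_nonsingular_map_iff {F : Type*} [Field F] {K : Type*} [Field K] (f : F →+* K)
    {A B C x y : F} : (cubicCurve (f A) (f B) (f C)).toAffine.Nonsingular (f x) (f y) ↔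
      (cubicCurve A B C).toAffine.Nonsingular x y := by
  rw [cubicCurve_nonsingular, cubicCurve_nonsingular]
  have e1 : (f y) ^ 2 = f x ^ 3 + f A * f x ^ 2 + f B * f x + f C ↔
      y ^ 2 = x ^ 3 + A * x ^ 2 + B * x + C := by
    rw [← f.injective.eq_iff]; simp
  have e2 : 3 * f x ^ 2 + 2 * f A * f x + f B ≠ 0 ↔ 3 * x ^ 2 + 2 * A * x + B ≠ 0 := by
    rw [not_iff_not, ← map_eq_zero f]; simp [map_ofNat]
  have e3 : 2 * f y ≠ 0 ↔ 2 * y ≠ 0 := by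
    rw [not_iff_not, ← map_eq_zero f, map_mul, map_ofNat]
  rw [e1, e2, e3]

omit [DecidableEq K] in
theorem isModelChange_conj (σ : K ≃ₐ[ℚ] K) : IsModelChange (σ : K →+* K)
    (cubicCurve (-1 : K) 1 0) (cubicCurve (-1 : K) 1 0) 1 0 0 0 := by
  refine ⟨one_ne_zero, ?_, ?_, ?_, ?_, ?_⟩ <;> simp

omit [DecidableEq K] in
theorem isModelChange_twist {d : ℤ} {θ : K} (hθ : θ ≠ 0) (h : θ ^ 2 = (d : K)) :
    IsModelChange (algebraMap ℚ K) (twistCurve (d : ℚ)) (cubicCurve (-1 : K) 1 0) θ 0 0 0 := by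
  refine ⟨hθ, ?_, ?_, ?_, ?_, ?_⟩
  · simp
  · simp [h]
  · simp
  · simp [← h]; ring
  · simp

/-- Rational points and points of the twist by d are the two eigenspaces of σ. Halving in both at
once makes four times any sum of such points infinitely divisible by 2 in E(K), hence zero by the
2-adic argument; and 8P is four times such a sum. -/
theorem IsQuadConj.eight_nsmul_eq_zero {σ : K ≃ₐ[ℚ] K} (hσ : IsQuadConj σ)
    (hK : Module.finrank ℚ K = 2) {d : ℤ}
    (hd : d = 5 ∨ d = 2 ∨ d = 3 ∨ d = -3 ∨ d = -1 ∨ d = -7 ∨ d = -2 ∨ d = -11) {θ : K}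
    (hθ : θ ^ 2 = (d : K)) (hσθ : σ θ = -θ) (P : (cubicCurve (-1 : K) 1 0).toAffine.Point) :
    8 • P = 0 := by
  have hd0 : (d : K) ≠ 0 := by
    rw [Int.cast_ne_zero]; omega
  have hθ0 : θ ≠ 0 := by
    rintro rfl; rw [zero_pow two_ne_zero] at hθ; exact hd0 hθ.symm
  obtain ⟨o, ho, h2, hH⟩ := exists_isOrd hK
  have H1 := isModelChange_twist (K := K) (d := 1) one_ne_zero (by simp)
  have Hd := isModelChange_twist hθ0 hθ
  have Hσ := isModelChange_conj σ
  have hinv (Q : (cubicCurve (-1 : K) 1 0).toAffine.Point) : Hσ.hom (Hσ.hom Q) = Q := by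
    rcases Q with _ | ⟨x, y, h⟩
    · rfl
    · obtain ⟨h1, e1⟩ := Hσ.exists_hom_some (x := x) (y := y) (X := σ x) (Y := σ y)
        (by simp) (by simp) h
      obtain ⟨h2, e2⟩ := Hσ.exists_hom_some (x := σ x) (y := σ y) (X := x) (Y := y)
        (by simp [hσ.invol]) (by simp [hσ.invol]) h1
      rw [e1, e2]
  have hrat (Q : (cubicCurve (-1 : K) 1 0).toAffine.Point) (hQ : Hσ.hom Q = Q) :
      ∃ a, H1.hom a = Q := by
    rcases Q with _ | ⟨x, y, h⟩
    · exact ⟨0, map_zero _⟩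
    · obtain ⟨h1, e1⟩ := Hσ.exists_hom_some (x := x) (y := y) (X := σ x) (Y := σ y)
        (by simp) (by simp) h
      rw [e1] at hQ
      obtain ⟨q, rfl⟩ := hσ.fixed x (Affine.Point.some.inj hQ).1
      obtain ⟨r, rfl⟩ := hσ.fixed y (Affine.Point.some.inj hQ).2
      have hn : (twistCurve ((1 : ℤ) : ℚ)).toAffine.Nonsingular q r := by
        rw [← cubicCurve_nonsingular_map_iff (algebraMap ℚ K)]
        simpa using h
      obtain ⟨h', e'⟩ := H1.exists_hom_some (X := algebraMap ℚ K q) (Y := algebraMap ℚ K r)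
        (by simp) (by simp) hn
      exact ⟨_, e'⟩
  -- If σQ = -Q, then x is rational and y/θ is rational; rescaling by d clears θ and lands on the
  -- twist.
  have hanti (Q : (cubicCurve (-1 : K) 1 0).toAffine.Point) (hQ : Hσ.hom Q = -Q) :
      ∃ a, Hd.hom a = Q := by
    rcases Q with _ | ⟨x, y, h⟩
    · exact ⟨0, map_zero _⟩
    · obtain ⟨h1, e1⟩ := Hσ.exists_hom_some (x := x) (y := y) (X := σ x) (Y := σ y)
        (by simp) (by simp) h
      obtain ⟨h2, e2⟩ := cubicCurve_neg h
      rw [e1, e2] at hQ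
      obtain ⟨q, rfl⟩ := hσ.fixed x (Affine.Point.some.inj hQ).1
      have hy : σ y = -y := (Affine.Point.some.inj hQ).2
      obtain ⟨r, hr⟩ := hσ.fixed (y / θ) (by rw [map_div₀, hy, hσθ, neg_div_neg_eq])
      have hy' : y = θ * algebraMap ℚ K r := by rw [hr]; field_simp
      subst hy'
      have he := (cubicCurve_nonsingular.1 h).1
      have hn : (twistCurve (d : ℚ)).toAffine.Nonsingular (d * q) (d ^ 2 * r) := by
        have hdQ : (d : ℚ) ≠ 0 := by
          rw [Int.cast_ne_zero]; omega
        have heQ : (d : ℚ) * r ^ 2 = q ^ 3 - q ^ 2 + q := by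
          apply (algebraMap ℚ K).injective
          simp only [map_mul, map_add, map_sub, map_pow, map_intCast, ← hθ]
          linear_combination he
        rw [cubicCurve_nonsingular]
        refine ⟨by linear_combination (d : ℚ) ^ 3 * heQ, ?_⟩
        rcases (cubicCurve_nonsingular.1 h).2 with h3 | h3
        · left
          intro h0
          apply h3
          have h0' : 3 * q ^ 2 + 2 * (-1) * q + 1 = 0 := by
            apply mul_left_cancel₀ (pow_ne_zero 2 hdQ)
            linear_combination h0
          have := congrArg (algebraMap ℚ K) h0'
          simpa using this
        · right
          refine mul_ne_zero two_ne_zero (mul_ne_zero (pow_ne_zero 2 hdQ) ?_)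
          rintro rfl
          simp at h3
      obtain ⟨h', e'⟩ := Hd.exists_hom_some (X := algebraMap ℚ K q) (Y := θ * algebraMap ℚ K r)
        (by simp [hθ]) (by simp [← hθ]; ring) hn
      exact ⟨_, e'⟩
  -- The relation 4P = 8R reproduces a multiple of 4 on the right, so the error killed by 4 never
  -- accumulates and halving can be iterated.
  have hdiv : ∀ n : ℕ, ∀ a b, ∃ a' b', 4 • (H1.hom a + Hd.hom b) =
      (2 ^ n : ℕ) • (4 • (H1.hom a' + Hd.hom b')) := by
    intro n
    induction n with
    | zero => intro a b; exact ⟨a, b, by simp⟩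
    | succ n ih =>
      intro a b
      obtain ⟨a', b', e⟩ := ih a b
      obtain ⟨a'', ha⟩ := twist_halvable (d := 1) (.inl rfl) a'
      obtain ⟨b'', hb⟩ := twist_halvable (.inr hd) b'
      refine ⟨a'', b'', ?_⟩
      rw [e, smul_add 4, ← map_nsmul, ← map_nsmul, ha, hb, map_nsmul, map_nsmul]
      rw [pow_succ, mul_smul]
      congr 1
      abel
  have hzero (a b) : 4 • (H1.hom a + Hd.hom b) = 0 := by
    apply eq_zero_of_two_pow_divisible ho h2 hH
    intro n
    obtain ⟨a', b', e⟩ := hdiv n a b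
    exact ⟨_, e.symm⟩
  obtain ⟨a, ha⟩ := hrat (P + Hσ.hom P) (by rw [map_add, hinv, add_comm])
  obtain ⟨b, hb⟩ := hanti (P - Hσ.hom P) (by rw [map_sub, hinv, neg_sub])
  have := hzero a b
  rw [ha, hb] at this
  rw [← this]; abel

end Rank

/-! ### Small discriminants, positive rank and the torsion statements. -/

section QuadraticPoints

open NumberField

theorem not_isSquare_thirteen : ¬ IsSquare ((13 : ℤ) : ℚ) := by
  have h7 : ¬ IsSquare (13 : ℕ) := by
    rintro ⟨r, hr⟩
    have : r < 4 := by nlinarith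
    interval_cases r <;> omega
  intro h
  exact h7 (Rat.isSquare_natCast_iff.1 (by exact_mod_cast h))

theorem IsQuadConj.map_sqrt {K : Type*} [Field K] [NumberField K] {σ : K ≃ₐ[ℚ] K}
    (hσ : IsQuadConj σ) {d : ℤ} (hd : ¬ IsSquare (d : ℚ)) {z : K} (hz : z ^ 2 = (d : K)) :
    σ z = -z := by
  have h1 : σ z ^ 2 = z ^ 2 := by rw [← map_pow, hz]; simp
  rcases sq_eq_sq_iff_eq_or_eq_neg.1 h1 with h | h
  · obtain ⟨q, rfl⟩ := hσ.fixed z h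
    refine absurd ⟨q, ?_⟩ hd
    apply (algebraMap ℚ K).injective
    rw [← sq, map_pow, hz, map_intCast]
  · exact h

theorem QSqrt.discr_thirteen : discr (QSqrt 13) = 13 := by
  have hK := QSqrt.finrank_eq not_isSquare_thirteen
  obtain ⟨σ, hσ⟩ := exists_isQuadConj (QSqrt 13) hK
  obtain ⟨b, θ, hθ, hsq, -⟩ := hσ.exists_sqrt_discr hK
  obtain ⟨w, hw⟩ := QSqrt.exists_sq_eq 13
  have hσw := hσ.map_sqrt not_isSquare_thirteen hw
  push_cast at hw
  have hint : _root_.IsIntegral ℤ ((1 + w) / 2) := by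
    refine ⟨Polynomial.X ^ 2 - Polynomial.X - 3, ?_, ?_⟩
    · monicity!
    · simp only [Polynomial.eval₂_sub, Polynomial.eval₂_pow, Polynomial.eval₂_X,
        Polynomial.eval₂_ofNat]
      linear_combination hw / 4
  obtain ⟨z, hz⟩ : ∃ z : 𝓞 (QSqrt 13), (z : QSqrt 13) = (1 + w) / 2 := ⟨⟨_, hint⟩, rfl⟩
  have rep (x : 𝓞 (QSqrt 13)) : ∃ p q : ℤ, (x : QSqrt 13) = p * (b 0 : QSqrt 13) + q * b 1 := by
    refine ⟨b.repr x 0, b.repr x 1, ?_⟩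
    have := b.sum_repr x
    rw [Fin.sum_univ_two] at this
    conv_lhs => rw [← this]
    simp
  obtain ⟨p, q, h1⟩ := rep 1
  obtain ⟨r, s, h2⟩ := rep z
  rw [hz] at h2
  have h1' : (1 : QSqrt 13) = p * (b 0 : QSqrt 13) + q * b 1 := by simpa using h1
  have h1σ := congrArg σ h1'
  have h2σ := congrArg σ h2
  simp only [map_one, map_add, map_mul, map_intCast, map_div₀, map_ofNat, hσw] at h1σ h2σ
  -- Writing 1 and (1 + w)/2 in the integral basis compares the two conjugate determinants: -w = kθ
  -- with an integer k, so 13 = k²Δ and k = ±1.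
  have hdet : -w = (p * s - q * r) * θ := by
    rw [hθ]
    linear_combination h2σ + (r * σ (b 0 : QSqrt 13) + s * σ (b 1 : QSqrt 13)) * h1' - h2
      - (r * (b 0 : QSqrt 13) + s * b 1) * h1σ
  have h13 : (13 : ℤ) = (p * s - q * r) ^ 2 * discr (QSqrt 13) := by
    have : ((13 : ℤ) : QSqrt 13) = (((p * s - q * r) ^ 2 * discr (QSqrt 13) : ℤ) : QSqrt 13) := by
      push_cast
      rw [← hsq, ← mul_pow, ← hdet, neg_sq, hw]
    exact_mod_cast this
  generalize p * s - q * r = k at h13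
  have hk : k ^ 2 ≤ 13 := Int.le_of_dvd (by norm_num) (Dvd.intro _ h13.symm)
  have hk4 : k < 4 := by nlinarith
  have hk4' : -4 < k := by nlinarith
  interval_cases k <;> omega

variable {K : Type*} [Field K] [NumberField K]

theorem le_abs_discr_of_positiveRank (hK : Module.finrank ℚ K = 2)
    (h : X₁TwoTwelveHasPositiveRank K) :
    13 ≤ |discr K| ∧ (|discr K| = 13 → Nonempty (K ≃+* QSqrt 13)) := by
  classical
  obtain ⟨σ, hσ⟩ := exists_isQuadConj K hK
  obtain ⟨-, θ, -, hsq, hσθ, S, N, hSN⟩ := hσ.exists_sqrt_discr hK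
  have hD0 : discr K ≠ 0 := discr_ne_zero K
  have hno (d : ℤ) (hd : d = 5 ∨ d = 2 ∨ d = 3 ∨ d = -3 ∨ d = -1 ∨ d = -7 ∨ d = -2 ∨ d = -11)
      (z : K) (hz : z ^ 2 = (d : K)) (hσz : σ z = -z) : False := by
    unfold X₁TwoTwelveHasPositiveRank at h
    apply h.ne'
    rw [rank_eq_zero_iff, X₁_baseChange K]
    intro P
    refine ⟨8, by norm_num, ?_⟩
    have := hσ.eight_nsmul_eq_zero hK hd hz hσz
    rw [← this]
    norm_cast
  -- A square discriminant would make θ rational, hence fixed by σ, while σθ = -θ.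
  have hsquare (k : ℤ) (hk : discr K = k ^ 2) : False := by
    rw [hk, Int.cast_pow, sq_eq_sq_iff_eq_or_eq_neg] at hsq
    have hθ0 : θ = 0 := by
      have : σ θ = θ := by rcases hsq with h | h <;> rw [h] <;> simp
      rw [hσθ] at this
      exact self_eq_neg.1 this.symm
    rw [hθ0] at hsq
    have : (k : K) = 0 := by
      rcases hsq with h | h
      · exact h.symm
      · exact neg_eq_zero.1 h.symm
    rw [Int.cast_eq_zero] at this
    exact hD0 (by rw [hk, this]; norm_num)
  have h4 : discr K % 4 = 0 ∨ discr K % 4 = 1 := by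
    rcases Int.even_or_odd' S with ⟨k, rfl | rfl⟩
    · left; rw [hSN, show (2 * k) ^ 2 - 4 * N = 4 * (k ^ 2 - N) by ring]; omega
    · right; rw [hSN, show (2 * k + 1) ^ 2 - 4 * N = 4 * (k ^ 2 + k - N) + 1 by ring]; omega
  have hhalf (d : ℤ) (hd : discr K = 4 * d) : (θ / 2) ^ 2 = (d : K) ∧ σ (θ / 2) = -(θ / 2) := by
    constructor
    · rw [div_pow, hsq, hd]; push_cast; ring
    · rw [map_div₀, hσθ, map_ofNat, neg_div]
  have hcases : discr K = 13 ∨ 13 < |discr K| := by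
    by_contra! hc
    obtain ⟨hc1, hc2⟩ := hc
    rw [abs_le] at hc2
    obtain ⟨hl, hu⟩ := hc2
    -- These are the nonzero integers congruent to 0 or 1 modulo 4 in the range. Non-fundamental
    -- values need no separate theory: -12 is treated by the twist by -3, and squares by `hsquare`.
    have hlist : discr K = -12 ∨ discr K = -11 ∨ discr K = -8 ∨ discr K = -7 ∨ discr K = -4 ∨
        discr K = -3 ∨ discr K = 1 ∨ discr K = 4 ∨ discr K = 5 ∨ discr K = 8 ∨ discr K = 9 ∨
        discr K = 12 := by omega
    have hfull (d : ℤ) (hd : discr K = d) : θ ^ 2 = (d : K) := by rw [hsq, hd]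
    rcases hlist with e | e | e | e | e | e | e | e | e | e | e | e
    · exact hno (-3) (by norm_num) _ (hhalf (-3) (e.trans (by norm_num))).1 (hhalf (-3) (e.trans (by norm_num))).2
    · exact hno (-11) (by norm_num) _ (hfull _ e) hσθ
    · exact hno (-2) (by norm_num) _ (hhalf (-2) (e.trans (by norm_num))).1 (hhalf (-2) (e.trans (by norm_num))).2
    · exact hno (-7) (by norm_num) _ (hfull _ e) hσθ
    · exact hno (-1) (by norm_num) _ (hhalf (-1) (e.trans (by norm_num))).1 (hhalf (-1) (e.trans (by norm_num))).2
    · exact hno (-3) (by norm_num) _ (hfull _ e) hσθ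
    · exact hsquare 1 e
    · exact hsquare 2 e
    · exact hno 5 (by norm_num) _ (hfull _ e) hσθ
    · exact hno 2 (by norm_num) _ (hhalf 2 e).1 (hhalf 2 e).2
    · exact hsquare 3 e
    · exact hno 3 (by norm_num) _ (hhalf 3 e).1 (hhalf 3 e).2
  rcases hcases with e | e
  · refine ⟨by rw [e]; norm_num, fun _ => ?_⟩
    exact nonempty_ringEquiv_QSqrt hK (by rw [hsq, e]) not_isSquare_thirteen
  · exact ⟨e.le, fun e' => absurd e' e.ne'⟩

theorem cusp_of_isOfFinAddOrder [DecidableEq K] (hK : Module.finrank ℚ K = 2)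
    {W : WeierstrassCurve K} (hW : W = cubicCurve (-1 : K) 1 0) (x y : K)
    (h : W.toAffine.Nonsingular x y)
    (hfin : IsOfFinAddOrder (Affine.Point.some x y h : W.toAffine.Point)) :
    x * (x - 1) * (x + 1) * (x ^ 2 - x + 1) * (x ^ 2 + 1) * (x ^ 2 - 4 * x + 1) = 0 := by
  subst hW
  obtain ⟨σ, hσ⟩ := exists_isQuadConj K hK
  obtain ⟨o, ho, h2, hH⟩ := exists_isOrd hK
  exact cusp_of_eight_nsmul_eq_zero (fun i s hi hs => hσ.not_sqrt_neg_one_and_neg_three hi hs) h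
    (eight_nsmul_eq_zero_of_isOfFinAddOrder ho h2 hH hfin)

theorem isX₁Cusp_of_mem_torsionPoints (hK : Module.finrank ℚ K = 2)
    {R : (X₁TwoTwelve⁄K).toAffine.Point} (hR : R ∈ torsionPoints (X₁TwoTwelve⁄K)) :
    IsX₁Cusp R := by
  classical
  rcases R with _ | ⟨x, y, h⟩
  · trivial
  · exact cusp_of_isOfFinAddOrder hK (X₁_baseChange K) x y h hR

/-- In rank zero every point satisfies a nonzero integer relation, hence is torsion, hence a cusp.
-/
theorem X₁_hasPositiveRank_of_not_isX₁Cusp (hK : Module.finrank ℚ K = 2)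
    {R : (X₁TwoTwelve⁄K).toAffine.Point} (hR : ¬ IsX₁Cusp R) : X₁TwoTwelveHasPositiveRank K := by
  classical
  unfold X₁TwoTwelveHasPositiveRank
  rw [pos_iff_ne_zero]
  intro h
  rw [rank_eq_zero_iff] at h
  obtain ⟨a, ha, h0⟩ := h R
  exact hR (isX₁Cusp_of_mem_torsionPoints hK (isOfFinAddOrder_iff_zsmul_eq_zero.2 ⟨a, ha, h0⟩))

theorem X₁_torsion_rat [DecidableEq ℚ] :
    (∀ P : (X₁TwoTwelve⁄ℚ).toAffine.Point, IsOfFinAddOrder P ↔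
      P = 0 ∨ ∃ x y h, P = .some x y h ∧ ((x = 0 ∧ y = 0) ∨ (x = 1 ∧ y = 1) ∨ (x = 1 ∧ y = -1))) ∧
    Nonempty (AddCommGroup.torsion (X₁TwoTwelve⁄ℚ).toAffine.Point ≃+ ZMod 4) := by
  classical
  have hns (d : ℤ) (hd : ¬ IsSquare d) (z : ℚ) : z ^ 2 ≠ d := fun h =>
    hd (Rat.isSquare_intCast_iff.1 ⟨z, by rw [← h, sq]⟩)
  refine torsion_eq_zmultiples ?_ ?_ ?_ (X₁_baseChange ℚ) ?_
  · intro z; nlinarith [sq_nonneg z]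
  · have := hns 3 (by
      rintro ⟨r, hr⟩
      have : r < 2 := by nlinarith
      have : -2 < r := by nlinarith
      interval_cases r <;> omega)
    exact_mod_cast this
  · intro z; nlinarith [sq_nonneg z]
  · intro x y h hfin
    -- Rational torsion stays torsion in any quadratic extension, where it is already known to be
    -- cuspidal; ℚ(√13) serves as one.
    have hK := QSqrt.finrank_eq not_isSquare_thirteen
    have := (Affine.Point.baseChange (W' := X₁TwoTwelve.toAffine) ℚ (QSqrt 13)).isOfFinAddOrder hfin
    have := cusp_of_isOfFinAddOrder hK (X₁_baseChange (QSqrt 13)) _ _ _ this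
    apply (algebraMap ℚ (QSqrt 13)).injective
    simpa [map_ofNat] using this

theorem X₁_torsion_quadratic (hK : Module.finrank ℚ K = 2) (h1 : IsEmpty (K ≃+* QSqrt (-1)))
    (h3 : IsEmpty (K ≃+* QSqrt 3)) (h3' : IsEmpty (K ≃+* QSqrt (-3))) :
    (∀ R, R ∈ torsionPoints (X₁TwoTwelve⁄K) ↔
      ∃ S ∈ torsionPoints (X₁TwoTwelve⁄ℚ), X₁TwoTwelveBaseChange K S = R) ∧
    HasTorsionFour (X₁TwoTwelve⁄K) := by
  classical
  have hno (d : ℤ) (hd : ¬ IsSquare d) (he : IsEmpty (K ≃+* QSqrt d)) (z : K) : z ^ 2 ≠ d := by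
    intro hz
    obtain ⟨e⟩ := nonempty_ringEquiv_QSqrt hK hz (fun h => hd (Rat.isSquare_intCast_iff.1 h))
    exact he.elim e
  obtain ⟨hiff, hfour⟩ := torsion_eq_zmultiples (K := K)
    (by
      have := hno (-1) (by rintro ⟨r, hr⟩; nlinarith [mul_self_nonneg r]) h1
      exact_mod_cast this)
    (by
      have := hno 3 (by
        rintro ⟨r, hr⟩
        have : r < 2 := by nlinarith
        have : -2 < r := by nlinarith
        interval_cases r <;> omega) h3
      exact_mod_cast this)
    (by
      have := hno (-3) (by rintro ⟨r, hr⟩; nlinarith [mul_self_nonneg r]) h3'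
      exact_mod_cast this)
    (X₁_baseChange K) (cusp_of_isOfFinAddOrder hK (X₁_baseChange K))
  let : DecidableEq ℚ := fun _ _ => Classical.propDecidable _
  refine ⟨fun R => ⟨fun hR => ?_, ?_⟩, hfour⟩
  · rcases (hiff R).1 hR with rfl | ⟨x, y, h, rfl, hxy⟩
    · exact ⟨0, zero_mem _, map_zero _⟩
    · obtain ⟨q, r, hq, hr, hqr⟩ : ∃ q r : ℚ, algebraMap ℚ K q = x ∧ algebraMap ℚ K r = y ∧
          ((q = 0 ∧ r = 0) ∨ (q = 1 ∧ r = 1) ∨ (q = 1 ∧ r = -1)) := by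
        rcases hxy with ⟨rfl, rfl⟩ | ⟨rfl, rfl⟩ | ⟨rfl, rfl⟩
        · exact ⟨0, 0, by simp⟩
        · exact ⟨1, 1, by simp⟩
        · exact ⟨1, -1, by simp⟩
      subst hq hr
      have hn : (X₁TwoTwelve⁄ℚ).toAffine.Nonsingular q r :=
        (X₁TwoTwelve.toAffine.baseChange_nonsingular (f := Algebra.ofId ℚ K)
          (Algebra.ofId ℚ K).injective q r).1 h
      exact ⟨.some q r hn, (X₁_torsion_rat.1 _).2 (.inr ⟨q, r, hn, rfl, hqr⟩), rfl⟩
  · rintro ⟨S, hS, rfl⟩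
    exact (Affine.Point.baseChange (W' := X₁TwoTwelve.toAffine) ℚ K).isOfFinAddOrder hS

end QuadraticPoints

/-! ### Subgroups generated by elements of orders 2 and 12. -/

section Groups

variable {G : Type*} [AddCommGroup G] {P Q : G}

/-- The only element of order 2 in the group generated by Q is 6Q, so P ≠ 6Q makes the sum direct.
-/
theorem AddSubgroup.nonempty_closure_pair_equiv (hP : addOrderOf P = 2) (hQ : addOrderOf Q = 12)
    (hne : P ≠ 6 • Q) : Nonempty (AddSubgroup.closure {P, Q} ≃+ ZMod 2 × ZMod 12) := by
  have hP2 : (2 : ℤ) • P = 0 := by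
    have := addOrderOf_nsmul_eq_zero P
    rw [hP] at this; exact_mod_cast this
  have hQ12 : (12 : ℤ) • Q = 0 := by
    have := addOrderOf_nsmul_eq_zero Q
    rw [hQ] at this; exact_mod_cast this
  let f : ZMod 2 →+ G := ZMod.lift 2 ⟨zmultiplesHom G P, by simpa using hP2⟩
  let g : ZMod 12 →+ G := ZMod.lift 12 ⟨zmultiplesHom G Q, by simpa using hQ12⟩
  have hf (k : ℤ) : f k = k • P := by simp [f]
  have hg (k : ℤ) : g k = k • Q := by simp [g]
  have hinj : Function.Injective (f.coprod g) := by
    rw [injective_iff_map_eq_zero]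
    rintro ⟨a, b⟩ h
    obtain ⟨a, rfl⟩ := ZMod.intCast_surjective a
    obtain ⟨b, rfl⟩ := ZMod.intCast_surjective b
    rw [AddMonoidHom.coprod_apply, hf, hg] at h
    -- Doubling a relation aP + bQ = 0 removes P, so 6 divides b; an odd a would then give P = 0 or
    -- P = 6Q.
    have h2 : (2 * b) • Q = 0 := by
      have : (2 * b) • Q = (2 : ℤ) • (a • P + b • Q) - a • ((2 : ℤ) • P) := by
        rw [smul_add, mul_smul, smul_comm a (2 : ℤ) P]; abel
      rw [this, h, hP2, smul_zero, smul_zero, sub_zero]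
    rw [← addOrderOf_dvd_iff_zsmul_eq_zero, hQ] at h2
    obtain ⟨k, rfl⟩ : (6 : ℤ) ∣ b := by push_cast at h2; omega
    rcases Int.even_or_odd' a with ⟨i, rfl | rfl⟩
    · have hz : (6 * k) • Q = 0 := by
        rwa [mul_comm 2 i, mul_smul i 2 P, hP2, smul_zero, zero_add] at h
      rw [← addOrderOf_dvd_iff_zsmul_eq_zero, hQ] at hz
      rw [Prod.mk_eq_zero, ZMod.intCast_zmod_eq_zero_iff_dvd, ZMod.intCast_zmod_eq_zero_iff_dvd]
      exact ⟨by simp, by exact_mod_cast hz⟩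
    · exfalso
      rw [add_smul, one_smul, mul_comm 2 i, mul_smul i 2 P, hP2, smul_zero, zero_add] at h
      rcases Int.even_or_odd' k with ⟨j, rfl | rfl⟩
      · rw [show 6 * (2 * j) = j * 12 by ring, mul_smul j 12 Q, hQ12, smul_zero, add_zero] at h
        rw [h, addOrderOf_zero] at hP
        omega
      · apply hne
        rw [show 6 * (2 * j + 1) = (j + 1) * 12 - 6 by ring, sub_smul, mul_smul (j + 1) 12 Q, hQ12,
          smul_zero, zero_sub, add_neg_eq_zero] at h
        rw [h]; norm_cast
  have hrange : (f.coprod g).range = AddSubgroup.closure {P, Q} := by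
    apply le_antisymm
    · rintro _ ⟨⟨a, b⟩, rfl⟩
      obtain ⟨a, rfl⟩ := ZMod.intCast_surjective a
      obtain ⟨b, rfl⟩ := ZMod.intCast_surjective b
      rw [AddMonoidHom.coprod_apply, hf, hg]
      exact add_mem (zsmul_mem (AddSubgroup.subset_closure (by simp)) _)
        (zsmul_mem (AddSubgroup.subset_closure (by simp)) _)
    · rw [AddSubgroup.closure_le]
      rintro _ (rfl | rfl)
      · refine ⟨(1, 0), ?_⟩
        have := hf 1
        rw [Int.cast_one, one_smul] at this
        simp [this]
      · refine ⟨(0, 1), ?_⟩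
        have := hg 1
        rw [Int.cast_one, one_smul] at this
        simp [this]
  rw [← hrange]
  exact ⟨(AddMonoidHom.ofInjective hinj).symm⟩

/-- Otherwise the group is cyclic, generated by Q, and has 12 elements instead of 24. -/
theorem AddSubgroup.ne_six_nsmul_of_closure_pair_equiv (hQ : addOrderOf Q = 12)
    (h : Nonempty (AddSubgroup.closure {P, Q} ≃+ ZMod 2 × ZMod 12)) : P ≠ 6 • Q := by
  rintro rfl
  obtain ⟨e⟩ := h
  have h1 : AddSubgroup.closure {6 • Q, Q} = AddSubgroup.zmultiples Q := by
    apply le_antisymm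
    · rw [AddSubgroup.closure_le]
      rintro _ (rfl | rfl)
      · exact nsmul_mem (AddSubgroup.mem_zmultiples Q) 6
      · exact AddSubgroup.mem_zmultiples _
    · rw [AddSubgroup.zmultiples_le]
      exact AddSubgroup.subset_closure (by simp)
  have h2 := Nat.card_congr e.toEquiv
  rw [h1, Nat.card_zmultiples, hQ, Nat.card_prod, Nat.card_zmod, Nat.card_zmod] at h2
  omega

theorem exists_pair_of_torsion_equiv {H : AddSubgroup G} (h : Nonempty (H ≃+ ZMod 2 × ZMod 12)) :
    ∃ P Q : G, addOrderOf P = 2 ∧ addOrderOf Q = 12 ∧ P ≠ 6 • Q := by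
  obtain ⟨e⟩ := h
  refine ⟨e.symm (1, 0), e.symm (0, 1), ?_, ?_, ?_⟩
  · rw [AddSubgroup.addOrderOf_coe, AddEquiv.addOrderOf_eq, Prod.addOrderOf_mk]
    simp [ZMod.addOrderOf_one]
  · rw [AddSubgroup.addOrderOf_coe, AddEquiv.addOrderOf_eq, Prod.addOrderOf_mk]
    simp [ZMod.addOrderOf_one]
  · rw [← AddSubgroup.coe_nsmul, ← map_nsmul, Ne, Subtype.coe_inj, e.symm.injective.eq_iff]
    simp

end Groups

/-! ### Multiples of the origin on the Tate normal form. -/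

section Tate

/-- The Tate normal form `Y² + (1 - c)XY - bY = X³ - bX²`. -/
abbrev tateCurve {K : Type*} [Field K] (b c : K) : WeierstrassCurve K := ⟨1 - c, -b, -b, 0, 0⟩

variable {K : Type*} [Field K] {b c : K}

theorem tateCurve_nonsingular_zero (hb : b ≠ 0) : (tateCurve b c).toAffine.Nonsingular 0 0 := by
  rw [Affine.nonsingular_iff, Affine.equation_iff]
  simp [hb.symm]

/-- The factors in m, with m + 2, are exactly those matched with the cusps in
`cusp_polynomial_eq_zero_iff`. -/
theorem tateCurve_Δ {m : K} (hm : m + 2 ≠ 0)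
    (hc : c = m * (m + 1) * (m ^ 2 + m + 1) / (m + 2)) (hb : b = c * (m ^ 2 + 2 * m + 2) / (m + 2)) :
    (tateCurve b c).Δ = m ^ 6 * (m + 1) ^ 12 * (m ^ 2 + m + 1) ^ 4 * (m ^ 2 + 2 * m + 2) ^ 3 *
      (m ^ 2 - 2 * m - 2) / (m + 2) ^ 10 := by
  subst hb hc
  simp only [Δ, b₂, b₄, b₆, b₈]
  field_simp
  ring

variable [DecidableEq K] (h : (tateCurve b c).toAffine.Nonsingular 0 0)

/-- The multiples `2Q` and `3Q` of the point `Q = (0, 0)`. -/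
theorem tateCurve_multiples (hb : b ≠ 0) : ∃ h₂ h₃,
    2 • (Affine.Point.some 0 0 h : (tateCurve b c).toAffine.Point) = .some b (b * c) h₂ ∧
    3 • (Affine.Point.some 0 0 h : (tateCurve b c).toAffine.Point) = .some c (b - c) h₃ := by
  obtain ⟨h₂, e₂⟩ := WeierstrassCurve.add_self_eq_of_tangent h (l := 0) (x₃ := b) (y₃ := b * c)
    (by simpa using hb) (by simp) (by simp) (by simp; ring)
  obtain ⟨h₃, e₃⟩ := WeierstrassCurve.add_eq_of_chord h₂ h (l := c) (x₃ := c) (y₃ := b - c)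
    hb (by ring) (by simp; ring) (by simp; ring)
  refine ⟨h₂, h₃, by rw [two_nsmul, e₂], ?_⟩
  rw [show 3 = 2 + 1 from rfl, add_nsmul, two_nsmul, e₂, one_nsmul, e₃]

theorem tateCurve_four_nsmul (hb : b ≠ 0) :
    4 • (Affine.Point.some 0 0 h : (tateCurve b c).toAffine.Point) = 0 ↔ c = 0 := by
  obtain ⟨h₂, h₃, e₂, e₃⟩ := tateCurve_multiples h hb
  rw [show 4 = 2 + 2 from rfl, add_nsmul, e₂]
  constructor
  · intro h0
    by_contra hc
    obtain ⟨h₄, e₄⟩ := WeierstrassCurve.add_self_eq_of_tangent h₂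
      (l := (3 * b ^ 2 + 2 * (-b) * b - (1 - c) * (b * c)) / (b * c))
      (by
        have : 2 * (b * c) + (1 - c) * b + -b = b * c := by ring
        simp only [this]; exact mul_ne_zero hb hc)
      (by
        have : 2 * (b * c) + (1 - c) * b + -b = b * c := by ring
        simp only [this]
        field_simp
        ring) rfl rfl
    rw [e₄] at h0
    exact Affine.Point.some_ne_zero _ h0
  · intro hc
    exact WeierstrassCurve.add_self_eq_zero h₂ (by simp [hc])

theorem tateCurve_five_nsmul (hb : b ≠ 0) (hbc : b = c) :
    5 • (Affine.Point.some 0 0 h : (tateCurve b c).toAffine.Point) = 0 := by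
  obtain ⟨h₂, h₃, e₂, e₃⟩ := tateCurve_multiples h hb
  rw [show 5 = 2 + 3 from rfl, add_nsmul, e₂, e₃]
  refine Affine.Point.add_of_Y_eq hbc ?_
  rw [Affine.negY, ← hbc]
  simp; ring

theorem tateCurve_six_nsmul_eq_zero (hb : b ≠ 0) (hbc : b = c + c ^ 2) :
    6 • (Affine.Point.some 0 0 h : (tateCurve b c).toAffine.Point) = 0 := by
  obtain ⟨h₂, h₃, e₂, e₃⟩ := tateCurve_multiples h hb
  rw [show 6 = 3 + 3 from rfl, add_nsmul, e₃]
  exact WeierstrassCurve.add_self_eq_zero h₃ (by simp [hbc]; ring)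

/-- The parameters n and s keep the tangent at 3Q simple, with slope (s - n + 1)/n. The last
relation measures the failure of 6Q to be its own negative: as c ≠ 0 excludes s = -1, 12Q = 0 means
s = (n - 1)(n - 2). -/
theorem tateCurve_six_nsmul (hb : b ≠ 0) (hc : c ≠ 0) {n s : K} (hn : n ≠ 0) (hs : s ≠ 0)
    (hcn : c = (s + 1) * s / n) (hbn : b = (s + 1) * s * (n + s) / n ^ 2) :
    ∃ X Y h₆, 6 • (Affine.Point.some 0 0 h : (tateCurve b c).toAffine.Point) = .some X Y h₆ ∧
      n ^ 2 * X = (s - n + 1) ^ 2 + (n - (s + 1) * s) * (s - n + 1) + (s + 1) * s * (s - n) ∧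
      n ^ 3 * (2 * Y + (1 - c) * X - b) = (s - (n - 1) * (n - 2)) * (s + 1) ^ 2 := by
  obtain ⟨h₂, h₃, e₂, e₃⟩ := tateCurve_multiples h hb
  rw [show 6 = 3 + 3 from rfl, add_nsmul, e₃]
  have hs1 : s + 1 ≠ 0 := by rintro h0; apply hc; rw [hcn, h0]; simp
  have hne : 2 * (b - c) + (1 - c) * c + -b = -((s + 1) * s ^ 3) / n ^ 2 := by
    rw [hbn, hcn]; field_simp; ring
  obtain ⟨h₆, e₆⟩ := WeierstrassCurve.add_self_eq_of_tangent h₃ (l := (s - n + 1) / n)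
    (by simp only [hne]; simp [hs, hs1, hn])
    (by simp only [hne]; rw [hbn, hcn]; field_simp; ring) rfl rfl
  refine ⟨_, _, h₆, e₆, ?_, ?_⟩
  · simp only [hbn, hcn]; field_simp; ring
  · simp only [hbn, hcn]; field_simp; ring

end Tate

/-! ### Cusps in terms of the parameter m. -/

section Cusps

variable {K : Type*} [Field K] [CharZero K] {x y m : K}

/-- The quadratic relation matches factors: m = 0 gives x² + 1, m = -1 gives x(x - 1), m = -2 gives
x² - 4x + 1, and m² + m + 1 gives x + 1 or x² - x + 1. The factors m² + 2m + 2 and m² - 2m - 2 are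
those of the discriminant in x, with double roots x = -(m + 1) and x = m + 1. -/
theorem cusp_polynomial_eq_zero_iff (hq : x ^ 2 - m ^ 2 * x + (m + 1) ^ 2 = 0) :
    x * (x - 1) * (x + 1) * (x ^ 2 - x + 1) * (x ^ 2 + 1) * (x ^ 2 - 4 * x + 1) = 0 ↔
      m * (m + 1) * (m + 2) * (m ^ 2 + m + 1) * (m ^ 2 + 2 * m + 2) * (m ^ 2 - 2 * m - 2) = 0 := by
  have h2 : (2 : K) ≠ 0 := two_ne_zero
  simp only [mul_eq_zero]
  constructor
  · rintro (((((h | h) | h) | h) | h) | h)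
    · have : m + 1 = 0 := by
        rw [h] at hq
        refine pow_eq_zero_iff two_ne_zero |>.1 ?_
        linear_combination hq
      tauto
    · have : m + 1 = 0 := mul_left_cancel₀ h2 (by linear_combination hq - (x + 1 - m ^ 2) * h)
      tauto
    · have : m ^ 2 + m + 1 = 0 :=
        mul_left_cancel₀ h2 (by linear_combination hq - (x - 1 - m ^ 2) * h)
      tauto
    · have hy : m * (x - 1) - 1 = 0 := by
        refine pow_eq_zero_iff two_ne_zero |>.1 ?_
        linear_combination (1 - x) * hq + x * h
      have hx : x - 1 ≠ 0 := by
        intro hx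
        apply one_ne_zero (α := K)
        linear_combination h - x * hx
      have : m ^ 2 + m + 1 = 0 := by
        apply mul_left_cancel₀ (pow_ne_zero 2 hx)
        linear_combination (m * (x - 1) + 1 + (x - 1)) * hy + h
      tauto
    · have h1 : m * (m * x - (m + 2)) = 0 := by linear_combination h - hq
      rcases mul_eq_zero.1 h1 with h1 | h1
      · tauto
      · have : m ^ 2 + 2 * m + 2 = 0 :=
          mul_left_cancel₀ h2 (by linear_combination m ^ 2 * h - (m * x + m + 2) * h1)
        tauto
    · have h1 : (m + 2) * ((m - 2) * x - m) = 0 := by linear_combination h - hq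
      rcases mul_eq_zero.1 h1 with h1 | h1
      · tauto
      · have : m ^ 2 - 2 * m - 2 = 0 := mul_left_cancel₀ h2 (by
          linear_combination ((m - 2) * x + m - 4 * (m - 2)) * h1 - (m - 2) ^ 2 * h)
        tauto
  · rintro (((((h | h) | h) | h) | h) | h)
    · have : x ^ 2 + 1 = 0 := by linear_combination hq + (m * x - m - 2) * h
      tauto
    · have : x * (x - 1) = 0 := by linear_combination hq + ((m - 1) * x - (m + 1)) * h
      rcases mul_eq_zero.1 this with h | h <;> tauto
    · have : x ^ 2 - 4 * x + 1 = 0 := by linear_combination hq + ((m - 2) * x - m) * h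
      tauto
    · have : (x + 1) * (x + m) = 0 := by linear_combination hq + (x - 1) * h
      rcases mul_eq_zero.1 this with h' | h'
      · tauto
      · have : x ^ 2 - x + 1 = 0 := by linear_combination h + (x - m - 1) * h'
        tauto
    · have hx : x + m + 1 = 0 := by
        refine pow_eq_zero_iff two_ne_zero |>.1 ?_
        linear_combination hq + (x + 1) * h - h
      have : x ^ 2 + 1 = 0 := by linear_combination (x - m - 1) * hx + h
      tauto
    · have hx : x - m - 1 = 0 := by
        refine pow_eq_zero_iff two_ne_zero |>.1 ?_
        linear_combination hq + x * h
      have : x ^ 2 - 4 * x + 1 = 0 := by linear_combination (x + m + 1 - 4) * hx + h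
      tauto

omit [CharZero K] in
theorem equation_of_param (hq : x ^ 2 - m ^ 2 * x + (m + 1) ^ 2 = 0) (hy : m * (x - 1) = y + 1) :
    y ^ 2 = x ^ 3 - x ^ 2 + x := by
  linear_combination (1 - x) * hq - (m * (x - 1) - 1 + y) * hy

-- The line y + 1 = m(x - 1) meets the curve at (1, -1); the quadratic is what remains after
-- dividing by x - 1.
omit [CharZero K] in
theorem param_of_equation (he : y ^ 2 = x ^ 3 - x ^ 2 + x) (hx : x ≠ 1)
    (hy : m * (x - 1) = y + 1) : x ^ 2 - m ^ 2 * x + (m + 1) ^ 2 = 0 := by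
  apply mul_left_cancel₀ (sub_ne_zero.2 hx)
  linear_combination -he - (m * (x - 1) - 1 + y) * hy

end Cusps

/-! ### The fibre at a non-cuspidal point is a triple. -/

section Moduli

variable {K : Type*} [Field K] [CharZero K]

omit [CharZero K] in
theorem carries_one {W : WeierstrassCurve K} {x y : K} (h : W.toAffine.Nonsingular x y) :
    Carries 1 (.some x y h) x y := by
  refine ⟨by simpa [VariableChange.one_def] using h, by simp [VariableChange.one_def]⟩

/-- The quadratic factor of the `2`-division polynomial of the fibre. -/
theorem fibre_two_division {b c m x X : K} (hm : m + 2 ≠ 0)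
    (hc : c = m * (m + 1) * (m ^ 2 + m + 1) / (m + 2)) (hb : b = c * (m ^ 2 + 2 * m + 2) / (m + 2))
    (hX : X = m * (m ^ 2 + 2 * m + 2) * (2 + 2 * m + m ^ 2 + x * m ^ 2 - m ^ 4) / (4 * (m + 2))) :
    4 * X ^ 3 + ((1 - c) ^ 2 - 4 * b) * X ^ 2 - 2 * (1 - c) * b * X + b ^ 2 =
      (X + (m + 1) * (m ^ 2 + m + 1) / (m + 2) ^ 2) *
        (m ^ 6 * (m ^ 2 + 2 * m + 2) ^ 2 / (m + 2) ^ 2) *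
        ((x ^ 2 - m ^ 2 * x + (m + 1) ^ 2) / 4) := by
  subst hX hb hc
  field_simp
  ring

variable [DecidableEq K]

/-- The points of order `2` and `12` on the fibre. -/
theorem fibre_points {b c m x X Y : K}
    (hc : c = m * (m + 1) * (m ^ 2 + m + 1) / (m + 2)) (hb : b = c * (m ^ 2 + 2 * m + 2) / (m + 2))
    (hX : X = m * (m ^ 2 + 2 * m + 2) * (2 + 2 * m + m ^ 2 + x * m ^ 2 - m ^ 4) / (4 * (m + 2)))
    (hY : Y = (b - (1 - c) * X) / 2) (hq : x ^ 2 - m ^ 2 * x + (m + 1) ^ 2 = 0)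
    (hne : m * (m + 1) * (m + 2) * (m ^ 2 + m + 1) * (m ^ 2 + 2 * m + 2) * (m ^ 2 - 2 * m - 2) ≠ 0) :
    (tateCurve b c).IsElliptic ∧ ∃ (hP : (tateCurve b c).toAffine.Nonsingular X Y)
      (hQ : (tateCurve b c).toAffine.Nonsingular 0 0),
      addOrderOf (.some X Y hP : (tateCurve b c).toAffine.Point) = 2 ∧
      addOrderOf (.some 0 0 hQ : (tateCurve b c).toAffine.Point) = 12 ∧
      (.some X Y hP : (tateCurve b c).toAffine.Point) ≠ 6 • .some 0 0 hQ := by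
  simp only [mul_ne_zero_iff] at hne
  obtain ⟨⟨⟨⟨⟨h1, h2⟩, h3⟩, h4⟩, h5⟩, h6⟩ := hne
  have hell : (tateCurve b c).IsElliptic := by
    refine ⟨isUnit_iff_ne_zero.2 ?_⟩
    rw [tateCurve_Δ h3 hc hb]
    simp [*]
  have hc0 : c ≠ 0 := by rw [hc]; simp [*]
  have hb0 : b ≠ 0 := by rw [hb]; simp [*]
  have hpsi := fibre_two_division h3 hc hb hX
  rw [hq, zero_div, mul_zero] at hpsi
  have hP : (tateCurve b c).toAffine.Nonsingular X Y := by
    rw [← Affine.equation_iff_nonsingular, Affine.equation_iff]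
    simp only
    rw [hY]
    linear_combination -hpsi / 4
  have hQ := tateCurve_nonsingular_zero (c := c) hb0
  -- With n = m + 2 and s = m(m + 1), the condition s = (n - 1)(n - 2) for 12Q = 0 holds
  -- identically.
  obtain ⟨X₆, Y₆, h₆, e₆, hX₆, hY₆⟩ := tateCurve_six_nsmul hQ hb0 hc0 (n := m + 2) (s := m * (m + 1))
    h3 (mul_ne_zero h1 h2) (by rw [hc]; ring) (by rw [hb, hc]; field_simp; ring)
  have hX₆' : X₆ = -((m + 1) * (m ^ 2 + m + 1)) / (m + 2) ^ 2 := by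
    rw [eq_div_iff (pow_ne_zero 2 h3)]
    linear_combination hX₆
  have hY₆' : 2 * Y₆ + (1 - c) * X₆ - b = 0 := by
    apply mul_left_cancel₀ (pow_ne_zero 3 h3)
    rw [hY₆]; ring
  refine ⟨hell, hP, hQ, ?_, ?_, ?_⟩
  · refine addOrderOf_eq_prime ?_ (Affine.Point.some_ne_zero _)
    rw [two_nsmul]
    exact WeierstrassCurve.add_self_eq_zero hP (by simp only; rw [hY]; ring)
  · refine addOrderOf_eq_of_nsmul_and_div_prime_nsmul (by norm_num) ?_ ?_
    · rw [show 12 = 6 + 6 from rfl, add_nsmul, e₆]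
      exact WeierstrassCurve.add_self_eq_zero h₆ (by simp only; linear_combination hY₆')
    · intro p hp hp12
      have hp' : p = 2 ∨ p = 3 := by
        have : p ∈ Nat.primeFactors 12 := by simp [hp, hp12]
        have h12 : Nat.primeFactors 12 = {2, 3} := by
          rw [show 12 = 2 ^ 2 * 3 from rfl, Nat.primeFactors_mul (by norm_num) (by norm_num),
            Nat.primeFactors_prime_pow two_ne_zero Nat.prime_two, Nat.prime_three.primeFactors]
          rfl
        simpa [h12] using this
      rcases hp' with rfl | rfl
      · norm_num
        rw [e₆]; exact Affine.Point.some_ne_zero _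
      · norm_num
        rw [tateCurve_four_nsmul hQ hb0]
        exact hc0
  · rw [e₆]
    intro he
    have hXX : X = X₆ := (Affine.Point.some.inj he).1
    rw [hXX, hX₆'] at hX
    have hx : m * (m + 2) * (m ^ 2 + 2 * m + 2) * (2 + 2 * m + m ^ 2 + x * m ^ 2 - m ^ 4) =
        -(4 * (m + 1) * (m ^ 2 + m + 1)) := by
      field_simp at hX
      linear_combination -hX
    -- Eliminating x between `hx` and the quadratic: if the abscissas of P and 6Q coincided, m would
    -- be a root of one of the excluded factors.
    have : (m + 1) ^ 6 * (m ^ 2 + m + 1) ^ 2 = 0 := by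
      linear_combination (m * (m + 2) * (m ^ 2 + 2 * m + 2)) ^ 2 * m ^ 4 / 16 * hq
        - (m * (m + 2) * (m ^ 2 + 2 * m + 2) * (2 + 2 * m + m ^ 2 + x * m ^ 2 - m ^ 4)
          - 4 * (m + 1) * (m ^ 2 + m + 1) - 16 * m - 40 * m ^ 2 - 48 * m ^ 3 - 32 * m ^ 4 - 8 * m ^ 5
          + 4 * m ^ 6 + 4 * m ^ 7 + m ^ 8) / 16 * hx
    simp [*] at this

omit [DecidableEq K] in
theorem exists_represents [Algebra ℚ K] {R : (X₁TwoTwelve⁄K).toAffine.Point} (hR : ¬ IsX₁Cusp R) :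
    ∃ T : TwoTwelveTriple K, Represents R T := by
  classical
  rcases R with _ | ⟨x, y, h⟩
  · exact absurd trivial hR
  have hcusp : ¬ (x * (x - 1) * (x + 1) * (x ^ 2 - x + 1) * (x ^ 2 + 1) * (x ^ 2 - 4 * x + 1) = 0) :=
    hR
  have he : y ^ 2 = x ^ 3 - x ^ 2 + x := by
    have h' := h
    rw [X₁_baseChange, cubicCurve_nonsingular] at h'
    linear_combination h'.1
  have hx : x ≠ 1 := by
    rintro rfl; simp at hcusp
  have hy : Fibre.m x y * (x - 1) = y + 1 := div_mul_cancel₀ _ (sub_ne_zero.2 hx)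
  have hq := param_of_equation he hx hy
  rw [cusp_polynomial_eq_zero_iff hq] at hcusp
  obtain ⟨hell, hP, hQ, oP, oQ, hPQ⟩ := fibre_points (b := Fibre.b x y) (c := Fibre.c x y)
    (X := Fibre.pX x y) (Y := Fibre.pY x y) rfl rfl rfl rfl hq hcusp
  refine ⟨⟨Fibre.curve x y, hell, .some _ _ hP, .some _ _ hQ, ?_, ?_, ?_⟩, 1, one_smul _ _,
    carries_one hP, carries_one hQ⟩
  · exact oP
  · exact oQ
  · exact AddSubgroup.nonempty_closure_pair_equiv oP oQ hPQ

end Moduli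

/-! ### Every triple comes from exactly one non-cuspidal point. -/

section Moduli

variable {K : Type*} [Field K]

/-- Translate Q to the origin and make its tangent horizontal. Then A and B are the coefficients a₃
and a₂: 2Q ≠ 0 gives A ≠ 0, and 3Q ≠ 0 (Q is not a flex) gives B ≠ 0. Scaling by u = A/B makes a₂ =
a₃. -/
theorem exists_carries_zero [DecidableEq K] {W : WeierstrassCurve K} {Q : W.toAffine.Point}
    (h2 : 2 • Q ≠ 0) (h3 : 3 • Q ≠ 0) :
    ∃ (C : VariableChange K) (b c : K), C • W = tateCurve b c ∧ b ≠ 0 ∧ Carries C Q 0 0 := by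
  rcases Q with _ | ⟨x, y, h⟩
  · exact absurd (nsmul_zero 2) h2
  have hA : 2 * y + W.a₁ * x + W.a₃ ≠ 0 := by
    intro h0
    apply h2
    rw [two_nsmul, WeierstrassCurve.add_self_eq_zero h h0]
  have he := h.1
  rw [Affine.equation_iff] at he
  obtain ⟨A, hAdef⟩ : ∃ A, A = 2 * y + W.a₁ * x + W.a₃ := ⟨_, rfl⟩
  obtain ⟨s, hs⟩ : ∃ s, s * A = 3 * x ^ 2 + 2 * W.a₂ * x + W.a₄ - W.a₁ * y :=
    ⟨_, div_mul_cancel₀ _ (by rwa [hAdef])⟩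
  obtain ⟨B, hBdef⟩ : ∃ B, B = W.a₂ - s * W.a₁ + 3 * x - s ^ 2 := ⟨_, rfl⟩
  have hA0 : A ≠ 0 := by rwa [hAdef]
  have hB0 : B ≠ 0 := by
    intro hB
    obtain ⟨h', e⟩ := WeierstrassCurve.add_self_eq_of_tangent h (l := s) (x₃ := x)
      (y₃ := -y - W.a₁ * x - W.a₃) hA (by rw [← hAdef, hs])
      (by linear_combination hB - hBdef) (by ring)
    apply h3
    rw [show 3 = 2 + 1 from rfl, add_nsmul, two_nsmul, e, one_nsmul]
    exact Affine.Point.add_of_Y_eq rfl rfl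
  have hu : A / B ≠ 0 := div_ne_zero hA0 hB0
  refine ⟨⟨Units.mk0 (A / B) hu, x, s, y⟩, -(B ^ 3 / A ^ 2), 1 - (B / A) * (W.a₁ + 2 * s), ?_, ?_, ?_⟩
  · ext
    · simp [variableChange_a₁]
    · simp only [variableChange_a₂, Units.val_inv_eq_inv_val, Units.val_mk0, ← hBdef]
      field_simp
    · simp only [variableChange_a₃, Units.val_inv_eq_inv_val, Units.val_mk0]
      rw [show W.a₃ + x * W.a₁ + 2 * y = A by rw [hAdef]; ring]
      field_simp
    · simp only [variableChange_a₄, Units.val_inv_eq_inv_val, Units.val_mk0]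
      rw [mul_eq_zero]; right
      rw [hAdef] at hs
      linear_combination -hs
    · simp only [variableChange_a₆, Units.val_inv_eq_inv_val, Units.val_mk0]
      rw [mul_eq_zero]; right
      linear_combination -he
  · simp [hA0, hB0]
  · exact ⟨by simpa using h, by simp⟩

/-- A curve in Tate normal form on which `(0, 0)` has order `12` is a fibre. -/
theorem tateCurve_param [DecidableEq K] {b c : K} (h : (tateCurve b c).toAffine.Nonsingular 0 0)
    (hb0 : b ≠ 0) (hord : addOrderOf (.some 0 0 h : (tateCurve b c).toAffine.Point) = 12) :
    ∃ m : K, m + 2 ≠ 0 ∧ c = m * (m + 1) * (m ^ 2 + m + 1) / (m + 2) ∧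
      b = c * (m ^ 2 + 2 * m + 2) / (m + 2) ∧ ∃ X Y h₆,
        6 • (.some 0 0 h : (tateCurve b c).toAffine.Point) = .some X Y h₆ ∧
          X = -((m + 1) * (m ^ 2 + m + 1)) / (m + 2) ^ 2 := by
  have hsmul (n : ℕ) (hn : n = 4 ∨ n = 5 ∨ n = 6) :
      n • (.some 0 0 h : (tateCurve b c).toAffine.Point) ≠ 0 := by
    intro h0
    have := addOrderOf_dvd_of_nsmul_eq_zero h0
    rw [hord] at this
    rcases hn with rfl | rfl | rfl <;> omega
  have hc0 : c ≠ 0 := fun hc => hsmul 4 (by norm_num) ((tateCurve_four_nsmul h hb0).2 hc)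
  have hbc : b ≠ c := fun hc => hsmul 5 (by norm_num) (tateCurve_five_nsmul h hb0 hc)
  have hbc2 : b ≠ c + c ^ 2 := fun hc => hsmul 6 (by norm_num) (tateCurve_six_nsmul_eq_zero h hb0 hc)
  have hd : b - c ≠ 0 := sub_ne_zero.2 hbc
  have hf : c + c ^ 2 - b ≠ 0 := sub_ne_zero.2 hbc2.symm
  -- `s = e - 1` and `n = (e - 1) / (d - 1)` where `d = b / c`, `e = c / (d - 1)`
  obtain ⟨s, hs⟩ : ∃ s, s = (c + c ^ 2 - b) / (b - c) := ⟨_, rfl⟩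
  obtain ⟨n, hn⟩ : ∃ n, n = c * (c + c ^ 2 - b) / (b - c) ^ 2 := ⟨_, rfl⟩
  have hs0 : s ≠ 0 := by rw [hs]; exact div_ne_zero hf hd
  have hn0 : n ≠ 0 := by rw [hn]; exact div_ne_zero (mul_ne_zero hc0 hf) (pow_ne_zero 2 hd)
  have hcn : c = (s + 1) * s / n := by
    obtain ⟨k, hk⟩ : ∃ k, k = c + c ^ 2 - b := ⟨_, rfl⟩
    rw [← hk] at hs hn hf
    rw [hs, hn]; field_simp; linear_combination -hk
  have hbn : b = (s + 1) * s * (n + s) / n ^ 2 := by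
    obtain ⟨k, hk⟩ : ∃ k, k = c + c ^ 2 - b := ⟨_, rfl⟩
    rw [← hk] at hs hn hf
    rw [hs, hn]; field_simp; linear_combination -b * hk
  obtain ⟨X, Y, h₆, e₆, hX, hY⟩ := tateCurve_six_nsmul h hb0 hc0 hn0 hs0 hcn hbn
  have hs1 : s + 1 ≠ 0 := by
    intro h0; apply hc0; rw [hcn, h0]; simp
  -- As 12Q = 0, the point 6Q is its own negative.
  have hY0 : 2 * Y + (1 - c) * X - b = 0 := by
    by_contra hne
    have hne' : 2 * Y + (tateCurve b c).a₁ * X + (tateCurve b c).a₃ ≠ 0 := by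
      simp only; rwa [← sub_eq_add_neg]
    have h12 := addOrderOf_nsmul_eq_zero (.some 0 0 h : (tateCurve b c).toAffine.Point)
    rw [hord, show 12 = 6 + 6 from rfl, add_nsmul, e₆] at h12
    obtain ⟨h', e'⟩ := WeierstrassCurve.add_self_eq_of_tangent h₆ hne' (div_mul_cancel₀ _ hne') rfl rfl
    rw [e'] at h12
    exact Affine.Point.some_ne_zero _ h12
  rw [hY0, mul_zero] at hY
  have hsn : s = (n - 1) * (n - 2) := by
    have := (mul_eq_zero.1 hY.symm).resolve_right (pow_ne_zero 2 hs1)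
    linear_combination this
  refine ⟨n - 2, by simpa using hn0, ?_, ?_, X, Y, h₆, e₆, ?_⟩
  · rw [hcn, hsn]; congr 1 <;> ring
  · rw [show n - 2 + 2 = n by ring, hbn, hcn, hsn]; field_simp; ring
  · rw [show n - 2 + 2 = n by ring, eq_div_iff (pow_ne_zero 2 hn0), mul_comm, hX, hsn]
    ring

/-- The Tate form supplies m from Q. The abscissa of P is a root of the 2-division polynomial other
than that of 6Q, and expressed through x it satisfies the quadratic of `fibre_two_division`, which
places (x, m(x - 1) - 1) on the curve. -/
theorem exists_point_represents [CharZero K] [Algebra ℚ K] (T : TwoTwelveTriple K) :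
    ∃ R : (X₁TwoTwelve⁄K).toAffine.Point, ¬ IsX₁Cusp R ∧ Represents R T := by
  classical
  obtain ⟨W, hell, P, Q, oP, oQ, gen⟩ := T
  have hPQ := AddSubgroup.ne_six_nsmul_of_closure_pair_equiv oQ gen
  have hQ (n : ℕ) (hn : n = 2 ∨ n = 3) : n • Q ≠ 0 := by
    intro h0
    have := addOrderOf_dvd_of_nsmul_eq_zero h0
    rw [oQ] at this
    rcases hn with rfl | rfl <;> omega
  obtain ⟨C, b, c, hC, hb0, hcar⟩ := exists_carries_zero (hQ 2 (by norm_num)) (hQ 3 (by norm_num))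
  have H : IsModelChange (RingHom.id K) W (tateCurve b c) C.u C.r C.s C.t :=
    hC ▸ isModelChange_smul C W
  have hellC : (tateCurve b c).IsElliptic := hC ▸ inferInstanceAs (C • W).IsElliptic
  obtain ⟨hQn, rfl⟩ := id hcar
  obtain ⟨h0, e0⟩ := H.exists_hom_some (x := (C.u : K) ^ 2 * 0 + C.r)
    (y := (C.u : K) ^ 3 * 0 + (C.u : K) ^ 2 * C.s * 0 + C.t) (X := 0) (Y := 0) rfl rfl hQn
  have oQ' := addOrderOf_injective H.hom H.hom_injective
    (.some _ _ hQn : W.toAffine.Point)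
  rw [e0, oQ] at oQ'
  rcases P with _ | ⟨xP, yP, hP⟩
  · have : addOrderOf (0 : W.toAffine.Point) = 2 := oP
    rw [addOrderOf_zero] at this; omega
  obtain ⟨X, hX⟩ : ∃ X, xP = (C.u : K) ^ 2 * X + C.r := ⟨_, H.map_x xP⟩
  obtain ⟨Y, hY⟩ : ∃ Y, yP = (C.u : K) ^ 3 * Y + (C.u : K) ^ 2 * C.s * X + C.t := by
    refine ⟨(yP - C.t - (C.u : K) ^ 2 * C.s * X) / (C.u : K) ^ 3, ?_⟩
    have := C.u.ne_zero
    field_simp; ring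
  obtain ⟨hXY, eXY⟩ := H.exists_hom_some (X := X) (Y := Y) hX hY hP
  have oP' := addOrderOf_injective H.hom H.hom_injective (.some _ _ hP : W.toAffine.Point)
  rw [eXY, oP] at oP'
  have hPQ' : (.some X Y hXY : (tateCurve b c).toAffine.Point) ≠ 6 • .some 0 0 h0 := by
    rw [← eXY, ← e0, ← map_nsmul]
    exact fun h => hPQ (H.hom_injective h)
  obtain ⟨m, hm, hc, hb, X₆, Y₆, h₆, e₆, hX₆⟩ := tateCurve_param h0 hb0 oQ'
  have hΔ := hellC.isUnit.ne_zero
  have hc0 : c ≠ 0 := by rintro rfl; apply hb0; rw [hb]; simp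
  rw [tateCurve_Δ hm hc hb] at hΔ
  have hm0 : m ≠ 0 := by rintro rfl; simp at hΔ
  have hm2 : m ^ 2 + 2 * m + 2 ≠ 0 := by intro h; rw [h] at hΔ; simp at hΔ
  -- The abscissa in the fibre is affine in x with leading coefficient m³(m² + 2m + 2) / (4(m + 2)),
  -- which is nonzero here, so it can be solved for x.
  obtain ⟨x, hx⟩ : ∃ x, X = m * (m ^ 2 + 2 * m + 2) * (2 + 2 * m + m ^ 2 + x * m ^ 2 - m ^ 4) /
      (4 * (m + 2)) :=
    ⟨(4 * (m + 2) * X / (m * (m ^ 2 + 2 * m + 2)) - 2 - 2 * m - m ^ 2 + m ^ 4) / m ^ 2, by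
      generalize m ^ 2 + 2 * m + 2 = g at hm2
      field_simp; ring⟩
  have hY2 : 2 * Y + (1 - c) * X - b = 0 := by
    by_contra hne
    have hne' : 2 * Y + (tateCurve b c).a₁ * X + (tateCurve b c).a₃ ≠ 0 := by
      simp only; rwa [← sub_eq_add_neg]
    have h2 := addOrderOf_nsmul_eq_zero (.some X Y hXY : (tateCurve b c).toAffine.Point)
    rw [oP', two_nsmul] at h2
    obtain ⟨h', e'⟩ := WeierstrassCurve.add_self_eq_of_tangent hXY hne' (div_mul_cancel₀ _ hne') rfl rfl
    rw [e'] at h2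
    exact Affine.Point.some_ne_zero _ h2
  -- Equal abscissas would mean P = ±6Q, and P = -P.
  have hXX : X ≠ X₆ := by
    rintro rfl
    rcases Affine.Point.X_eq_iff (h₁ := hXY) (h₂ := h₆) |>.1 rfl with hd | hd
    · exact hPQ' (by rw [e₆, hd])
    · have h2 := addOrderOf_nsmul_eq_zero (.some X Y hXY : (tateCurve b c).toAffine.Point)
      rw [oP', two_nsmul] at h2
      exact hPQ' (by rw [eq_neg_of_add_eq_zero_left h2, e₆, hd, neg_neg])
  have hpsi := fibre_two_division hm hc hb hx
  have heq := hXY.1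
  rw [Affine.equation_iff] at heq
  simp only at heq
  have hpsi0 : 4 * X ^ 3 + ((1 - c) ^ 2 - 4 * b) * X ^ 2 - 2 * (1 - c) * b * X + b ^ 2 = 0 := by
    linear_combination (2 * Y + (1 - c) * X - b) * hY2 - 4 * heq
  rw [hpsi0] at hpsi
  have hX6 : X + (m + 1) * (m ^ 2 + m + 1) / (m + 2) ^ 2 ≠ 0 := by
    intro h; apply hXX; rw [hX₆]; linear_combination h
  have hq : x ^ 2 - m ^ 2 * x + (m + 1) ^ 2 = 0 := by
    have := (mul_eq_zero.1 hpsi.symm).resolve_left (mul_ne_zero hX6 (by simp [hm, hm0, hm2]))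
    exact (div_eq_zero_iff.1 this).resolve_right (by norm_num)
  have hne : m * (m + 1) * (m + 2) * (m ^ 2 + m + 1) * (m ^ 2 + 2 * m + 2) * (m ^ 2 - 2 * m - 2) ≠ 0 := by
    intro h
    apply hΔ
    simp only [mul_eq_zero] at h
    rcases h with ((((h | h) | h) | h) | h) | h
    · simp [h]
    · simp [h]
    · exact absurd h hm
    · simp [h]
    · simp [h]
    · simp [h]
  rw [Ne, ← cusp_polynomial_eq_zero_iff hq] at hne
  have hx1 : x ≠ 1 := by rintro rfl; simp at hne
  have hfm : Fibre.m x (m * (x - 1) - 1) = m := by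
    rw [Fibre.m, sub_add_cancel, mul_div_cancel_right₀ _ (sub_ne_zero.2 hx1)]
  have hfc : Fibre.c x (m * (x - 1) - 1) = c := by rw [Fibre.c, hfm, hc]
  have hfb : Fibre.b x (m * (x - 1) - 1) = b := by rw [Fibre.b, hfc, hfm, hb]
  have hfX : Fibre.pX x (m * (x - 1) - 1) = X := by rw [Fibre.pX, hfm, hx]
  have hfY : Fibre.pY x (m * (x - 1) - 1) = Y := by
    rw [Fibre.pY, hfX, hfc, hfb]; linear_combination -hY2 / 2
  have hy2 := equation_of_param hq (y := m * (x - 1) - 1) (by ring)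
  have hns : (X₁TwoTwelve⁄K).toAffine.Nonsingular x (m * (x - 1) - 1) := by
    rw [X₁_baseChange, cubicCurve_nonsingular]
    refine ⟨by linear_combination hy2, ?_⟩
    by_contra! hcon
    obtain ⟨k1, k2⟩ := hcon
    have hy0 : m * (x - 1) - 1 = 0 := (mul_eq_zero.1 k2).resolve_left two_ne_zero
    rw [hy0] at hy2
    apply hne
    linear_combination -(x - 1) * (x + 1) * (x ^ 2 + 1) * (x ^ 2 - 4 * x + 1) * hy2
  refine ⟨.some x _ hns, hne, C, ?_, ?_, hcar⟩
  · rw [hC, Fibre.curve, hfc, hfb]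
  · rw [hfX, hfY]
    exact ⟨hX ▸ hY ▸ hP, by simp [hX, hY]⟩

/-- The normalisation leaves no freedom. The position of Q fixes r and t, its horizontal tangent
fixes s, and a₂ = a₃ ≠ 0 fixes u. So b and c agree; they determine m, and then the abscissa of P
determines x. -/
theorem represents_unique [CharZero K] [Algebra ℚ K] {T : TwoTwelveTriple K}
    {R R' : (X₁TwoTwelve⁄K).toAffine.Point} (hR : ¬ IsX₁Cusp R) (hR' : ¬ IsX₁Cusp R')
    (h : Represents R T) (h' : Represents R' T) : R = R' := by
  have key {x y : K} (hxy : (X₁TwoTwelve⁄K).toAffine.Nonsingular x y) (hcusp : ¬ (x * (x - 1) *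
      (x + 1) * (x ^ 2 - x + 1) * (x ^ 2 + 1) * (x ^ 2 - 4 * x + 1) = 0)) :
      ∃ m, m = Fibre.m x y ∧ y = m * (x - 1) - 1 ∧ Fibre.b x y ≠ 0 ∧ Fibre.c x y ≠ 0 ∧
        Fibre.b x y - Fibre.c x y ≠ 0 ∧
        (Fibre.b x y - Fibre.c x y) ^ 2 * (m + 2) =
          Fibre.c x y * (Fibre.c x y ^ 2 - Fibre.b x y + Fibre.c x y) ∧
        m ^ 3 * (m ^ 2 + 2 * m + 2) / (4 * (m + 2)) ≠ 0 ∧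
        Fibre.pX x y = m ^ 3 * (m ^ 2 + 2 * m + 2) / (4 * (m + 2)) * x +
          m * (m ^ 2 + 2 * m + 2) * (2 + 2 * m + m ^ 2 - m ^ 4) / (4 * (m + 2)) := by
    have he : y ^ 2 = x ^ 3 - x ^ 2 + x := by
      rw [X₁_baseChange, cubicCurve_nonsingular] at hxy
      linear_combination hxy.1
    have hx : x ≠ 1 := by
      rintro rfl; simp at hcusp
    obtain ⟨m, hm⟩ : ∃ m, m = Fibre.m x y := ⟨_, rfl⟩
    have hy : m * (x - 1) = y + 1 := by rw [hm]; exact div_mul_cancel₀ _ (sub_ne_zero.2 hx)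
    rw [cusp_polynomial_eq_zero_iff (param_of_equation he hx hy)] at hcusp
    rw [← Ne] at hcusp
    simp only [mul_ne_zero_iff] at hcusp
    obtain ⟨⟨⟨⟨⟨h1, h2⟩, h3⟩, h4⟩, h5⟩, h6⟩ := hcusp
    have hc : Fibre.c x y = m * (m + 1) * (m ^ 2 + m + 1) / (m + 2) := by rw [Fibre.c, ← hm]
    have hb : Fibre.b x y = m * (m + 1) * (m ^ 2 + m + 1) * (m ^ 2 + 2 * m + 2) / (m + 2) ^ 2 := by
      rw [Fibre.b, hc, ← hm]; field_simp
    have hbc : Fibre.b x y - Fibre.c x y = (m * (m + 1)) ^ 2 * (m ^ 2 + m + 1) / (m + 2) ^ 2 := by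
      rw [hb, hc]; field_simp; ring
    refine ⟨m, hm, by linear_combination -hy, ?_, ?_, ?_, ?_, ?_, ?_⟩
    · rw [hb]; simp [h1, h2, h3, h4, h5]
    · rw [hc]; simp [h1, h2, h3, h4]
    · rw [hbc]; simp [h1, h2, h3, h4]
    · rw [hbc, show Fibre.c x y ^ 2 - Fibre.b x y + Fibre.c x y =
        Fibre.c x y ^ 2 - (Fibre.b x y - Fibre.c x y) by ring, hbc, hc]
      field_simp; ring
    · simp [h1, h3, h5]
    · rw [Fibre.pX, ← hm]; field_simp; ring
  rcases R with _ | ⟨x, y, hxy⟩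
  · exact h.elim
  rcases R' with _ | ⟨x', y', hxy'⟩
  · exact h'.elim
  obtain ⟨m, -, hy, hb0, hc0, hbc, hm, hl, hpX⟩ := key hxy hR
  obtain ⟨m', -, hy', -, -, -, hm', -, hpX'⟩ := key hxy' hR'
  obtain ⟨C, hC, ⟨hP, eP⟩, ⟨hQ, eQ⟩⟩ := h
  obtain ⟨C', hC', ⟨hP', eP'⟩, ⟨hQ', eQ'⟩⟩ := h'
  have H := isModelChange_smul C T.W
  have H' := isModelChange_smul C' T.W
  rw [hC] at H
  rw [hC'] at H'
  rw [eQ, Affine.Point.some.injEq] at eQ'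
  rw [eP, Affine.Point.some.injEq] at eP'
  have hr : C.r = C'.r := by linear_combination eQ'.1
  have ht : C.t = C'.t := by linear_combination eQ'.2
  have a3 := H.a₃
  have a3' := H'.a₃
  have a2 := H.a₂
  have a2' := H'.a₂
  have a4 := H.a₄
  have a4' := H'.a₄
  have a1 := H.a₁
  have a1' := H'.a₁
  simp only [Fibre.curve, RingHom.id_apply, mul_zero, ← hr, ← ht] at a1 a1' a2 a2' a3 a3' a4 a4'
  have hu := C.u.ne_zero
  have hu' := C'.u.ne_zero
  have hs : C.s = C'.s := by
    have : (C.s - C'.s) * (C.u : K) ^ 3 * Fibre.b x y = 0 := by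
      linear_combination a4' - a4 - (C.s - C'.s) * a3
    have := (mul_eq_zero.1 this).resolve_right hb0
    exact sub_eq_zero.1 ((mul_eq_zero.1 this).resolve_right (pow_ne_zero 3 hu))
  rw [← hs] at a2' a1'
  have hub : (C'.u : K) = C.u := by
    have : ((C'.u : K) - C.u) * (C.u ^ 2 * Fibre.b x y) = 0 := by
      linear_combination a3 - a3' - (C'.u : K) * (a2 - a2')
    exact sub_eq_zero.1 ((mul_eq_zero.1 this).resolve_right (mul_ne_zero (pow_ne_zero 2 hu) hb0))
  rw [hub] at a1' a2'
  have hcc : Fibre.c x y = Fibre.c x' y' := mul_left_cancel₀ hu (by linear_combination a1' - a1)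
  have hbb : Fibre.b x y = Fibre.b x' y' :=
    mul_left_cancel₀ (pow_ne_zero 2 hu) (by linear_combination a2' - a2)
  rw [← hcc, ← hbb, ← hm] at hm'
  -- The parameter is recovered from m + 2 = c(c² - b + c) / (b - c)².
  have hmm : m' = m := by
    have := mul_left_cancel₀ (pow_ne_zero 2 hbc) hm'
    linear_combination this
  subst hmm
  have hpp : Fibre.pX x y = Fibre.pX x' y' := by
    apply mul_left_cancel₀ (pow_ne_zero 2 hu)
    have := eP'.1
    rw [hub] at this
    linear_combination this - hr
  rw [hpX, hpX'] at hpp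
  have hxx : x = x' := mul_left_cancel₀ hl (by linear_combination hpp)
  subst hxx
  have hyy : y = y' := by rw [hy, hy']
  subst hyy
  rfl

theorem X₁_hasPositiveRank_of_twoTwelveAppears {K : Type*} [Field K] [NumberField K]
    (hK : Module.finrank ℚ K = 2) (h : TwoTwelveAppearsOver K) : X₁TwoTwelveHasPositiveRank K := by
  classical
  obtain ⟨W, hell, htors⟩ := h
  obtain ⟨P, Q, oP, oQ, hPQ⟩ := exists_pair_of_torsion_equiv htors
  obtain ⟨R, hR, -⟩ := exists_point_represents
    ⟨W, hell, P, Q, oP, oQ, AddSubgroup.nonempty_closure_pair_equiv oP oQ hPQ⟩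
  exact X₁_hasPositiveRank_of_not_isX₁Cusp hK hR

end Moduli

/-! ### The parameter x/y near infinity over an ultrametric field. -/

section Ultrametric

variable {F : Type*} [NormedField F] [IsUltrametricDist F]

theorem norm_add_le_of_both_le {a b : F} {r : ℝ} (ha : ‖a‖ ≤ r) (hb : ‖b‖ ≤ r) : ‖a + b‖ ≤ r :=
  (IsUltrametricDist.norm_add_le_max a b).trans (max_le ha hb)

theorem norm_sub_le_of_both_le {a b : F} {r : ℝ} (ha : ‖a‖ ≤ r) (hb : ‖b‖ ≤ r) : ‖a - b‖ ≤ r :=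
  sub_eq_add_neg a b ▸ norm_add_le_of_both_le ha (by rwa [norm_neg])

omit [IsUltrametricDist F] in
theorem norm_mul_le_right {a b : F} {r : ℝ} (ha : ‖a‖ ≤ 1) (hb : ‖b‖ ≤ r) : ‖a * b‖ ≤ r := by
  rw [norm_mul]
  calc ‖a‖ * ‖b‖ ≤ 1 * ‖b‖ := by gcongr
    _ ≤ r := by rwa [one_mul]

omit [IsUltrametricDist F] in
theorem norm_mul_le_left {a b : F} {r : ℝ} (ha : ‖a‖ ≤ r) (hb : ‖b‖ ≤ 1) : ‖a * b‖ ≤ r := by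
  rw [mul_comm]; exact norm_mul_le_right hb ha

theorem norm_two_le_one : ‖(2 : F)‖ ≤ 1 := by
  rw [← one_add_one_eq_two]
  exact norm_add_le_of_both_le (norm_one (α := F)).le (norm_one (α := F)).le

theorem norm_three_le_one : ‖(3 : F)‖ ≤ 1 := by
  rw [← two_add_one_eq_three]
  exact norm_add_le_of_both_le norm_two_le_one (norm_one (α := F)).le

theorem norm_eq_of_norm_sub_lt {a b : F} (h : ‖a - b‖ < ‖b‖) : ‖a‖ = ‖b‖ := by
  rw [← sub_add_cancel a b, IsUltrametricDist.norm_add_eq_max_of_norm_ne_norm h.ne, max_eq_right h.le]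

variable {A B C : F}

theorem norm_cubic_sub_le (hA : ‖A‖ ≤ 1) (hB : ‖B‖ ≤ 1) (hC : ‖C‖ ≤ 1) {x : F} (hx : 1 ≤ ‖x‖) :
    ‖(x ^ 3 + A * x ^ 2 + B * x + C) - x ^ 3‖ ≤ ‖x‖ ^ 2 := by
  have e : (x ^ 3 + A * x ^ 2 + B * x + C) - x ^ 3 = A * x ^ 2 + B * x + C := by ring
  have h1 : (1 : ℝ) ≤ ‖x‖ ^ 2 := one_le_pow₀ hx
  have h2 : ‖x‖ ≤ ‖x‖ ^ 2 := by nlinarith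
  rw [e]
  refine norm_add_le_of_both_le (norm_add_le_of_both_le (norm_mul_le_right hA (norm_pow x 2).le)
    (norm_mul_le_right hB h2)) (hC.trans h1)

/-- The parameter `z = x / y` at a point of the kernel of reduction. -/
theorem kernel_norms (hA : ‖A‖ ≤ 1) (hB : ‖B‖ ≤ 1) (hC : ‖C‖ ≤ 1) {x y : F}
    (he : y ^ 2 = x ^ 3 + A * x ^ 2 + B * x + C) (hx : 1 < ‖x‖) :
    y ≠ 0 ∧ x ≠ 0 ∧ ‖x / y‖ ^ 2 * ‖x‖ = 1 ∧ ‖x / y‖ ^ 3 * ‖y‖ = 1 ∧ ‖x / y‖ < 1 ∧ ‖y‖ ^ 2 = ‖x‖ ^ 3 := by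
  have h0 : 0 < ‖x‖ := zero_lt_one.trans hx
  have hlt : ‖x‖ ^ 2 < ‖x‖ ^ 3 := by gcongr; norm_num
  have hy2 : ‖y‖ ^ 2 = ‖x‖ ^ 3 := by
    rw [← norm_pow, he, ← norm_pow]
    apply norm_eq_of_norm_sub_lt
    rw [norm_pow x 3]
    exact (norm_cubic_sub_le hA hB hC hx.le).trans_lt hlt
  have hy0 : y ≠ 0 := by
    rintro rfl
    rw [norm_zero, zero_pow two_ne_zero] at hy2
    exact (pow_pos h0 3).ne hy2
  have hyn : 0 < ‖y‖ := norm_pos_iff.2 hy0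
  have e1 : ‖x / y‖ ^ 2 * ‖x‖ = 1 := by
    rw [norm_div, div_pow, hy2]; field_simp
  have e2 : ‖x / y‖ ^ 3 * ‖y‖ = 1 := by
    rw [norm_div, div_pow, ← hy2]; field_simp
  refine ⟨hy0, norm_pos_iff.1 h0, e1, e2, ?_, hy2⟩
  by_contra! hc
  have : 1 ≤ ‖x / y‖ ^ 2 := one_le_pow₀ hc
  nlinarith

/-- The parameters of three collinear points almost add up to zero. -/
theorem collinear_sum (hA : ‖A‖ ≤ 1) (hB : ‖B‖ ≤ 1) (hC : ‖C‖ ≤ 1) {x₁ x₂ x₃ y₁ y₂ y₃ l n : F} {r : ℝ}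
    (hr0 : 0 ≤ r) (hr : r < 1) (h₁ : y₁ = l * x₁ + n) (h₂ : y₂ = l * x₂ + n) (h₃ : y₃ = l * x₃ + n)
    (e1 : x₁ + x₂ + x₃ = l ^ 2 - A) (e2 : x₁ * x₂ + x₁ * x₃ + x₂ * x₃ = B - 2 * l * n)
    (e3 : x₁ * x₂ * x₃ = n ^ 2 - C) (hn : n ≠ 0) (hl : ‖l‖ ≤ r ^ 2 * ‖n‖) (hn1 : 1 ≤ r ^ 3 * ‖n‖)
    (hy₁ : y₁ ≠ 0) (hy₂ : y₂ ≠ 0) (hz₁ : ‖x₁ / y₁‖ ≤ r) (hz₂ : ‖x₂ / y₂‖ ≤ r)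
    (he : y₃ ^ 2 = x₃ ^ 3 + A * x₃ ^ 2 + B * x₃ + C) :
    1 < ‖x₃‖ ∧ ‖x₁ / y₁ + x₂ / y₂ + x₃ / y₃‖ ≤ r ^ 3 := by
  have hn0 : 0 < ‖n‖ := norm_pos_iff.2 hn
  have hr2 : r ^ 2 < 1 := by nlinarith
  have hr3 : r ^ 3 ≤ r := by nlinarith
  -- In the coordinates z = x/y, w = 1/y at infinity the line becomes w = β - αz, with small α and
  -- β.
  obtain ⟨α, hα⟩ : ∃ α, l = α * n := ⟨l / n, by field_simp⟩
  obtain ⟨β, hβ⟩ : ∃ β, β * n = 1 := ⟨n⁻¹, by field_simp⟩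
  have hαn : ‖α‖ ≤ r ^ 2 := by
    rw [hα, norm_mul] at hl
    exact le_of_mul_le_mul_right hl hn0
  have hα1 : ‖α‖ ≤ 1 := hαn.trans hr2.le
  have hβn : ‖β‖ ≤ r ^ 3 := by
    have : ‖β‖ * ‖n‖ = 1 := by rw [← norm_mul, hβ, norm_one]
    exact le_of_mul_le_mul_right (this.trans_le hn1) hn0
  -- D is the product of the three ordinates divided by n³, computed from the symmetric functions of
  -- the abscissas; it is a unit because α is small.
  obtain ⟨D, hD⟩ : ∃ D, D = 1 + α * (-A + α * (B - α * C)) := ⟨_, rfl⟩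
  have hD1 : ‖D‖ = 1 := by
    rw [← norm_one (α := F)]
    apply norm_eq_of_norm_sub_lt
    rw [norm_one, hD, add_sub_cancel_left]
    refine (norm_mul_le_left hαn ?_).trans_lt hr2
    exact norm_add_le_of_both_le (by rwa [norm_neg A]) (norm_mul_le_right hα1
      (norm_sub_le_of_both_le hB (norm_mul_le_right hα1 hC)))
  have hD0 : D ≠ 0 := by
    rintro rfl; simp at hD1
  have hprod : y₁ * y₂ * y₃ = n ^ 3 * D := by
    rw [h₁, h₂, h₃, hD]
    have : (l * x₁ + n) * (l * x₂ + n) * (l * x₃ + n) = l ^ 3 * (x₁ * x₂ * x₃) +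
      l ^ 2 * n * (x₁ * x₂ + x₁ * x₃ + x₂ * x₃) + l * n ^ 2 * (x₁ + x₂ + x₃) + n ^ 3 := by ring
    rw [this, e1, e2, e3, hα]; ring
  have hy₃ : y₃ ≠ 0 := by
    rintro rfl
    rw [mul_zero] at hprod
    exact mul_ne_zero (pow_ne_zero 3 hn) hD0 hprod.symm
  have hsum : x₁ / y₁ + x₂ / y₂ + x₃ / y₃ = -(β * (A + α * (-(2 * B) + α * (3 * C)))) / D := by
    have s1 : x₁ * y₂ * y₃ + x₂ * y₁ * y₃ + x₃ * y₁ * y₂ =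
        -(n ^ 2 * (A + α * (-(2 * B) + α * (3 * C)))) := by
      rw [h₁, h₂, h₃]
      have : x₁ * (l * x₂ + n) * (l * x₃ + n) + x₂ * (l * x₁ + n) * (l * x₃ + n) +
        x₃ * (l * x₁ + n) * (l * x₂ + n) = 3 * l ^ 2 * (x₁ * x₂ * x₃) +
        2 * l * n * (x₁ * x₂ + x₁ * x₃ + x₂ * x₃) + n ^ 2 * (x₁ + x₂ + x₃) := by ring
      rw [this, e1, e2, e3, hα]; ring
    have s2 : x₁ / y₁ + x₂ / y₂ + x₃ / y₃ =
        (x₁ * y₂ * y₃ + x₂ * y₁ * y₃ + x₃ * y₁ * y₂) / (y₁ * y₂ * y₃) := by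
      field_simp
    rw [s2, s1, hprod, div_eq_div_iff (mul_ne_zero (pow_ne_zero 3 hn) hD0) hD0]
    linear_combination n ^ 2 * (A + α * (-(2 * B) + α * (3 * C))) * D * hβ
  have hsn : ‖x₁ / y₁ + x₂ / y₂ + x₃ / y₃‖ ≤ r ^ 3 := by
    rw [hsum, norm_div, norm_neg, hD1, div_one]
    refine norm_mul_le_left hβn (norm_add_le_of_both_le hA (norm_mul_le_right hα1 (norm_add_le_of_both_le ?_
      (norm_mul_le_right hα1 (norm_mul_le_right norm_three_le_one hC)))))
    rw [norm_neg]
    exact norm_mul_le_right norm_two_le_one hB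
  refine ⟨?_, hsn⟩
  have hz₃ : ‖x₃ / y₃‖ ≤ r := by
    have : x₃ / y₃ = (x₁ / y₁ + x₂ / y₂ + x₃ / y₃) - (x₁ / y₁ + x₂ / y₂) := by ring
    rw [this]
    exact norm_sub_le_of_both_le (hsn.trans hr3) (norm_add_le_of_both_le hz₁ hz₂)
  have hw₃ : ‖1 / y₃‖ < 1 := by
    have : 1 / y₃ = β - α * (x₃ / y₃) := by
      rw [eq_sub_iff_add_eq, ← mul_div_assoc, ← add_div, div_eq_iff hy₃, h₃, hα]
      linear_combination -(α * x₃ + 1) * hβ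
    rw [this]
    exact (norm_sub_le_of_both_le (hβn.trans hr3) (norm_mul_le_right hα1 hz₃)).trans_lt hr
  rw [norm_div, norm_one, div_lt_one (norm_pos_iff.2 hy₃)] at hw₃
  by_contra! hx
  have : ‖y₃ ^ 2‖ ≤ 1 := by
    have hp (k : ℕ) : ‖x₃ ^ k‖ ≤ 1 := by rw [norm_pow]; exact pow_le_one₀ (norm_nonneg _) hx
    rw [he]
    exact norm_add_le_of_both_le (norm_add_le_of_both_le (norm_add_le_of_both_le (hp 3)
      (norm_mul_le_right hA (hp 2))) (norm_mul_le_right hB hx)) hC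
  rw [norm_pow] at this
  nlinarith

variable [DecidableEq F]

/-- The kernel of reduction. -/
def InReductionKernel (P : (cubicCurve A B C).toAffine.Point) : Prop :=
  P = 0 ∨ ∃ x y h, P = .some x y h ∧ 1 < ‖x‖

omit [IsUltrametricDist F] [DecidableEq F] in
theorem inReductionKernel_zero : InReductionKernel (0 : (cubicCurve A B C).toAffine.Point) := .inl rfl

/-- The parameter `x / y` of a point. -/
noncomputable def formalParameter : (cubicCurve A B C).toAffine.Point → F
  | .zero => 0
  | .some x y _ => x / y

/-- The additive law to first order, with cubic error. The sum is the reflection of the third point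
on the line, so `collinear_sum` applies once the line is shown to be w = β - αz with |α| ≤ r² and
|β| ≤ r³. -/
theorem formalParameter_add (hA : ‖A‖ ≤ 1) (hB : ‖B‖ ≤ 1) (hC : ‖C‖ ≤ 1)
    {P Q : (cubicCurve A B C).toAffine.Point} (hP : InReductionKernel P) (hQ : InReductionKernel Q)
    (h2 : (2 : F) ≠ 0)
    {r : ℝ} (hr0 : 0 ≤ r) (hr : r < 1) (hPr : ‖formalParameter P‖ ≤ r) (hQr : ‖formalParameter Q‖ ≤ r) :
    InReductionKernel (P + Q) ∧
      ‖formalParameter (P + Q) - formalParameter P - formalParameter Q‖ ≤ r ^ 3 := by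
  have hr3 : 0 ≤ r ^ 3 := pow_nonneg hr0 3
  rcases hP with rfl | ⟨x₁, y₁, h₁, rfl, hx₁⟩
  · rw [zero_add]
    refine ⟨hQ, ?_⟩
    simpa [formalParameter, Affine.Point.zero_def] using hr3
  rcases hQ with rfl | ⟨x₂, y₂, h₂, rfl, hx₂⟩
  · rw [add_zero]
    refine ⟨.inr ⟨_, _, _, rfl, hx₁⟩, ?_⟩
    simpa [formalParameter, Affine.Point.zero_def] using hr3
  change ‖x₁ / y₁‖ ≤ r at hPr
  change ‖x₂ / y₂‖ ≤ r at hQr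
  have he₁ := (cubicCurve_nonsingular.1 h₁).1
  have he₂ := (cubicCurve_nonsingular.1 h₂).1
  obtain ⟨hy₁, hx₁0, n1, m1, -, p1⟩ := kernel_norms hA hB hC he₁ hx₁
  obtain ⟨hy₂, hx₂0, n2, m2, -, p2⟩ := kernel_norms hA hB hC he₂ hx₂
  have finish (l n x₃ y₃ : F) (h₃ : (cubicCurve A B C).toAffine.Nonsingular x₃ (-y₃))
      (e : (Affine.Point.some x₁ y₁ h₁ + Affine.Point.some x₂ y₂ h₂ :
        (cubicCurve A B C).toAffine.Point) = .some x₃ (-y₃) h₃)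
      (l1 : y₁ = l * x₁ + n) (l2 : y₂ = l * x₂ + n) (l3 : y₃ = l * x₃ + n)
      (e1 : x₁ + x₂ + x₃ = l ^ 2 - A) (e2 : x₁ * x₂ + x₁ * x₃ + x₂ * x₃ = B - 2 * l * n)
      (e3 : x₁ * x₂ * x₃ = n ^ 2 - C) (hn : n ≠ 0) (hl : ‖l‖ ≤ r ^ 2 * ‖n‖) (hn1 : 1 ≤ r ^ 3 * ‖n‖) :
      InReductionKernel (Affine.Point.some x₁ y₁ h₁ + Affine.Point.some x₂ y₂ h₂ :
        (cubicCurve A B C).toAffine.Point) ∧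
      ‖formalParameter (Affine.Point.some x₁ y₁ h₁ + Affine.Point.some x₂ y₂ h₂ :
        (cubicCurve A B C).toAffine.Point) - x₁ / y₁ - x₂ / y₂‖ ≤ r ^ 3 := by
    obtain ⟨hx₃, hs⟩ := collinear_sum hA hB hC hr0 hr l1 l2 l3 e1 e2 e3 hn hl hn1 hy₁ hy₂ hPr hQr
      (by rw [← (cubicCurve_nonsingular.1 h₃).1]; ring)
    rw [e]
    refine ⟨.inr ⟨_, _, _, rfl, hx₃⟩, ?_⟩
    have : formalParameter (Affine.Point.some x₃ (-y₃) h₃ : (cubicCurve A B C).toAffine.Point) =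
      -(x₃ / y₃) := div_neg _
    rw [this, ← norm_neg]
    have e' : -(-(x₃ / y₃) - x₁ / y₁ - x₂ / y₂) = x₁ / y₁ + x₂ / y₂ + x₃ / y₃ := by ring
    rwa [e']
  by_cases hx : x₁ = x₂
  · subst hx
    rcases cubicCurve_eq_or_eq_neg h₁ h₂ with hE | hE
    swap
    · rw [hE, neg_add_cancel]
      refine ⟨inReductionKernel_zero, ?_⟩
      obtain ⟨h', e'⟩ := cubicCurve_neg h₂
      have : formalParameter (-Affine.Point.some x₁ y₂ h₂ : (cubicCurve A B C).toAffine.Point) =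
          -(x₁ / y₂) := by rw [e']; exact div_neg _
      rw [this]
      simpa [formalParameter, Affine.Point.zero_def] using hr3
    have hyy : y₁ = y₂ := (Affine.Point.some.inj hE).2
    subst hyy
    have hyn : 0 < ‖2 * y₁‖ := norm_pos_iff.2 (mul_ne_zero h2 hy₁)
    obtain ⟨l, hl⟩ : ∃ l, l * (2 * y₁) = 3 * x₁ ^ 2 + 2 * A * x₁ + B :=
      ⟨_, div_mul_cancel₀ _ (mul_ne_zero h2 hy₁)⟩
    obtain ⟨n, hn⟩ : ∃ n, n = y₁ - l * x₁ := ⟨_, rfl⟩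
    -- Multiplying by 2y₁ expresses the tangent through x₁ alone, so no lower bound on |2| is
    -- needed.
    have hn' : n * (2 * y₁) = -x₁ ^ 3 + B * x₁ + 2 * C := by
      rw [hn]; linear_combination 2 * he₁ - x₁ * hl
    have hx1 : 1 ≤ r ^ 2 * ‖x₁‖ := by
      rw [← n1]; gcongr
    have hx2 : ‖x₁‖ ≤ ‖x₁‖ ^ 2 := by nlinarith
    have hn2 : ‖n‖ * ‖2 * y₁‖ = ‖x₁‖ ^ 3 := by
      rw [← norm_mul, hn', ← norm_pow, ← norm_neg (x₁ ^ 3)]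
      apply norm_eq_of_norm_sub_lt
      have e : -x₁ ^ 3 + B * x₁ + 2 * C - -x₁ ^ 3 = B * x₁ + 2 * C := by ring
      rw [e, norm_neg, norm_pow]
      refine (norm_add_le_of_both_le (norm_mul_le_right hB le_rfl)
        ((norm_mul_le_right norm_two_le_one hC).trans hx₁.le)).trans_lt ?_
      nlinarith
    have hl2 : ‖l‖ * ‖2 * y₁‖ ≤ ‖x₁‖ ^ 2 := by
      rw [← norm_mul, hl]
      refine norm_add_le_of_both_le (norm_add_le_of_both_le
        (norm_mul_le_right norm_three_le_one (norm_pow x₁ 2).le)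
        ((norm_mul_le_right (norm_mul_le_right norm_two_le_one hA) le_rfl).trans hx2)) (hB.trans ?_)
      exact one_le_pow₀ hx₁.le
    obtain ⟨h₃, e₃⟩ := cubicCurve_add_self h2 hy₁ h₁ (x' := l ^ 2 - A - 2 * x₁)
      (y' := -(l * (l ^ 2 - A - 2 * x₁) + n)) hl rfl (by rw [hn]; ring)
    refine finish l n _ _ h₃ e₃ (by rw [hn]; ring) (by rw [hn]; ring) rfl (by ring) ?_ ?_ ?_ ?_ ?_
    · rw [hn]; linear_combination hl
    · rw [hn]; linear_combination -he₁ + x₁ * hl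
    · rintro rfl
      rw [norm_zero, zero_mul] at hn2
      have := norm_pos_iff.2 hx₁0
      exact (pow_pos this 3).ne hn2
    · refine le_of_mul_le_mul_right ?_ hyn
      rw [mul_assoc, hn2]
      calc ‖l‖ * ‖2 * y₁‖ ≤ 1 * ‖x₁‖ ^ 2 := by rwa [one_mul]
        _ ≤ (r ^ 2 * ‖x₁‖) * ‖x₁‖ ^ 2 := by gcongr
        _ = r ^ 2 * ‖x₁‖ ^ 3 := by ring
    · refine le_of_mul_le_mul_right ?_ hyn
      rw [mul_assoc, hn2, ← p1, one_mul]
      have h3 : 1 ≤ r ^ 3 * ‖y₁‖ := by rw [← m1]; gcongr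
      calc ‖2 * y₁‖ ≤ 1 * ‖y₁‖ := by rw [one_mul]; exact norm_mul_le_right norm_two_le_one le_rfl
        _ ≤ (r ^ 3 * ‖y₁‖) * ‖y₁‖ := by gcongr
        _ = r ^ 3 * ‖y₁‖ ^ 2 := by ring
  -- The chord slope is awkward in x and y. In z and w the equation reads w = z³ + Az²w + Bzw² +
  -- Cw³, and subtracting two instances bounds (w₁ - w₂)/(z₁ - z₂) by r².
  · obtain ⟨z₁, hz₁⟩ : ∃ z, x₁ = z * y₁ := ⟨x₁ / y₁, by field_simp⟩
    obtain ⟨z₂, hz₂⟩ : ∃ z, x₂ = z * y₂ := ⟨x₂ / y₂, by field_simp⟩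
    obtain ⟨w₁, hw₁⟩ : ∃ w, w * y₁ = 1 := ⟨1 / y₁, by field_simp⟩
    obtain ⟨w₂, hw₂⟩ : ∃ w, w * y₂ = 1 := ⟨1 / y₂, by field_simp⟩
    have hz₁r : ‖z₁‖ ≤ r := by rwa [hz₁, mul_div_cancel_right₀ _ hy₁] at hPr
    have hz₂r : ‖z₂‖ ≤ r := by rwa [hz₂, mul_div_cancel_right₀ _ hy₂] at hQr
    have hwr {w z y x : F} (hy : y ≠ 0) (hz : x = z * y) (hw : w * y = 1) (hzr : ‖z‖ ≤ r)
        (hm : ‖x / y‖ ^ 3 * ‖y‖ = 1) : ‖w‖ ≤ r ^ 3 := by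
      rw [hz, mul_div_cancel_right₀ _ hy] at hm
      have : ‖w‖ * ‖y‖ = ‖z‖ ^ 3 * ‖y‖ := by rw [hm, ← norm_mul, hw, norm_one]
      rw [mul_right_cancel₀ (norm_ne_zero_iff.2 hy) this]
      gcongr
    have hw₁r := hwr hy₁ hz₁ hw₁ hz₁r m1
    have hw₂r := hwr hy₂ hz₂ hw₂ hz₂r m2
    have hcurve {w z y x : F} (hz : x = z * y) (hw : w * y = 1)
        (he : y ^ 2 = x ^ 3 + A * x ^ 2 + B * x + C) :
        w = z ^ 3 + A * z ^ 2 * w + B * z * w ^ 2 + C * w ^ 3 := by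
      have hwx : z = w * x := by rw [hz]; linear_combination -z * hw
      have : w ^ 3 * y ^ 2 = w := by linear_combination w * (w * y + 1) * hw
      rw [hwx]
      linear_combination w ^ 3 * he - this
    have c₁ := hcurve hz₁ hw₁ he₁
    have c₂ := hcurve hz₂ hw₂ he₂
    have hr2 : r ^ 2 < 1 := by nlinarith
    have hr32 : r ^ 3 ≤ r ^ 2 := by nlinarith [sq_nonneg r]
    have hr31 : r ^ 3 ≤ r := by nlinarith
    have hmul {a b : F} {s t : ℝ} (ha : ‖a‖ ≤ s) (hb : ‖b‖ ≤ t) : ‖a * b‖ ≤ s * t := by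
      rw [norm_mul]; exact mul_le_mul ha hb (norm_nonneg _) ((norm_nonneg _).trans ha)
    have hzz {a b : F} (ha : ‖a‖ ≤ r) (hb : ‖b‖ ≤ r) : ‖a * b‖ ≤ r ^ 2 := by
      rw [sq]; exact hmul ha hb
    have hU : ‖1 - (A * (z₂ * z₂) + B * (z₂ * (w₁ + w₂)) + C * (w₁ * w₁ + w₁ * w₂ + w₂ * w₂))‖ = 1 := by
      rw [← norm_one (α := F)]
      apply norm_eq_of_norm_sub_lt
      rw [norm_one, sub_sub_cancel_left, norm_neg]
      have w1 := hw₁r.trans hr31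
      have w2 := hw₂r.trans hr31
      refine lt_of_le_of_lt ?_ hr2
      exact norm_add_le_of_both_le (norm_add_le_of_both_le (norm_mul_le_right hA (hzz hz₂r hz₂r))
        (norm_mul_le_right hB (hzz hz₂r (norm_add_le_of_both_le w1 w2)))) (norm_mul_le_right hC
          (norm_add_le_of_both_le (norm_add_le_of_both_le (hzz w1 w1) (hzz w1 w2)) (hzz w2 w2)))
    have hV : ‖z₁ * z₁ + z₁ * z₂ + z₂ * z₂ + A * ((z₁ + z₂) * w₁) + B * (w₁ * w₁)‖ ≤ r ^ 2 := by
      have w1 := hw₁r.trans hr31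
      exact norm_add_le_of_both_le (norm_add_le_of_both_le (norm_add_le_of_both_le
        (norm_add_le_of_both_le (hzz hz₁r hz₁r) (hzz hz₁r hz₂r)) (hzz hz₂r hz₂r))
        (norm_mul_le_right hA (hzz (norm_add_le_of_both_le hz₁r hz₂r) w1)))
        (norm_mul_le_right hB (hzz w1 w1))
    have hUV : (w₁ - w₂) *
        (1 - (A * (z₂ * z₂) + B * (z₂ * (w₁ + w₂)) + C * (w₁ * w₁ + w₁ * w₂ + w₂ * w₂))) =
        (z₁ - z₂) * (z₁ * z₁ + z₁ * z₂ + z₂ * z₂ + A * ((z₁ + z₂) * w₁) + B * (w₁ * w₁)) := by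
      linear_combination c₁ - c₂
    have hwz : ‖w₁ - w₂‖ ≤ r ^ 2 * ‖z₁ - z₂‖ := by
      have := congrArg norm hUV
      rw [norm_mul, norm_mul, hU, mul_one] at this
      rw [this, mul_comm]
      gcongr
    have hzne : 0 < ‖z₁ - z₂‖ := by
      rw [norm_pos_iff]
      intro h0
      rw [h0, norm_zero, mul_zero] at hwz
      have hw : w₁ = w₂ := sub_eq_zero.1 (norm_le_zero_iff.1 hwz)
      have hz : z₁ = z₂ := sub_eq_zero.1 h0
      have hy : y₁ = y₂ := by
        rw [hw] at hw₁
        exact mul_left_cancel₀ (left_ne_zero_of_mul_eq_one hw₂) (hw₁.trans hw₂.symm)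
      exact hx (by rw [hz₁, hz₂, hz, hy])
    have hxs := sub_ne_zero.2 hx
    obtain ⟨l, hl⟩ : ∃ l, l * (x₁ - x₂) = y₁ - y₂ := ⟨_, div_mul_cancel₀ _ hxs⟩
    obtain ⟨n, hn⟩ : ∃ n, n = y₁ - l * x₁ := ⟨_, rfl⟩
    have hn₂ : y₂ = l * x₂ + n := by rw [hn]; linear_combination hl
    have hw12 : w₁ - w₂ = w₁ * w₂ * (y₂ - y₁) := by linear_combination -w₁ * hw₂ + w₂ * hw₁
    have hnx : n * (x₁ - x₂) = y₁ * y₂ * (z₁ - z₂) := by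
      have : n * (x₁ - x₂) = y₂ * x₁ - y₁ * x₂ := by rw [hn]; linear_combination -x₁ * hl
      rw [this, hz₁, hz₂]; ring
    have hxx : x₁ - x₂ = y₁ * y₂ * (w₂ * (z₁ - z₂) - z₂ * (w₁ - w₂)) := by
      rw [hz₁, hz₂]
      linear_combination -z₁ * y₁ * hw₂ + z₂ * y₂ * hw₁
    have hyy : y₁ * y₂ ≠ 0 := mul_ne_zero hy₁ hy₂
    have hnz : n * (w₂ * (z₁ - z₂) - z₂ * (w₁ - w₂)) = z₁ - z₂ := by
      apply mul_left_cancel₀ hyy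
      rw [← hnx, hxx]; ring
    have hlz : l * (z₁ - z₂) = -(w₁ - w₂) * n := by
      apply mul_left_cancel₀ hyy
      apply mul_right_cancel₀ hxs
      have e1 : y₁ * y₂ * (w₁ - w₂) = y₂ - y₁ := by linear_combination y₂ * hw₁ - y₁ * hw₂
      linear_combination y₁ * y₂ * (z₁ - z₂) * hl + (x₁ - x₂) * n * e1 + (y₁ - y₂) * hnx * (-1)
    have hG : l ^ 2 * (x₁ + x₂) + 2 * l * n = x₁ ^ 2 + x₁ * x₂ + x₂ ^ 2 + A * (x₁ + x₂) + B := by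
      apply mul_left_cancel₀ hxs
      have : y₁ = l * x₁ + n := by rw [hn]; ring
      rw [this, hn₂] at hl
      rw [this] at he₁
      rw [hn₂] at he₂
      linear_combination he₁ - he₂
    obtain ⟨h₃, e₃⟩ := cubicCurve_add h₁ h₂ hx (x' := l ^ 2 - A - x₁ - x₂)
      (y' := -(l * (l ^ 2 - A - x₁ - x₂) + n)) hl rfl (by rw [hn]; ring)
    refine finish l n _ _ h₃ e₃ (by rw [hn]; ring) hn₂ rfl (by ring) ?_ ?_ ?_ ?_ ?_
    · linear_combination hG
    · have hy1 : y₁ = l * x₁ + n := by rw [hn]; ring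
      rw [hy1] at he₁
      linear_combination -he₁ + x₁ * hG
    · rintro rfl
      rw [zero_mul] at hnz
      rw [← hnz, norm_zero] at hzne
      exact hzne.false
    · refine le_of_mul_le_mul_right ?_ hzne
      rw [← norm_mul, hlz, norm_mul, norm_neg]
      calc ‖w₁ - w₂‖ * ‖n‖ ≤ r ^ 2 * ‖z₁ - z₂‖ * ‖n‖ := by gcongr
        _ = r ^ 2 * ‖n‖ * ‖z₁ - z₂‖ := by ring
    · refine le_of_mul_le_mul_right ?_ hzne
      have hle : ‖w₂ * (z₁ - z₂) - z₂ * (w₁ - w₂)‖ ≤ r ^ 3 * ‖z₁ - z₂‖ := by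
        refine norm_sub_le_of_both_le (hmul hw₂r le_rfl) ((hmul hz₂r hwz).trans_eq (by ring))
      calc 1 * ‖z₁ - z₂‖ = ‖n‖ * ‖w₂ * (z₁ - z₂) - z₂ * (w₁ - w₂)‖ := by
            rw [one_mul, ← norm_mul, hnz]
        _ ≤ ‖n‖ * (r ^ 3 * ‖z₁ - z₂‖) := by gcongr
        _ = r ^ 3 * ‖n‖ * ‖z₁ - z₂‖ := by ring

end Ultrametric

/-! ### Torsion injects into the reduction over the p-adic numbers. -/

section Padic

variable {p : ℕ} [Fact p.Prime] {A B C : ℚ_[p]} [DecidableEq ℚ_[p]]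

omit [DecidableEq ℚ_[p]] in
theorem padic_norm_le_inv {z : ℚ_[p]} (hz : ‖z‖ < 1) : ‖z‖ ≤ (p : ℝ)⁻¹ := by
  have := (Padic.norm_lt_pow_iff_norm_le_pow_sub_one z 0).1 (by simpa using hz)
  simpa using this

omit [DecidableEq ℚ_[p]] in
theorem padicInt_toZMod_eq_iff {x y : ℤ_[p]} :
    PadicInt.toZMod x = PadicInt.toZMod y ↔ ‖(x : ℚ_[p]) - y‖ < 1 := by
  rw [← sub_eq_zero, ← map_sub, ← RingHom.mem_ker, PadicInt.ker_toZMod,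
    IsLocalRing.mem_maximalIdeal, PadicInt.mem_nonunits, ← PadicInt.coe_sub, PadicInt.norm_def]

omit [DecidableEq ℚ_[p]] in
theorem padicInt_toZMod_eq_zero_iff {x : ℤ_[p]} :
    PadicInt.toZMod x = 0 ↔ ‖(x : ℚ_[p])‖ < 1 := by
  simpa using padicInt_toZMod_eq_iff (x := x) (y := 0)

omit [DecidableEq ℚ_[p]] in

theorem formalParameter_lt_one (hA : ‖A‖ ≤ 1) (hB : ‖B‖ ≤ 1) (hC : ‖C‖ ≤ 1)
    {P : (cubicCurve A B C).toAffine.Point} (hP : InReductionKernel P) : ‖formalParameter P‖ < 1 := by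
  rcases hP with rfl | ⟨x, y, h, rfl, hx⟩
  · simp [formalParameter]
  · exact (kernel_norms hA hB hC (cubicCurve_nonsingular.1 h).1 hx).2.2.2.2.1

/-- The errors of the n additions do not add up, since the norm is ultrametric. -/
theorem nsmul_mem_reductionKernel (hA : ‖A‖ ≤ 1) (hB : ‖B‖ ≤ 1) (hC : ‖C‖ ≤ 1)
    {P : (cubicCurve A B C).toAffine.Point} (hP : InReductionKernel P) (n : ℕ) :
    InReductionKernel (n • P) ∧ ‖formalParameter (n • P)‖ ≤ ‖formalParameter P‖ ∧
      ‖formalParameter (n • P) - n * formalParameter P‖ ≤ ‖formalParameter P‖ ^ 3 := by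
  have hr := formalParameter_lt_one hA hB hC hP
  have hr0 := norm_nonneg (formalParameter P)
  have hr3 : ‖formalParameter P‖ ^ 3 ≤ ‖formalParameter P‖ :=
    pow_le_of_le_one hr0 hr.le (by norm_num)
  induction n with
  | zero =>
    rw [zero_nsmul]
    refine ⟨inReductionKernel_zero, ?_⟩
    have : formalParameter (0 : (cubicCurve A B C).toAffine.Point) = 0 := rfl
    rw [this]
    simp
  | succ n ih =>
    obtain ⟨i1, i2, i3⟩ := ih
    obtain ⟨k1, k2⟩ := formalParameter_add hA hB hC i1 hP two_ne_zero hr0 hr i2 le_rfl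
    rw [succ_nsmul]
    refine ⟨k1, ?_, ?_⟩
    · have e : formalParameter (n • P + P) = (formalParameter (n • P + P) - formalParameter (n • P) -
          formalParameter P) + (formalParameter (n • P) + formalParameter P) := by ring
      rw [e]
      exact norm_add_le_of_both_le (k2.trans hr3) (norm_add_le_of_both_le i2 le_rfl)
    · have e : formalParameter (n • P + P) - (n + 1 : ℕ) * formalParameter P =
          (formalParameter (n • P + P) - formalParameter (n • P) - formalParameter P) +
          (formalParameter (n • P) - n * formalParameter P) := by push_cast; ring
      rw [e]
      exact norm_add_le_of_both_le k2 i3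

/-- The kernel of reduction has no torsion. -/
theorem eq_zero_of_isOfFinAddOrder (hA : ‖A‖ ≤ 1) (hB : ‖B‖ ≤ 1) (hC : ‖C‖ ≤ 1)
    {P : (cubicCurve A B C).toAffine.Point} (hP : InReductionKernel P) (hfin : IsOfFinAddOrder P) :
    P = 0 := by
  by_contra hne
  obtain ⟨q, hq, hdvd⟩ := Nat.exists_prime_and_dvd (mt AddMonoid.addOrderOf_eq_one_iff.1 hne)
  have hpos := hfin.addOrderOf_pos
  obtain ⟨k, hk⟩ := hdvd
  have hk0 : k ≠ 0 := by rintro rfl; omega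
  -- A multiple of prime order q suffices. Its parameter z would satisfy |q|·|z| ≤ |z|³, while |q| ≥
  -- 1/p and |z| ≤ 1/p.
  obtain ⟨R, hR⟩ : ∃ R, R = k • P := ⟨_, rfl⟩
  have hR0 : R ≠ 0 := by
    intro h0
    have := Nat.le_of_dvd (Nat.pos_of_ne_zero hk0) (addOrderOf_dvd_of_nsmul_eq_zero (hR ▸ h0))
    rw [hk] at this
    have := hq.two_le
    have := Nat.pos_of_ne_zero hk0
    nlinarith
  have hqR : q • R = 0 := by
    rw [hR, ← mul_smul, ← hk, addOrderOf_nsmul_eq_zero]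
  have hRk : InReductionKernel R := hR ▸ (nsmul_mem_reductionKernel hA hB hC hP k).1
  obtain ⟨-, -, h3⟩ := nsmul_mem_reductionKernel hA hB hC hRk q
  rw [hqR] at h3
  have h0 : formalParameter (0 : (cubicCurve A B C).toAffine.Point) = 0 := rfl
  rw [h0, zero_sub, norm_neg, norm_mul] at h3
  have hlt := formalParameter_lt_one hA hB hC hRk
  have hz : 0 < ‖formalParameter R‖ := by
    rcases hRk with h | ⟨x, y, h, e, hx⟩
    · exact absurd h hR0
    · obtain ⟨hy, hx', -⟩ := kernel_norms hA hB hC (cubicCurve_nonsingular.1 h).1 hx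
      rw [e]
      exact norm_pos_iff.2 (div_ne_zero hx' hy)
  have hle := padic_norm_le_inv hlt
  have hp1 : (1 : ℝ) < p := by exact_mod_cast (Fact.out : p.Prime).one_lt
  have hqn : (p : ℝ)⁻¹ ≤ ‖(q : ℚ_[p])‖ := by
    by_cases hqp : q = p
    · rw [hqp, Padic.norm_p]
    · have : ‖(q : ℚ_[p])‖ = 1 := by
        rw [Padic.norm_natCast_eq_one_iff]
        exact (Nat.coprime_primes Fact.out hq).2 (Ne.symm hqp)
      rw [this]
      exact inv_le_one_of_one_le₀ hp1.le
  have h4 : ‖(q : ℚ_[p])‖ ≤ ‖formalParameter R‖ ^ 2 := by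
    refine le_of_mul_le_mul_right ?_ hz
    exact h3.trans_eq (by ring)
  have hpi : 0 < (p : ℝ)⁻¹ := inv_pos.2 (zero_lt_one.trans hp1)
  have hpi1 : (p : ℝ)⁻¹ < 1 := inv_lt_one_of_one_lt₀ hp1
  nlinarith

/-- Torsion points with the same reduction are equal. -/
theorem eq_of_reduction_eq (h2 : ‖(2 : ℚ_[p])‖ = 1) (hA : ‖A‖ ≤ 1) (hB : ‖B‖ ≤ 1) (hC : ‖C‖ ≤ 1)
    {x₁ y₁ x₂ y₂ : ℚ_[p]} (h₁ : (cubicCurve A B C).toAffine.Nonsingular x₁ y₁)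
    (h₂ : (cubicCurve A B C).toAffine.Nonsingular x₂ y₂)
    (f₁ : IsOfFinAddOrder (.some x₁ y₁ h₁ : (cubicCurve A B C).toAffine.Point))
    (f₂ : IsOfFinAddOrder (.some x₂ y₂ h₂ : (cubicCurve A B C).toAffine.Point))
    (hx₁ : ‖x₁‖ ≤ 1) (hx₂ : ‖x₂‖ ≤ 1) (hx : ‖x₁ - x₂‖ < 1) (hy : ‖y₁ - y₂‖ < 1)
    (hns : ‖y₁‖ < 1 → ‖3 * x₁ ^ 2 + 2 * A * x₁ + B‖ = 1) :
    (Affine.Point.some x₁ y₁ h₁ : (cubicCurve A B C).toAffine.Point) = .some x₂ y₂ h₂ := by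
  have hint {x y : ℚ_[p]} (h : (cubicCurve A B C).toAffine.Nonsingular x y) (hx : ‖x‖ ≤ 1) :
      ‖y‖ ≤ 1 := by
    have hp (k : ℕ) : ‖x ^ k‖ ≤ 1 := by rw [norm_pow]; exact pow_le_one₀ (norm_nonneg _) hx
    have : ‖y ^ 2‖ ≤ 1 := by
      rw [(cubicCurve_nonsingular.1 h).1]
      exact norm_add_le_of_both_le (norm_add_le_of_both_le (norm_add_le_of_both_le (hp 3)
        (norm_mul_le_right hA (hp 2))) (norm_mul_le_right hB hx)) hC
    rw [norm_pow] at this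
    by_contra! hc
    nlinarith
  have hy₁ := hint h₁ hx₁
  have hy₂ := hint h₂ hx₂
  obtain ⟨hn, en⟩ := cubicCurve_neg h₂
  by_contra hne
  have hfin : IsOfFinAddOrder (Affine.Point.some x₁ y₁ h₁ + .some x₂ (-y₂) hn :
      (cubicCurve A B C).toAffine.Point) := by
    rw [← en]; exact f₁.add f₂.neg
  have hne0 : (Affine.Point.some x₁ y₁ h₁ + .some x₂ (-y₂) hn :
      (cubicCurve A B C).toAffine.Point) ≠ 0 := by
    rw [← en]; exact fun h => hne (by rwa [add_neg_eq_zero] at h)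
  -- If the line defining the difference of the points has slope of norm above 1, the difference has
  -- abscissa of norm above 1, so it is a torsion point in the kernel and vanishes.
  have fin (l : ℚ_[p]) (y₃ h₃) (hl : 1 < ‖l‖) (e : (Affine.Point.some x₁ y₁ h₁ + .some x₂ (-y₂) hn :
      (cubicCurve A B C).toAffine.Point) = .some (l ^ 2 - A - x₁ - x₂) y₃ h₃) : False := by
    apply hne0
    refine eq_zero_of_isOfFinAddOrder hA hB hC (.inr ⟨_, _, _, e, ?_⟩) hfin
    have hl2 : 1 < ‖l ^ 2‖ := by rw [norm_pow]; exact one_lt_pow₀ hl two_ne_zero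
    have : ‖l ^ 2 - A - x₁ - x₂‖ = ‖l ^ 2‖ := by
      apply norm_eq_of_norm_sub_lt
      have e : l ^ 2 - A - x₁ - x₂ - l ^ 2 = -(A + x₁ + x₂) := by ring
      rw [e, norm_neg]
      exact (norm_add_le_of_both_le (norm_add_le_of_both_le hA hx₁) hx₂).trans_lt hl2
    rwa [this]
  have he₁ := (cubicCurve_nonsingular.1 h₁).1
  have he₂ := (cubicCurve_nonsingular.1 h₂).1
  have big {a b l : ℚ_[p]} (ha : ‖a‖ = 1) (hb : ‖b‖ < 1) (h : l * b = a) : 1 < ‖l‖ := by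
    have := congrArg norm h
    rw [norm_mul, ha] at this
    by_contra! hc
    have := mul_le_mul_of_nonneg_right hc (norm_nonneg b)
    linarith
  have hsum : ‖2 * y₁ - (y₁ + y₂)‖ < 1 := by
    have : 2 * y₁ - (y₁ + y₂) = y₁ - y₂ := by ring
    rwa [this]
  by_cases hxx : x₁ = x₂
  · subst hxx
    rcases cubicCurve_eq_or_eq_neg h₁ h₂ with hE | hE
    · exact hne hE
    rw [en] at hE
    have hyy : y₁ = -y₂ := (Affine.Point.some.inj hE).2
    have h2y : ‖2 * y₁‖ < 1 := by
      have : 2 * y₁ = y₁ - y₂ := by linear_combination hyy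
      rwa [this]
    have hy1 : ‖y₁‖ < 1 := by rwa [norm_mul, h2, one_mul] at h2y
    have hy0 : y₁ ≠ 0 := by
      rintro rfl
      apply hne
      have : y₂ = 0 := by linear_combination hyy
      subst this; rfl
    have hd : (2 * y₁) ≠ 0 := mul_ne_zero two_ne_zero hy0
    obtain ⟨l, hl⟩ : ∃ l, l * (2 * y₁) = 3 * x₁ ^ 2 + 2 * A * x₁ + B := ⟨_, div_mul_cancel₀ _ hd⟩
    obtain ⟨h₃, e₃⟩ := cubicCurve_add_self two_ne_zero hy0 h₁ (x' := l ^ 2 - A - x₁ - x₁) hl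
      (by ring) rfl
    rw [← hE] at fin
    exact fin l _ h₃ (big (hns hy1) h2y hl) e₃
  · have hxs := sub_ne_zero.2 hxx
    obtain ⟨l, hl⟩ : ∃ l, l * (x₁ - x₂) = y₁ - -y₂ := ⟨_, div_mul_cancel₀ _ hxs⟩
    obtain ⟨h₃, e₃⟩ := cubicCurve_add h₁ hn hxx hl rfl rfl
    refine fin l _ h₃ ?_ e₃
    by_cases hy1 : ‖y₁‖ < 1
    -- When the ordinates reduce to 0 the slope is rewritten with denominator y₁ - y₂; its numerator
    -- is congruent to the derivative of the cubic, a unit by nonsingularity of the reduction.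
    · have hG : l * (y₁ - y₂) = x₁ ^ 2 + x₁ * x₂ + x₂ ^ 2 + A * (x₁ + x₂) + B := by
        apply mul_left_cancel₀ hxs
        linear_combination (y₁ - y₂) * hl + he₁ - he₂
      refine big ?_ hy hG
      rw [← hns hy1]
      apply norm_eq_of_norm_sub_lt
      rw [hns hy1]
      have e : x₁ ^ 2 + x₁ * x₂ + x₂ ^ 2 + A * (x₁ + x₂) + B - (3 * x₁ ^ 2 + 2 * A * x₁ + B) =
          -((x₁ - x₂) * (2 * x₁ + x₂ + A)) := by ring
      rw [e, norm_neg]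
      exact (norm_mul_le_left le_rfl (norm_add_le_of_both_le (norm_add_le_of_both_le
        (norm_mul_le_right norm_two_le_one hx₁) hx₂) hA)).trans_lt hx
    · have hy1' : ‖y₁‖ = 1 := le_antisymm hy₁ (not_lt.1 hy1)
      have : ‖y₁ - -y₂‖ = 1 := by
        have e : ‖2 * y₁‖ = 1 := by rw [norm_mul, h2, hy1', one_mul]
        rw [sub_neg_eq_add, ← e]
        apply norm_eq_of_norm_sub_lt
        rwa [e, norm_sub_rev]
      exact big this hx hl

/-- The torsion subgroup is at most as large as the group of points of the reduction. -/
theorem card_le_of_forall_isOfFinAddOrder (hp : p ≠ 2) {A B C : ℤ_[p]} {a b c : ZMod p}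
    (ha : PadicInt.toZMod A = a) (hb : PadicInt.toZMod B = b) (hc : PadicInt.toZMod C = c)
    {S : Finset (ZMod p × ZMod p)}
    (hS : ∀ x y, y ^ 2 = x ^ 3 + a * x ^ 2 + b * x + c → (x, y) ∈ S)
    (hns : ∀ x, x ^ 3 + a * x ^ 2 + b * x + c = 0 → 3 * x ^ 2 + 2 * a * x + b ≠ 0)
    {T : AddSubgroup (cubicCurve (A : ℚ_[p]) B C).toAffine.Point}
    (hT : ∀ P ∈ T, IsOfFinAddOrder P) : Finite T ∧ Nat.card T ≤ S.card + 1 := by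
  have hA : ‖(A : ℚ_[p])‖ ≤ 1 := A.2
  have hB : ‖(B : ℚ_[p])‖ ≤ 1 := B.2
  have hC : ‖(C : ℚ_[p])‖ ≤ 1 := C.2
  have h2 : ‖(2 : ℚ_[p])‖ = 1 := by
    have := (Padic.norm_natCast_eq_one_iff (p := p) (n := 2)).2
      ((Nat.coprime_primes Fact.out Nat.prime_two).2 hp)
    simpa using this
  -- The value `none` stands for the point at infinity of the reduced curve, which accounts for the
  -- 1 in the bound.
  have key (P : T) : ∃ o : Option S, (o = none → P = 0) ∧ ∀ s, o = some s → ∃ (X Y : ℤ_[p])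
      (h : (cubicCurve (A : ℚ_[p]) B C).toAffine.Nonsingular (X : ℚ_[p]) Y),
      (P : (cubicCurve (A : ℚ_[p]) B C).toAffine.Point) = .some (X : ℚ_[p]) Y h ∧
        (PadicInt.toZMod X, PadicInt.toZMod Y) = s.1 := by
    obtain ⟨P, hP⟩ := P
    by_cases hP0 : P = 0
    · subst hP0; exact ⟨none, fun _ => rfl, by simp⟩
    rcases P with _ | ⟨x, y, h⟩
    · exact absurd rfl hP0
    have hx : ‖x‖ ≤ 1 := by
      by_contra! hx
      exact hP0 (eq_zero_of_isOfFinAddOrder hA hB hC (.inr ⟨_, _, _, rfl, hx⟩) (hT _ hP))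
    have he := (cubicCurve_nonsingular.1 h).1
    have hy : ‖y‖ ≤ 1 := by
      have hp (k : ℕ) : ‖x ^ k‖ ≤ 1 := by rw [norm_pow]; exact pow_le_one₀ (norm_nonneg _) hx
      have : ‖y ^ 2‖ ≤ 1 := by
        rw [he]
        exact norm_add_le_of_both_le (norm_add_le_of_both_le (norm_add_le_of_both_le (hp 3)
          (norm_mul_le_right hA (hp 2))) (norm_mul_le_right hB hx)) hC
      rw [norm_pow] at this
      by_contra! hc
      nlinarith
    obtain ⟨x, rfl⟩ : ∃ X : ℤ_[p], (X : ℚ_[p]) = x := ⟨⟨x, hx⟩, rfl⟩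
    obtain ⟨y, rfl⟩ : ∃ Y : ℤ_[p], (Y : ℚ_[p]) = y := ⟨⟨y, hy⟩, rfl⟩
    have he' : y ^ 2 = x ^ 3 + A * x ^ 2 + B * x + C := Subtype.ext (by push_cast; exact he)
    have hmem : (PadicInt.toZMod x, PadicInt.toZMod y) ∈ S := by
      apply hS
      rw [← ha, ← hb, ← hc, ← map_pow, he']
      simp
    refine ⟨some ⟨_, hmem⟩, by simp, ?_⟩
    intro s hs
    exact ⟨x, y, h, rfl, congrArg Subtype.val (Option.some.inj hs)⟩
  choose φ h0 h1 using key
  have hinj : Function.Injective φ := by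
    intro P Q hPQ
    rcases hφ : φ P with _ | s
    · rw [h0 P hφ, h0 Q (by rw [← hPQ, hφ])]
    · obtain ⟨X, Y, h, e, hs⟩ := h1 P s hφ
      obtain ⟨X', Y', h', e', hs'⟩ := h1 Q s (by rw [← hPQ, hφ])
      rw [← hs', Prod.mk.injEq] at hs
      apply Subtype.ext
      rw [e, e']
      apply eq_of_reduction_eq h2 hA hB hC h h' (e ▸ hT _ P.2) (e' ▸ hT _ Q.2) X.2 X'.2
        (padicInt_toZMod_eq_iff.1 hs.1) (padicInt_toZMod_eq_iff.1 hs.2)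
      intro hY
      rw [← padicInt_toZMod_eq_zero_iff] at hY
      have he : Y ^ 2 = X ^ 3 + A * X ^ 2 + B * X + C :=
        Subtype.ext (by push_cast; exact (cubicCurve_nonsingular.1 h).1)
      have hroot := congrArg PadicInt.toZMod he
      simp only [map_add, map_mul, map_pow, hY, ha, hb, hc] at hroot
      have hd := hns _ (by rw [← hroot]; simp)
      have hd' : PadicInt.toZMod (3 * X ^ 2 + 2 * A * X + B) ≠ 0 := by
        simpa [ha, hb, map_ofNat] using hd
      rw [Ne, padicInt_toZMod_eq_zero_iff, not_lt] at hd'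
      have := le_antisymm (3 * X ^ 2 + 2 * A * X + B).2 hd'
      push_cast at this
      exact this
  refine ⟨Finite.of_injective φ hinj, ?_⟩
  have := Nat.card_le_card_of_injective φ hinj
  rwa [Finite.card_option, Nat.card_eq_fintype_card (α := S), Fintype.card_coe] at this

end Padic

/-! ### The explicit curve as a fibre over ℚ(√13). -/

section Example

theorem IsModelChange.exists_variableChange {F : Type*} [Field F] {W W' : WeierstrassCurve F}
    {u r s t : F} (H : IsModelChange (RingHom.id F) W W' u r s t) : ∃ C : VariableChange F, C • W = W' := by
  refine ⟨⟨Units.mk0 u H.u_ne, r, s, t⟩, ?_⟩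
  ext
  · simp only [variableChange_a₁, Units.val_inv_eq_inv_val, Units.val_mk0]
    rw [inv_mul_eq_iff_eq_mul₀ H.u_ne]
    exact H.a₁.symm
  · simp only [variableChange_a₂, Units.val_inv_eq_inv_val, Units.val_mk0, inv_pow]
    rw [inv_mul_eq_iff_eq_mul₀ (pow_ne_zero 2 H.u_ne)]
    exact H.a₂.symm
  · simp only [variableChange_a₃, Units.val_inv_eq_inv_val, Units.val_mk0, inv_pow]
    rw [inv_mul_eq_iff_eq_mul₀ (pow_ne_zero 3 H.u_ne)]
    exact H.a₃.symm
  · simp only [variableChange_a₄, Units.val_inv_eq_inv_val, Units.val_mk0, inv_pow]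
    rw [inv_mul_eq_iff_eq_mul₀ (pow_ne_zero 4 H.u_ne)]
    exact H.a₄.symm
  · simp only [variableChange_a₆, Units.val_inv_eq_inv_val, Units.val_mk0, inv_pow]
    rw [inv_mul_eq_iff_eq_mul₀ (pow_ne_zero 6 H.u_ne)]
    exact H.a₆.symm

variable {K : Type*} [Field K] [CharZero K] {w : K}

/-- The translation (r, t) is the given point of order 12, which goes to the origin of the Tate
form. -/
theorem isModelChange_exampleCurve (hw : w ^ 2 = 13) :
    IsModelChange (RingHom.id K) (exampleCurve w)
      (tateCurve (128180 / 81 + 33830 / 81 * w) (-1040 / 27 - 470 / 27 * w)) (7925 - 2198 * w)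
      (3993089880 - 1107483870 * w) (-159120 + 44132 * w)
      (176222937989280 * w - 635380838833260) := by
  refine ⟨?_, ?_, ?_, ?_, ?_, ?_⟩
  · intro h
    -- The scaling factor has norm -27, hence is nonzero.
    have : (7925 - 2198 * w) * (7925 + 2198 * w) = -27 := by linear_combination -4831204 * hw
    rw [h, zero_mul] at this
    norm_num at this
  · simp only [exampleCurve, RingHom.id_apply]
    linear_combination ((-1033060/27)) * hw
  · simp only [exampleCurve, RingHom.id_apply]
    linear_combination ((-163439631320/81) * w + (584195816600/81)) * hw
  · simp only [exampleCurve, RingHom.id_apply]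
    linear_combination ((359240309641360/81) * w ^ 2 + (-2524635558906440/81) * w + (622936304340340/81)) * hw
  · simp only [exampleCurve, RingHom.id_apply]
    linear_combination ((1816799273823024480) * w + (-6550567544953700100)) * hw
  · simp only [exampleCurve, RingHom.id_apply]
    linear_combination ((3981739747718651911793998200) * w + (-14356366825952648346437156400)) * hw

theorem add_mul_sqrt_thirteen_ne_zero (hw : w ^ 2 = 13) {p q : ℚ} (h : p ^ 2 ≠ 13 * q ^ 2) :
    (p : K) + q * w ≠ 0 := by
  intro h0
  have h1 : ((p ^ 2 : ℚ) : K) = ((13 * q ^ 2 : ℚ) : K) := by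
    push_cast
    linear_combination (p - q * w) * h0 + (q : K) ^ 2 * hw
  exact h (Rat.cast_injective h1)

/-- The given points have orders `2` and `12` and generate a group of order `24`. -/
theorem exampleCurve_points [DecidableEq K] (hw : w ^ 2 = 13) :
    (exampleCurve w).IsElliptic ∧
    ∃ (hP : (exampleCurve w).toAffine.Nonsingular (954691712 - 264783840 * w)
        (42132429627392 * w - 151910635381440))
      (hQ : (exampleCurve w).toAffine.Nonsingular (3993089880 - 1107483870 * w)
        (176222937989280 * w - 635380838833260)),
      addOrderOf (.some _ _ hP : (exampleCurve w).toAffine.Point) = 2 ∧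
      addOrderOf (.some _ _ hQ : (exampleCurve w).toAffine.Point) = 12 ∧
      (.some _ _ hP : (exampleCurve w).toAffine.Point) ≠ 6 • .some _ _ hQ := by
  have hm2 : (1 - 2 * w) / 3 + 2 ≠ 0 := by
    intro h
    apply add_mul_sqrt_thirteen_ne_zero hw (p := 7 / 3) (q := -2 / 3) (by norm_num)
    push_cast; linear_combination h
  -- This is the fibre at (4, -2w), where y² = 52 = 4·13 and m = (1 - 2w)/3.
  obtain ⟨hell, hP, hQ, oP, oQ, hPQ⟩ := fibre_points (K := K)
    (b := 128180 / 81 + 33830 / 81 * w) (c := -1040 / 27 - 470 / 27 * w) (m := (1 - 2 * w) / 3) (x := 4)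
    (X := 3910 / 729 * w - 3536 / 729) (Y := 2855320 / 19683 * w + 5515276 / 19683)
    (by rw [eq_div_iff hm2]; linear_combination ((-16/81) * w ^ 2 + (80/81) * w + (188/27)) * hw)
    (by rw [eq_div_iff hm2]; linear_combination ((1880/243) * w + (-71020/243)) * hw)
    (by rw [eq_div_iff (mul_ne_zero (by norm_num) hm2)]; linear_combination ((-128/2187) * w ^ 5 + (832/2187) * w ^ 4 + (-2624/2187) * w ^ 3 + (608/243) * w ^ 2 + (-1384/243) * w + (8116/2187)) * hw)
    (by linear_combination ((918850/19683)) * hw)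
    (by linear_combination ((-4/3)) * hw)
    (by
      simp only [mul_ne_zero_iff]
      refine ⟨⟨⟨⟨⟨?_, ?_⟩, hm2⟩, ?_⟩, ?_⟩, ?_⟩
      · intro h
        apply add_mul_sqrt_thirteen_ne_zero hw (p := 1 / 3) (q := -2 / 3) (by norm_num)
        push_cast; linear_combination h
      · intro h
        apply add_mul_sqrt_thirteen_ne_zero hw (p := 4 / 3) (q := -2 / 3) (by norm_num)
        push_cast; linear_combination h
      · intro h
        apply add_mul_sqrt_thirteen_ne_zero hw (p := 65/9) (q := -10/9) (by norm_num)
        push_cast; linear_combination h - 4 / 9 * hw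
      · intro h
        apply add_mul_sqrt_thirteen_ne_zero hw (p := 77/9) (q := -16/9) (by norm_num)
        push_cast; linear_combination h - 4 / 9 * hw
      · intro h
        apply add_mul_sqrt_thirteen_ne_zero hw (p := 29/9) (q := 8/9) (by norm_num)
        push_cast; linear_combination h - 4 / 9 * hw)
  have H := isModelChange_exampleCurve hw
  have hellE : (exampleCurve w).IsElliptic := by
    obtain ⟨C, hC⟩ := H.exists_variableChange
    refine ⟨isUnit_iff_ne_zero.2 fun h0 => hell.isUnit.ne_zero ?_⟩
    rw [← hC, variableChange_Δ, h0, mul_zero]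
  have nP : (exampleCurve w).toAffine.Nonsingular (954691712 - 264783840 * w)
      (42132429627392 * w - 151910635381440) := by
    rw [← Affine.equation_iff_nonsingular, Affine.equation_iff]
    simp only [exampleCurve]
    linear_combination ((168522478255138577858396160) * w + (-607616436417167294298148864)) * hw
  have nQ : (exampleCurve w).toAffine.Nonsingular (3993089880 - 1107483870 * w)
      (176222937989280 * w - 635380838833260) := by
    rw [← Affine.equation_iff_nonsingular, Affine.equation_iff]
    simp only [exampleCurve]
    linear_combination ((3981739747718651911793998200) * w + (-14356366825952648346437156400)) * hw
  obtain ⟨hP', eP⟩ := H.exists_hom_some (X := 3910 / 729 * w - 3536 / 729)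
    (Y := 2855320 / 19683 * w + 5515276 / 19683)
    (by rw [RingHom.id_apply]; linear_combination ((-18890007640/729) * w + (153300890344/729)) * hw)
    (by rw [RingHom.id_apply]; linear_combination ((7811951161256480/19683) * w ^ 2 + (-5576939893276192/19683) * w + (-447452961371818120/19683)) * hw) nP
  obtain ⟨hQ', eQ⟩ := H.exists_hom_some (X := 0) (Y := 0) (by rw [RingHom.id_apply]; ring)
    (by rw [RingHom.id_apply]; ring) nQ
  refine ⟨hellE, nP, nQ, ?_, ?_, ?_⟩
  · rw [← addOrderOf_injective H.hom H.hom_injective, eP, oP]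
  · rw [← addOrderOf_injective H.hom H.hom_injective, eQ, oQ]
  · intro h
    have := congrArg H.hom h
    rw [map_nsmul, eP, eQ] at this
    exact hPQ this

end Example

/-! ### Bounding the torsion of the explicit curve modulo 23. -/

section Torsion

instance fact_prime_twenty_three : Fact (Nat.Prime 23) := ⟨by norm_num⟩

/-- Hensel's lemma from 6² = 13 + 23, the derivative 12 being a unit. -/
theorem exists_padic_sqrt_thirteen : ∃ r : ℚ_[23], r ^ 2 = 13 := by
  obtain ⟨z, hz, -⟩ := hensels_lemma (p := 23) (R := ℤ) (F := Polynomial.X ^ 2 - 13) (a := 6) (by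
    have h1 : (Polynomial.X ^ 2 - 13 : Polynomial ℤ).aeval (6 : ℤ_[23]) = ((23 : ℕ) : ℤ_[23]) := by
      simp only [map_sub, map_pow, Polynomial.aeval_X, map_ofNat]; norm_num
    have h2 : (Polynomial.X ^ 2 - 13 : Polynomial ℤ).derivative.aeval (6 : ℤ_[23]) =
        ((12 : ℕ) : ℤ_[23]) := by
      simp only [Polynomial.derivative_sub, Polynomial.derivative_X_pow, Polynomial.derivative_ofNat]
      simp [map_ofNat]; norm_num
    rw [h1, h2, PadicInt.norm_natCast_eq_one_iff (n := 12) |>.2 (by norm_num), one_pow]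
    exact PadicInt.norm_natCast_lt_one_iff.2 (dvd_refl 23))
  refine ⟨z, ?_⟩
  have : z ^ 2 = 13 := by
    simpa [sub_eq_zero, map_ofNat] using hz
  have := congrArg (PadicInt.Coe.ringHom (p := 23)) this
  rwa [map_pow, map_ofNat] at this

theorem nonempty_ringHom_padic : Nonempty (QSqrt 13 →+* ℚ_[23]) := by
  obtain ⟨r, hr⟩ := exists_padic_sqrt_thirteen
  have : Nonempty (QSqrt 13 →ₐ[ℚ] ℚ_[23]) := by
    apply IntermediateField.nonempty_algHom_adjoin_of_splits
    intro s hs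
    have hmonic : (Polynomial.X ^ 2 - Polynomial.C (13 : ℚ)).Monic :=
      Polynomial.monic_X_pow_sub_C _ two_ne_zero
    have hroot : Polynomial.aeval s (Polynomial.X ^ 2 - Polynomial.C (13 : ℚ)) = 0 := by
      have hs' : s ^ 2 = ((13 : ℤ) : ℂ) := hs
      simp [hs']
    refine ⟨⟨_, hmonic, hroot⟩, ?_⟩
    have hfac : Polynomial.map (algebraMap ℚ ℚ_[23]) (Polynomial.X ^ 2 - Polynomial.C (13 : ℚ)) =
        (Polynomial.X - Polynomial.C r) * (Polynomial.X + Polynomial.C r) := by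
      have hC : algebraMap ℚ ℚ_[23] 13 = r ^ 2 := by rw [hr, map_ofNat]
      rw [Polynomial.map_sub, Polynomial.map_pow, Polynomial.map_X, Polynomial.map_C, hC,
        Polynomial.C_pow]
      ring
    refine Polynomial.Splits.of_dvd (g := (Polynomial.X - Polynomial.C r) * (Polynomial.X + Polynomial.C r))
      ?_ ?_ ?_
    · exact (Polynomial.Splits.X_sub_C r).mul (Polynomial.Splits.X_add_C r)
    · exact mul_ne_zero (Polynomial.X_sub_C_ne_zero r) (Polynomial.X_add_C_ne_zero r)
    · rw [← hfac]
      exact Polynomial.map_dvd _ (minpoly.dvd ℚ s hroot)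
  exact this.map AlgHom.toRingHom

/-- Scaling by 1/2 while completing the square keeps the coefficients integral, as the reduction
argument requires. -/
theorem isModelChange_completeSquare {F K : Type*} [Field F] [Field K] (f : F →+* K)
    (W : WeierstrassCurve F) (h4 : W.a₄ = 0) (h6 : W.a₆ = 0) (h2 : (2 : K) ≠ 0) :
    IsModelChange f W (cubicCurve (f W.a₁ ^ 2 + 4 * f W.a₂) (8 * f W.a₁ * f W.a₃) (16 * f W.a₃ ^ 2))
      (1 / 2) 0 (-(f W.a₁) / 2) (-(f W.a₃) / 2) := by
  refine ⟨by simpa using h2, ?_, ?_, ?_, ?_, ?_⟩ <;> simp only [h4, h6, map_zero] <;> field_simp <;>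
    ring

/-- With the point at infinity the reduced curve has 24 points, just the order of the group already
found. -/
theorem solutions_mod_twenty_three_a : (Finset.univ.filter fun s : ZMod 23 × ZMod 23 =>
    s.2 ^ 2 = s.1 ^ 3 + 16 * s.1 ^ 2 + 20 * s.1 + 6).card = 23 ∧
    ∀ x : ZMod 23, x ^ 3 + 16 * x ^ 2 + 20 * x + 6 = 0 → 3 * x ^ 2 + 2 * 16 * x + 20 ≠ 0 := by
  decide +kernel

theorem solutions_mod_twenty_three_b : (Finset.univ.filter fun s : ZMod 23 × ZMod 23 =>
    s.2 ^ 2 = s.1 ^ 3 + 22 * s.1 ^ 2 + 18 * s.1 + 6).card = 23 ∧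
    ∀ x : ZMod 23, x ^ 3 + 22 * x ^ 2 + 18 * x + 6 = 0 → 3 * x ^ 2 + 2 * 22 * x + 18 ≠ 0 := by
  decide +kernel

theorem exampleCurve_card_torsion [DecidableEq (QSqrt 13)] {w : QSqrt 13} (hw : w ^ 2 = 13) :
    Finite (AddCommGroup.torsion (exampleCurve w).toAffine.Point) ∧
      Nat.card (AddCommGroup.torsion (exampleCurve w).toAffine.Point) ≤ 24 := by
  classical
  obtain ⟨φ⟩ := nonempty_ringHom_padic
  have hφ : φ w ^ 2 = 13 := by rw [← map_pow, hw, map_ofNat]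
  have hle : ‖φ w‖ ≤ 1 := by
    have h13 : ‖(13 : ℚ_[23])‖ ≤ 1 := by
      have := Padic.norm_int_le_one (p := 23) 13
      simpa using this
    rw [← hφ, norm_pow] at h13
    by_contra! hc
    nlinarith
  obtain ⟨ρ, hρ⟩ : ∃ ρ : ℤ_[23], (ρ : ℚ_[23]) = φ w := ⟨⟨_, hle⟩, rfl⟩
  have hρ' : PadicInt.Coe.ringHom ρ = φ w := hρ
  have hρ2 : ρ ^ 2 = 13 := Subtype.ext (by push_cast; rw [hρ, hφ]; rfl)
  obtain ⟨A, hA⟩ : ∃ A : ℤ_[23], A = (134025 - 37172 * ρ) ^ 2 + 4 * (3775925760 * ρ - 13614293940) :=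
    ⟨_, rfl⟩
  obtain ⟨B, hB⟩ : ∃ B : ℤ_[23], B = 8 * (134025 - 37172 * ρ) *
    (47915630355840 - 13289404780320 * ρ) := ⟨_, rfl⟩
  obtain ⟨C, hC⟩ : ∃ C : ℤ_[23], C = 16 * (47915630355840 - 13289404780320 * ρ) ^ 2 := ⟨_, rfl⟩
  have H : IsModelChange φ (exampleCurve w) (cubicCurve (A : ℚ_[23]) B C) (1 / 2) 0
      (-(φ (exampleCurve w).a₁) / 2) (-(φ (exampleCurve w).a₃) / 2) := by
    have := isModelChange_completeSquare φ (exampleCurve w) rfl rfl two_ne_zero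
    have eA := congrArg (PadicInt.Coe.ringHom (p := 23)) hA
    have eB := congrArg (PadicInt.Coe.ringHom (p := 23)) hB
    have eC := congrArg (PadicInt.Coe.ringHom (p := 23)) hC
    simp only [map_add, map_sub, map_mul, map_pow, map_ofNat, hρ'] at eA eB eC
    simp only [exampleCurve, map_sub, map_mul, map_ofNat] at this ⊢
    rw [← eA, ← eB, ← eC] at this
    exact this
  have key : Finite ((AddCommGroup.torsion (exampleCurve w).toAffine.Point).map H.hom) ∧
      Nat.card ((AddCommGroup.torsion (exampleCurve w).toAffine.Point).map H.hom) ≤ 23 + 1 := by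
    have hT : ∀ P ∈ (AddCommGroup.torsion (exampleCurve w).toAffine.Point).map H.hom,
        IsOfFinAddOrder P := by
      rintro _ ⟨P, hP, rfl⟩
      exact H.hom.isOfFinAddOrder hP
    have hv : PadicInt.toZMod ρ ^ 2 = 13 := by rw [← map_pow, hρ2, map_ofNat]
    -- The chosen embedding may send w to either root of 13 modulo 23, so both reductions are
    -- needed.
    have hv2 : ∀ v : ZMod 23, v ^ 2 = 13 → v = 6 ∨ v = 17 := by decide +kernel
    have eA := congrArg PadicInt.toZMod hA
    have eB := congrArg PadicInt.toZMod hB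
    have eC := congrArg PadicInt.toZMod hC
    simp only [map_add, map_sub, map_mul, map_pow, map_ofNat] at eA eB eC
    rcases hv2 _ hv with h | h <;> rw [h] at eA eB eC <;> reduce_mod_char at eA eB eC
    · obtain ⟨h1, h2⟩ := solutions_mod_twenty_three_a
      have := card_le_of_forall_isOfFinAddOrder (S := Finset.univ.filter fun s : ZMod 23 × ZMod 23 =>
        s.2 ^ 2 = s.1 ^ 3 + 16 * s.1 ^ 2 + 20 * s.1 + 6)
        (by norm_num) eA eB eC (fun x y h => by simpa using h) h2 hT
      rwa [h1] at this
    · obtain ⟨h1, h2⟩ := solutions_mod_twenty_three_b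
      have := card_le_of_forall_isOfFinAddOrder (S := Finset.univ.filter fun s : ZMod 23 × ZMod 23 =>
        s.2 ^ 2 = s.1 ^ 3 + 22 * s.1 ^ 2 + 18 * s.1 + 6)
        (by norm_num) eA eB eC (fun x y h => by simpa using h) h2 hT
      rwa [h1] at this
  let e := (AddCommGroup.torsion (exampleCurve w).toAffine.Point).equivMapOfInjective H.hom H.hom_injective
  obtain ⟨hfin, hcard⟩ := key
  exact ⟨Finite.of_equiv _ e.symm.toEquiv, (Nat.card_congr e.toEquiv).trans_le hcard⟩

/-- The two points generate a subgroup of order 24 inside a torsion group of order at most 24. -/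
theorem exampleCurve_closure [DecidableEq (QSqrt 13)] {w : QSqrt 13} (hw : w ^ 2 = 13) :
    (exampleCurve w).IsElliptic ∧
    Nonempty (AddCommGroup.torsion (exampleCurve w).toAffine.Point ≃+ ZMod 2 × ZMod 12) ∧
    ∃ (h₁ : (exampleCurve w).toAffine.Nonsingular (954691712 - 264783840 * w)
        (42132429627392 * w - 151910635381440))
      (h₂ : (exampleCurve w).toAffine.Nonsingular (3993089880 - 1107483870 * w)
        (176222937989280 * w - 635380838833260)),
      AddSubgroup.closure {Affine.Point.some _ _ h₁, Affine.Point.some _ _ h₂} =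
        AddCommGroup.torsion (exampleCurve w).toAffine.Point := by
  obtain ⟨hell, hP, hQ, oP, oQ, hPQ⟩ := exampleCurve_points hw
  obtain ⟨e⟩ := AddSubgroup.nonempty_closure_pair_equiv oP oQ hPQ
  obtain ⟨hfin, hcard⟩ := exampleCurve_card_torsion hw
  have heq : AddSubgroup.closure {Affine.Point.some _ _ hP, Affine.Point.some _ _ hQ} =
      AddCommGroup.torsion (exampleCurve w).toAffine.Point := by
    apply AddSubgroup.eq_of_le_of_card_ge
    · rw [AddSubgroup.closure_le]
      rintro _ (rfl | rfl)
      · exact addOrderOf_pos_iff.1 (by rw [oP]; norm_num)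
      · exact addOrderOf_pos_iff.1 (by rw [oQ]; norm_num)
    · rw [Nat.card_congr e.toEquiv, Nat.card_prod, Nat.card_zmod, Nat.card_zmod]
      exact hcard
  exact ⟨hell, ⟨heq ▸ e⟩, hP, hQ, heq⟩

end Torsion

/-! ### Assembly of the statements about ℚ(√13). -/

section Main

theorem twoTwelveAppearsOver_qSqrt_thirteen : TwoTwelveAppearsOver (QSqrt 13) := by
  let : DecidableEq (QSqrt 13) := fun _ _ => Classical.propDecidable _
  obtain ⟨w, hw⟩ := QSqrt.exists_sq_eq 13
  obtain ⟨hell, ht, -⟩ := exampleCurve_closure (w := w) (by rw [hw]; norm_cast)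
  exact ⟨exampleCurve w, hell, ht⟩

theorem hasPositiveRank_qSqrt_thirteen : X₁TwoTwelveHasPositiveRank (QSqrt 13) :=
  X₁_hasPositiveRank_of_twoTwelveAppears (QSqrt.finrank_eq not_isSquare_thirteen)
    twoTwelveAppearsOver_qSqrt_thirteen

theorem abs_discr_qSqrt_thirteen_le {K : Type*} [Field K] [NumberField K]
    (hK : Module.finrank ℚ K = 2) (h : X₁TwoTwelveHasPositiveRank K) :
    |NumberField.discr (QSqrt 13)| ≤ |NumberField.discr K| ∧
      (|NumberField.discr K| = |NumberField.discr (QSqrt 13)| → Nonempty (K ≃+* QSqrt 13)) := by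
  rw [QSqrt.discr_thirteen]
  exact le_abs_discr_of_positiveRank hK h

end Main

theorem theorem10 :
    -- `ℚ(√13)` is a quadratic field of discriminant `13`
    (Module.finrank ℚ (QSqrt 13) = 2 ∧ NumberField.discr (QSqrt 13) = 13) ∧
    -- it is the quadratic field of smallest `|Δ|` over which `ℤ/2ℤ ⊕ ℤ/12ℤ` appears
    (TwoTwelveAppearsOver (QSqrt 13) ∧
      ∀ (K : Type u) [Field K] [NumberField K], Module.finrank ℚ K = 2 →
        TwoTwelveAppearsOver K →
          |NumberField.discr (QSqrt 13)| ≤ |NumberField.discr K| ∧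
          (|NumberField.discr K| = |NumberField.discr (QSqrt 13)| →
            Nonempty (K ≃+* QSqrt 13))) ∧
    -- it is the quadratic field of smallest `|Δ|` over which `X₁(2,12)` has positive rank
    (X₁TwoTwelveHasPositiveRank (QSqrt 13) ∧
      ∀ (K : Type u) [Field K] [NumberField K], Module.finrank ℚ K = 2 →
        X₁TwoTwelveHasPositiveRank K →
          |NumberField.discr (QSqrt 13)| ≤ |NumberField.discr K| ∧
          (|NumberField.discr K| = |NumberField.discr (QSqrt 13)| →
            Nonempty (K ≃+* QSqrt 13))) ∧
    -- the `K`-points of `X₁(2,12)` other than the cusps classify the triples over `K`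
    (∀ (K : Type u) [Field K] [NumberField K], Module.finrank ℚ K = 2 →
      (∀ R : (X₁TwoTwelve⁄K).toAffine.Point, ¬ IsX₁Cusp R →
        ∃ T : TwoTwelveTriple K, Represents R T) ∧
      (∀ T : TwoTwelveTriple K,
        ∃! R : (X₁TwoTwelve⁄K).toAffine.Point, ¬ IsX₁Cusp R ∧ Represents R T)) ∧
    -- the torsion of `X₁(2,12)` over `ℚ` and over all quadratic fields
    HasTorsionFour (X₁TwoTwelve⁄ℚ) ∧
    (∀ (K : Type u) [Field K] [NumberField K], Module.finrank ℚ K = 2 →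
      (IsEmpty (K ≃+* QSqrt (-1)) → IsEmpty (K ≃+* QSqrt 3) → IsEmpty (K ≃+* QSqrt (-3)) →
        (∀ R, R ∈ torsionPoints (X₁TwoTwelve⁄K) ↔
            ∃ S ∈ torsionPoints (X₁TwoTwelve⁄ℚ), X₁TwoTwelveBaseChange K S = R) ∧
          HasTorsionFour (X₁TwoTwelve⁄K)) ∧
      (∀ R ∈ torsionPoints (X₁TwoTwelve⁄K), IsX₁Cusp R)) ∧
    -- an explicit elliptic curve over `ℚ(√13)`, with generators of its torsion group
    (∀ w : QSqrt 13, w ^ 2 = 13 →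
      (exampleCurve w).IsElliptic ∧ HasTorsionTwoTwelve (exampleCurve w) ∧
      GenerateTorsion (exampleCurve w)
        (954691712 - 264783840 * w) (42132429627392 * w - 151910635381440)
        (3993089880 - 1107483870 * w) (176222937989280 * w - 635380838833260)) := by
  classical
  refine ⟨⟨QSqrt.finrank_eq not_isSquare_thirteen, QSqrt.discr_thirteen⟩,
    ⟨twoTwelveAppearsOver_qSqrt_thirteen, fun K _ _ hK h =>
      abs_discr_qSqrt_thirteen_le hK (X₁_hasPositiveRank_of_twoTwelveAppears hK h)⟩,
    ⟨hasPositiveRank_qSqrt_thirteen, fun K _ _ hK h => abs_discr_qSqrt_thirteen_le hK h⟩,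
    fun K _ _ hK => ⟨fun R hR => exists_represents hR, fun T => ?_⟩, ?_,
    fun K _ _ hK => ⟨fun h1 h3 h3' => X₁_torsion_quadratic hK h1 h3 h3',
      fun R hR => isX₁Cusp_of_mem_torsionPoints hK hR⟩,
    fun w hw => ?_⟩
  · obtain ⟨R, hR, h⟩ := exists_point_represents T
    exact ⟨R, ⟨hR, h⟩, fun R' h' => represents_unique h'.1 hR h'.2 h⟩
  · let : DecidableEq ℚ := fun _ _ => Classical.propDecidable _
    exact X₁_torsion_rat.2
  · let : DecidableEq (QSqrt 13) := fun _ _ => Classical.propDecidable _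
    exact exampleCurve_closure hw
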